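/- Let $n\ge 0$, let $G=\mathrm{GL}_n(\mathbb C)$, let $B\subset G$ be the subgroup of invertible upper triangular matrices and $\mathfrak n$ the space of strictly upper triangular $n\times n$ matrices; $G$ acts on matrices by $g.x=gxg^{-1}$. All closures and irreducibility are with respect to Zariski topologies, and irreducible sets are non-empty. Let $\mathbf S_n^2=\{\sigma\in S_n:\sigma^2=1\}$. For $\sigma\in\mathbf S_n^2$ let $N_\sigma$ be the matrix with $(N_\sigma)_{i,j}=1$ if $i<j$ and $\sigma(i)=j$, and $0$ otherwise. For $x\in\mathfrak n$ let $R_x$ be the matrix with $(R_x)_{i,j}=0$ for $i\ge j$ and, for $i<j$, $(R_x)_{i,j}$ the rank of the submatrix of $x$ on rows and columns $i,\dots,j$. Put $R_\sigma=R_{N_\sigma}$, $\mathbf R_n^2=\{R_\sigma:\sigma\in\mathbf S_n^2\}$, and $(R_{\sigma,\sigma'})_{i,j}=\min\{(R_\sigma)_{i,j},(R_{\sigma'})_{i,j}\}$; write $A\preceq A'$ if $A_{i,j}\le A'_{i,j}$ for all $i,j$. **Theorem.** (1) For all $\sigma,\sigma'\in\mathbf S_n^2$, $$\overline{B.N_\sigma}\cap\overline{B.N_{\sigma'}}=\coprod_{\varsigma\in\mathbf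 S_n^2,\ R_\varsigma\preceq R_{\sigma,\sigma'}}B.N_\varsigma ,$$ where the union is disjoint, orbits of distinct involutions being disjoint; and this intersection is irreducible if and only if $R_{\sigma,\sigma'}\in\mathbf R_n^2$. (2) Let $\mu$ be a Young diagram with $n$ boxes and at most two columns. For a nilpotent endomorphism $u$ let $J(u)$ be the Young diagram whose rows are the sizes of the Jordan blocks of $u$, and let $\mathcal O_\mu$ be the set of nilpotent $n\times n$ matrices $u$ with $J(u)=\mu$. For a standard Young tableau $T$ of shape $\mu$ and $1\le m\le n$ let $T_{\le m}$ be the subtableau of entries at most $m$. Let $\mathcal V_T$ be the closure in $\mathcal O_\mu$ of the set of $u\in\mathcal O_\mu\cap\mathfrak n$ such that, for all $m$, the upper left $m\times m$ block of $u$ has Jordan type the shape of $T_{\le m}$. Let $j_1<\dots<j_k$ be the entries of the second column of $T$, let $i_s$ be the largest $d<j_s$ in the first column different from $i_1,\dots,i_{s-1}$, for $s=1,\dots,k$, and let $\sigma_T=(i_1,j_1)\cdots(i_k,j_k)$. Then for all standard tableaux $T,T'$ of shape $\mu$, $\mathcal V_T\cap\mathcal V_{T'}$ is irreducible if and only if $R_{\sigma_T,\sigma_{T'}}\in\mathbf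 R_n^2$. (3) Let moreover $x\in\mathcal O_\mu\cap\mathfrak n$, and let $\mathcal F_x=\{gB\in G/B: g^{-1}.x\in\mathfrak n\}$ be its Springer fiber. For $gB\in\mathcal F_x$ let $V_m$ be the span of the first $m$ columns of $g$, which is $x$-stable. Let $\mathcal F_T$ be the closure of the set of $gB\in\mathcal F_x$ such that $J(x|_{V_m})$ is the shape of $T_{\le m}$ for all $1\le m\le n$. Then for all standard tableaux $T,T'$ of shape $\mu$, $\mathcal F_T\cap\mathcal F_{T'}$ is irreducible if and only if $R_{\sigma_T,\sigma_{T'}}\in\mathbf R_n^2$. -/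

import Mathlib

open scoped Topology MatrixGroups

noncomputable section

/-! ## Zariski topologies -/

/-- The Zariski topology on the affine space of complex `n × n` matrices: the closed sets are the
common zero sets of families of polynomials in the matrix entries. -/
@[reducible] def matZariski (n : ℕ) : TopologicalSpace (Matrix (Fin n) (Fin n) ℂ) :=
  TopologicalSpace.ofClosed
    {Z | ∃ S : Set (MvPolynomial (Fin n × Fin n) ℂ),
      Z = {x | ∀ p ∈ S, MvPolynomial.eval (fun c => x c.1 c.2) p = 0}}
    ⟨{1}, by ext x; simp⟩
    (by
      intro A hA
      refine ⟨{p | ∃ Z ∈ A, ∀ x ∈ Z, MvPolynomial.eval (fun c => x c.1 c.2) p = 0}, ?_⟩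
      ext x
      constructor
      · rintro hx p ⟨Z, hZ, hp⟩
        exact hp x (hx Z hZ)
      · intro hx Z hZ
        obtain ⟨S, rfl⟩ := hA hZ
        exact fun p hp => hx p ⟨_, hZ, fun y hy => hy p hp⟩)
    (by
      rintro _ ⟨S, rfl⟩ _ ⟨S', rfl⟩
      refine ⟨{r | ∃ p ∈ S, ∃ q ∈ S', r = p * q}, ?_⟩
      ext x
      constructor
      · rintro (hx | hx) _ ⟨p, hp, q, hq, rfl⟩
        · simp [hx p hp]
        · simp [hx q hq]
      · intro hx
        by_contra hcon
        simp only [Set.mem_union, Set.mem_ofPred_eq, not_or, not_forall] at hcon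
        obtain ⟨⟨p, hp, hp0⟩, q, hq, hq0⟩ := hcon
        have h := hx _ ⟨p, hp, q, hq, rfl⟩
        rw [map_mul] at h
        exact (mul_ne_zero hp0 hq0) h)

/-- The Zariski topology on `GL_n(ℂ)`, a principal open subset of the space of matrices. -/
@[reducible] def glZariski (n : ℕ) : TopologicalSpace (GL (Fin n) ℂ) :=
  TopologicalSpace.induced (fun g => (g : Matrix (Fin n) (Fin n) ℂ)) (matZariski n)

/-! ## The Borel subgroup, the nilradical, the flag manifold -/

/-- The group `B` of invertible upper triangular matrices. -/
def upperGroup (n : ℕ) : Subgroup (GL (Fin n) ℂ) where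
  carrier := {g | (g : Matrix (Fin n) (Fin n) ℂ).BlockTriangular id}
  one_mem' := by
    simpa using (Matrix.blockTriangular_one : (1 : Matrix (Fin n) (Fin n) ℂ).BlockTriangular id)
  mul_mem' := by
    intro a b ha hb
    simpa using Matrix.BlockTriangular.mul ha hb
  inv_mem' := by
    intro a ha
    have : Invertible (a : Matrix (Fin n) (Fin n) ℂ) := a.invertible
    simpa using Matrix.blockTriangular_inv_of_blockTriangular ha

/-- The space of strictly upper triangular matrices. -/
def strictlyUpper (n : ℕ) : Set (Matrix (Fin n) (Fin n) ℂ) :=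
  {x | ∀ i j, j ≤ i → x i j = 0}

/-- The adjoint action `g.x = g x g⁻¹`. -/
def adj {n : ℕ} (g : GL (Fin n) ℂ) (x : Matrix (Fin n) (Fin n) ℂ) : Matrix (Fin n) (Fin n) ℂ :=
  (g : Matrix (Fin n) (Fin n) ℂ) * x * ((g⁻¹ : GL (Fin n) ℂ) : Matrix (Fin n) (Fin n) ℂ)

/-- The orbit `B.x`. -/
def borelOrbit {n : ℕ} (x : Matrix (Fin n) (Fin n) ℂ) : Set (Matrix (Fin n) (Fin n) ℂ) :=
  {y | ∃ b ∈ upperGroup n, y = adj b x}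

/-- The flag manifold `G/B`. -/
abbrev FlagManifold (n : ℕ) : Type := GL (Fin n) ℂ ⧸ upperGroup n

/-- The Zariski topology of the variety `G/B`: the quotient of that of `G`. -/
@[reducible] def flagZariski (n : ℕ) : TopologicalSpace (FlagManifold n) :=
  TopologicalSpace.coinduced (fun g : GL (Fin n) ℂ => (g : FlagManifold n)) (glZariski n)

/-! ## Involutions and rank matrices -/

/-- The set of `σ ∈ S_n` with `σ² = 1`. -/
def involutions (n : ℕ) : Set (Equiv.Perm (Fin n)) := {σ | σ ^ 2 = 1}

/-- The strictly upper triangular part `N_σ` of the permutation matrix of `σ`. -/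
def upperPart {n : ℕ} (σ : Equiv.Perm (Fin n)) : Matrix (Fin n) (Fin n) ℂ :=
  Matrix.of fun i j => if i < j ∧ σ i = j then 1 else 0

/-- The submatrix of `x` on the rows and columns indexed by `s`. -/
def principalBlock {n : ℕ} (s : Finset (Fin n)) (x : Matrix (Fin n) (Fin n) ℂ) :
    Matrix s s ℂ :=
  x.submatrix (fun k => (k : Fin n)) (fun k => (k : Fin n))

/-- The rank matrix `R_x`: for `i < j`, its entry is the rank of the block of `x` on the rows and
columns `i, …, j`. -/
def rankMatrix {n : ℕ} (x : Matrix (Fin n) (Fin n) ℂ) : Matrix (Fin n) (Fin n) ℕ :=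
  Matrix.of fun i j => if i < j then (principalBlock (Finset.Icc i j) x).rank else 0

/-- `R_σ`, the rank matrix of `N_σ`. -/
def invRankMatrix {n : ℕ} (σ : Equiv.Perm (Fin n)) : Matrix (Fin n) (Fin n) ℕ :=
  rankMatrix (upperPart σ)

/-- The set of the rank matrices `R_σ` of all involutions. -/
def involutionRankMatrices (n : ℕ) : Set (Matrix (Fin n) (Fin n) ℕ) :=
  invRankMatrix '' involutions n

/-- The entrywise order on matrices of natural numbers. -/
def EntrywiseLE {n : ℕ} (A A' : Matrix (Fin n) (Fin n) ℕ) : Prop :=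
  ∀ i j, A i j ≤ A' i j

/-- `R_{σ,σ'}`, the entrywise minimum of `R_σ` and `R_σ'`. -/
def minRankMatrix {n : ℕ} (σ σ' : Equiv.Perm (Fin n)) : Matrix (Fin n) (Fin n) ℕ :=
  Matrix.of fun i j => min (invRankMatrix σ i j) (invRankMatrix σ' i j)

/-! ## Jordan types and Young tableaux -/

/-- The boxes (row, column), numbered from `0`, of the Young diagram whose rows are the sizes of
the Jordan blocks of a nilpotent endomorphism `f`: column `m` has as many boxes as there are
blocks of size greater than `m`, namely `rank (f ^ m) - rank (f ^ (m + 1))`. -/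
def jordanBoxes {V : Type*} [AddCommGroup V] [Module ℂ V] (f : V →ₗ[ℂ] V) : Set (ℕ × ℕ) :=
  {c | c.1 < Module.finrank ℂ (LinearMap.range (f ^ c.2)) -
    Module.finrank ℂ (LinearMap.range (f ^ (c.2 + 1)))}

/-- Young tableaux of shape `μ` filled with the `n` elements of `Fin n`, where `v : Fin n`
stands for the integer `v + 1`: entries increase along rows and down columns. -/
structure Tableau (n : ℕ) (μ : YoungDiagram) where
  /-- the entry in each box -/
  entry : μ.cells ≃ Fin n
  row_lt : ∀ c d : μ.cells, c.1.1 = d.1.1 → c.1.2 < d.1.2 → entry c < entry d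
  col_lt : ∀ c d : μ.cells, c.1.2 = d.1.2 → c.1.1 < d.1.1 → entry c < entry d

/-- The boxes of `T` whose entry is at most `m`. -/
def Tableau.boxesUpTo {n : ℕ} {μ : YoungDiagram} (T : Tableau n μ) (m : Fin n) : Set (ℕ × ℕ) :=
  {c | ∃ h : c ∈ μ.cells, T.entry ⟨c, h⟩ ≤ m}

/-- The set of entries of `T` in column `c`, where the columns are numbered from `0`. -/
def Tableau.column {n : ℕ} {μ : YoungDiagram} (T : Tableau n μ) (c : ℕ) : Finset (Fin n) :=
  Finset.univ.filter fun v => (T.entry.symm v).1.2 = c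

/-- Greedy matching: `greedyInvolution [j₁, …, j_k] A` is the product of the transpositions
`(i_s, j_s)`, where `i_s` is the largest `d < j_s` in `A` other than `i₁, …, i_{s-1}`. (If there
is no such `d`, the element `j_s` is skipped; this does not occur for the columns of a tableau.) -/
def greedyInvolution {n : ℕ} : List (Fin n) → Finset (Fin n) → Equiv.Perm (Fin n)
  | [], _ => 1
  | j :: js, A =>
    if h : (A.filter fun d => d < j).Nonempty then
      Equiv.swap ((A.filter fun d => d < j).max' h) j *
        greedyInvolution js (A.erase ((A.filter fun d => d < j).max' h))
    else greedyInvolution js A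

/-- The involution `σ_T` of a tableau `T` with at most two columns. -/
def Tableau.involution {n : ℕ} {μ : YoungDiagram} (T : Tableau n μ) : Equiv.Perm (Fin n) :=
  greedyInvolution ((T.column 1).sort (fun a b => a ≤ b)) (T.column 0)

/-! ## Orbital varieties and components of Springer fibers -/

/-- The nilpotent orbit of all nilpotent matrices of Jordan type `μ`. -/
def nilpotentOrbit (n : ℕ) (μ : YoungDiagram) : Set (Matrix (Fin n) (Fin n) ℂ) :=
  {x | IsNilpotent x ∧ jordanBoxes (Matrix.toLin' x) = ↑μ.cells}

/-- The strictly upper triangular matrices `u` of Jordan type `μ` such that, for every `m`, the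
Jordan type of the upper left block of `u` of size `m` is the shape of the subtableau of `T` with
entries `1, …, m`. -/
def orbitalStratum {n : ℕ} {μ : YoungDiagram} (T : Tableau n μ) :
    Set (Matrix (Fin n) (Fin n) ℂ) :=
  {u | u ∈ strictlyUpper n ∧ u ∈ nilpotentOrbit n μ ∧
    ∀ m : Fin n,
      jordanBoxes (Matrix.toLin' (principalBlock (Finset.Iic m) u)) = T.boxesUpTo m}

/-- The orbital variety `V_T`: the closure of the stratum of `T` in the nilpotent orbit. -/
def orbitalVariety {n : ℕ} {μ : YoungDiagram} (T : Tableau n μ) :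
    Set (Matrix (Fin n) (Fin n) ℂ) :=
  closure[matZariski n] (orbitalStratum T) ∩ nilpotentOrbit n μ

/-- The Springer fiber `{gB | g⁻¹.x is strictly upper triangular}`. -/
def springerFiber {n : ℕ} (x : Matrix (Fin n) (Fin n) ℂ) : Set (FlagManifold n) :=
  (fun g : GL (Fin n) ℂ => (g : FlagManifold n)) '' {g | adj g⁻¹ x ∈ strictlyUpper n}

/-- The member of the flag `gB` spanned by the columns of `g` up to the one with index `m`. -/
def flagSpace {n : ℕ} (g : GL (Fin n) ℂ) (m : Fin n) : Submodule ℂ (Fin n → ℂ) :=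
  Submodule.span ℂ {v | ∃ k ≤ m, v = (g : Matrix (Fin n) (Fin n) ℂ).col k}

/-- The flags `ξ = gB` of the Springer fiber over `x` such that, for every `m`, the Jordan type of
the restriction of `x` to the `m`-dimensional member of `ξ` is the shape of the subtableau of `T`
with entries `1, …, m`. -/
def springerStratum {n : ℕ} {μ : YoungDiagram} (x : Matrix (Fin n) (Fin n) ℂ)
    (T : Tableau n μ) : Set (FlagManifold n) :=
  (fun g : GL (Fin n) ℂ => (g : FlagManifold n)) '' {g | adj g⁻¹ x ∈ strictlyUpper n ∧
    ∀ m : Fin n, ∃ h : ∀ v ∈ flagSpace g m, Matrix.toLin' x v ∈ flagSpace g m,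
      jordanBoxes ((Matrix.toLin' x).restrict h) = T.boxesUpTo m}

/-- The irreducible component `F_T` of the Springer fiber over `x`: the closure of the stratum
of `T`. (The Springer fiber is closed in the flag manifold.) -/
def springerComponent {n : ℕ} {μ : YoungDiagram} (x : Matrix (Fin n) (Fin n) ℂ)
    (T : Tableau n μ) : Set (FlagManifold n) :=
  closure[flagZariski n] (springerStratum x T)

end

/-! Elimination along the flag shows that `B` has finitely many orbits on strictly upper triangular
matrices of square zero, one through N_σ for each involution σ. The entries of R_σ count the links p
< σ p inside intervals; `linkCount σ a b` uses the half-open interval [a, b) of indices starting at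
0, so that the end points can be moved one at a time.

The central fact is `closure_borelOrbit`: among square-zero matrices, the closure of B.N_σ is cut
out by R_x ≼ R_σ. One inclusion is semicontinuity of rank. For the other, let R_τ ≼ R_σ. If the
counts of σ on intervals separating i from i + 1 are not as small as possible, they are as large as
possible, s_i σ s_i is strictly smaller, and the closure of B.N_σ contains all translates of the
closure of B.N_{s_i σ s_i} by the minimal parabolic P_i (`closure_invariant_parabolic`). As τ or s_i
τ s_i lies below s_i σ s_i (`exists_linkLE_conjSwap`), induction applies. When no such i is left,
the closure contains a linear space through all N_τ with τ below σ (`mem_closure_of_isMinAt`). No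
dimension theory enters: an irreducible set of square-zero matrices lies in the closure of one of
the finitely many orbits that meet it, and the order on rank matrices identifies that orbit.

If the minimum of R_σ and R_σ' is some R_τ, the intersection of the closures is the closure of
B.N_τ, hence irreducible. Conversely, each single entry of the minimum is attained inside the
intersection, by the explicit smallest involution with a given number of links in a given interval
(`exists_least_involution`). If the intersection is irreducible, it lies in the closure of one of
its own orbits, whose rank matrix must then be the minimum.

For a tableau T, the matching σ_T is noncrossing and has no fixed point under an arc, so it is the
largest involution whose right end points form the second column (`linkLE_of_noncrossing`). Hence
V_T is the part of the closure of B.N_{σ_T} inside the nilpotent orbit. The previous argument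
applies again, because the smallest involution can be chosen with the prescribed total number of
links. Finally, the maps from G to G/B and g ↦ g⁻¹.x from G to the nilpotent orbit are continuous
and open with irreducible fibres, and the preimages of F_T and V_T in G coincide; irreducibility
therefore passes between the two settings. -/

noncomputable section

/-! ## Polynomial functions on matrices and regular functions on `GL_n` -/

/-- The algebra of polynomial functions on the space of matrices. -/
def polyFun (n : ℕ) : Subalgebra ℂ (Matrix (Fin n) (Fin n) ℂ → ℂ) :=
  (MvPolynomial.aeval (fun (c : Fin n × Fin n) (x : Matrix (Fin n) (Fin n) ℂ) => x c.1 c.2)).range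

theorem mem_polyFun {n : ℕ} {φ : Matrix (Fin n) (Fin n) ℂ → ℂ} :
    φ ∈ polyFun n ↔ ∃ p : MvPolynomial (Fin n × Fin n) ℂ,
      ∀ x, φ x = MvPolynomial.eval (fun c => x c.1 c.2) p := by
  have key : ∀ (p : MvPolynomial (Fin n × Fin n) ℂ) (x : Matrix (Fin n) (Fin n) ℂ),
      (MvPolynomial.aeval (fun (c : Fin n × Fin n) (x : Matrix (Fin n) (Fin n) ℂ) => x c.1 c.2) p) x
        = MvPolynomial.eval (fun c => x c.1 c.2) p := by
    intro p x
    induction p using MvPolynomial.induction_on with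
    | C a => simp [Pi.algebraMap_apply]
    | add p q hp hq => simp [hp, hq]
    | mul_X p i hp => simp [hp]
  constructor
  · rintro ⟨p, rfl⟩
    exact ⟨p, fun x => key p x⟩
  · rintro ⟨p, hp⟩
    exact ⟨p, funext fun x => (key p x).trans (hp x).symm⟩

theorem entry_mem_polyFun {n : ℕ} (i j : Fin n) :
    (fun x : Matrix (Fin n) (Fin n) ℂ => x i j) ∈ polyFun n :=
  mem_polyFun.2 ⟨MvPolynomial.X (i, j), by simp⟩

theorem const_mem_polyFun {n : ℕ} (a : ℂ) :
    (fun _ : Matrix (Fin n) (Fin n) ℂ => a) ∈ polyFun n :=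
  (polyFun n).algebraMap_mem a

/-- A matrix of functions in a subalgebra has determinant in the subalgebra. -/
theorem det_mem_subalgebra {X m : Type*} [Fintype m] [DecidableEq m] (A : Subalgebra ℂ (X → ℂ))
    (M : X → Matrix m m ℂ) (hM : ∀ i j, (fun x => M x i j) ∈ A) :
    (fun x => (M x).det) ∈ A := by
  have : (fun x => (M x).det) = ∑ σ : Equiv.Perm m,
      (((Equiv.Perm.sign σ : ℤ) : ℂ)) • ∏ i, (fun x => M x (σ i) i) := by
    funext x
    simp [Matrix.det_apply', Finset.sum_apply]
  rw [this]
  exact sum_mem fun σ _ => A.smul_mem (prod_mem fun i _ => hM _ _) _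

theorem adjugate_mem_subalgebra {X m : Type*} [Fintype m] [DecidableEq m]
    (A : Subalgebra ℂ (X → ℂ))
    (M : X → Matrix m m ℂ) (hM : ∀ i j, (fun x => M x i j) ∈ A) (i j : m) :
    (fun x => (M x).adjugate i j) ∈ A := by
  simp only [Matrix.adjugate_apply]
  refine det_mem_subalgebra A _ fun k l => ?_
  by_cases h : k = j
  · subst h
    simp only [Matrix.updateRow_self]
    exact A.algebraMap_mem _
  · simp only [Matrix.updateRow_ne h]
    exact hM k l

theorem mul_mem_subalgebra {X l m k : Type*} [Fintype m] (A : Subalgebra ℂ (X → ℂ))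
    (M : X → Matrix l m ℂ) (N : X → Matrix m k ℂ) (hM : ∀ i j, (fun x => M x i j) ∈ A)
    (hN : ∀ i j, (fun x => N x i j) ∈ A) (i : l) (j : k) :
    (fun x => (M x * N x) i j) ∈ A := by
  have : (fun x => (M x * N x) i j) = ∑ r, (fun x => M x i r) * (fun x => N x r j) := by
    funext x
    simp [Matrix.mul_apply, Finset.sum_apply]
  rw [this]
  exact sum_mem fun r _ => mul_mem (hM _ _) (hN _ _)

theorem polyFun_comp {n : ℕ} {X : Type*} (A : Subalgebra ℂ (X → ℂ))
    (F : X → Matrix (Fin n) (Fin n) ℂ) (hF : ∀ i j, (fun x => F x i j) ∈ A)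
    {φ : Matrix (Fin n) (Fin n) ℂ → ℂ} (hφ : φ ∈ polyFun n) : (fun x => φ (F x)) ∈ A := by
  obtain ⟨p, hp⟩ := mem_polyFun.1 hφ
  simp only [hp]
  clear hp hφ
  induction p using MvPolynomial.induction_on with
  | C a =>
    simp only [MvPolynomial.eval_C]
    exact A.algebraMap_mem a
  | add p q hp hq =>
    simp only [map_add]
    exact add_mem hp hq
  | mul_X p i hp =>
    simp only [map_mul, MvPolynomial.eval_X]
    exact mul_mem hp (hF _ _)

/-- The algebra of regular functions on `GL_n`: polynomials divided by powers of `det`. -/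
def regFun (n : ℕ) : Subalgebra ℂ (GL (Fin n) ℂ → ℂ) where
  carrier := {φ | ∃ d : ℕ, ∃ q ∈ polyFun n, ∀ g : GL (Fin n) ℂ,
    φ g * (g : Matrix (Fin n) (Fin n) ℂ).det ^ d = q g}
  mul_mem' := by
    rintro φ ψ ⟨d, q, hq, h⟩ ⟨d', q', hq', h'⟩
    refine ⟨d + d', q * q', mul_mem hq hq', fun g => ?_⟩
    simp only [Pi.mul_apply, ← h, ← h', pow_add]
    ring
  add_mem' := by
    rintro φ ψ ⟨d, q, hq, h⟩ ⟨d', q', hq', h'⟩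
    have hdet := det_mem_subalgebra (polyFun n) (fun x => x) entry_mem_polyFun
    refine ⟨d + d', q * (fun x => x.det) ^ d' + q' * (fun x => x.det) ^ d,
      add_mem (mul_mem hq (pow_mem hdet _)) (mul_mem hq' (pow_mem hdet _)), fun g => ?_⟩
    simp only [Pi.mul_apply, Pi.add_apply, Pi.pow_apply, ← h, ← h', pow_add]
    ring
  algebraMap_mem' a := ⟨0, algebraMap _ _ a, (polyFun n).algebraMap_mem a, fun g => by simp⟩

theorem polyFun_regFun {n : ℕ} {φ : Matrix (Fin n) (Fin n) ℂ → ℂ} (h : φ ∈ polyFun n) :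
    (fun g : GL (Fin n) ℂ => φ g) ∈ regFun n :=
  ⟨0, φ, h, fun g => by simp⟩

theorem inv_entry_regFun {n : ℕ} (i j : Fin n) :
    (fun g : GL (Fin n) ℂ => ((g⁻¹ : GL (Fin n) ℂ) : Matrix (Fin n) (Fin n) ℂ) i j) ∈ regFun n := by
  refine ⟨1, fun x => x.adjugate i j,
    adjugate_mem_subalgebra (polyFun n) (fun x => x) entry_mem_polyFun i j, fun g => ?_⟩
  have hg : IsUnit (g : Matrix (Fin n) (Fin n) ℂ).det :=
    (Matrix.isUnit_iff_isUnit_det _).1 g.isUnit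
  beta_reduce
  rw [Matrix.coe_units_inv, Matrix.inv_def, Matrix.smul_apply, smul_eq_mul, pow_one,
    mul_comm, ← mul_assoc, Ring.mul_inverse_cancel _ hg, one_mul]

theorem adj_entry_regFun {n : ℕ} (x : Matrix (Fin n) (Fin n) ℂ) (i j : Fin n) :
    (fun g : GL (Fin n) ℂ => adj g x i j) ∈ regFun n := by
  refine mul_mem_subalgebra (regFun n) _ _ (mul_mem_subalgebra (regFun n) _ _
    (fun i j => polyFun_regFun (entry_mem_polyFun i j)) fun i j => (regFun n).algebraMap_mem _)
    inv_entry_regFun i j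

theorem adj_inv_entry_regFun {n : ℕ} (x : Matrix (Fin n) (Fin n) ℂ) (i j : Fin n) :
    (fun g : GL (Fin n) ℂ => adj g⁻¹ x i j) ∈ regFun n := by
  refine mul_mem_subalgebra (regFun n) _ _ (mul_mem_subalgebra (regFun n) _ _
    inv_entry_regFun fun i j => (regFun n).algebraMap_mem _) ?_ i j
  intro i j
  simpa using polyFun_regFun (entry_mem_polyFun i j)

/-! ## The Zariski topologies -/

theorem matZariski_isClosed_iff {n : ℕ} {Z : Set (Matrix (Fin n) (Fin n) ℂ)} :
    IsClosed[matZariski n] Z ↔ ∃ S ⊆ (polyFun n : Set (Matrix (Fin n) (Fin n) ℂ → ℂ)),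
      Z = {x | ∀ φ ∈ S, φ x = 0} := by
  have h1 : IsClosed[matZariski n] Z ↔ ∃ S : Set (MvPolynomial (Fin n × Fin n) ℂ),
      Z = {x | ∀ p ∈ S, MvPolynomial.eval (fun c => x c.1 c.2) p = 0} := by
    rw [← @isOpen_compl_iff _ _ (matZariski n)]
    change Zᶜᶜ ∈ _ ↔ _
    rw [compl_compl]
    rfl
  rw [h1]
  constructor
  · rintro ⟨S, rfl⟩
    refine ⟨(fun p x => MvPolynomial.eval (fun c => x c.1 c.2) p) '' S, ?_, ?_⟩
    · rintro _ ⟨p, _, rfl⟩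
      exact mem_polyFun.2 ⟨p, fun _ => rfl⟩
    · ext x
      simp
  · rintro ⟨S, hS, rfl⟩
    refine ⟨{p | (fun x : Matrix (Fin n) (Fin n) ℂ =>
      MvPolynomial.eval (fun c => x c.1 c.2) p) ∈ S}, ?_⟩
    ext x
    constructor
    · exact fun hx p hp => hx _ hp
    · intro hx φ hφ
      obtain ⟨p, hp⟩ := mem_polyFun.1 (hS hφ)
      obtain rfl : φ = fun x => MvPolynomial.eval (fun c => x c.1 c.2) p := funext hp
      exact hx p hφ

theorem isClosed_zero_polyFun {n : ℕ} {φ : Matrix (Fin n) (Fin n) ℂ → ℂ} (h : φ ∈ polyFun n) :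
    IsClosed[matZariski n] {x | φ x = 0} :=
  matZariski_isClosed_iff.2 ⟨{φ}, by simpa using h, by simp⟩

theorem exists_polyFun_of_mem_isOpen {n : ℕ} {U : Set (Matrix (Fin n) (Fin n) ℂ)}
    (hU : IsOpen[matZariski n] U) {a : Matrix (Fin n) (Fin n) ℂ} (ha : a ∈ U) :
    ∃ φ ∈ polyFun n, φ a ≠ 0 ∧ ∀ x, φ x ≠ 0 → x ∈ U := by
  obtain ⟨S, hS, h⟩ := matZariski_isClosed_iff.1
    ((@isClosed_compl_iff _ (matZariski n) U).2 hU)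
  have ha' : a ∉ Uᶜ := fun h => h ha
  rw [h] at ha'
  simp only [Set.mem_ofPred_eq, not_forall] at ha'
  obtain ⟨φ, hφ, h0⟩ := ha'
  refine ⟨φ, hS hφ, h0, fun x hx => ?_⟩
  by_contra hxU
  have : x ∈ Uᶜ := hxU
  rw [h] at this
  exact hx (this φ hφ)

theorem continuous_matZariski {n : ℕ} {X : Type*} [TopologicalSpace X]
    (F : X → Matrix (Fin n) (Fin n) ℂ) (hF : ∀ φ ∈ polyFun n, IsClosed {x | φ (F x) = 0}) :
    @Continuous _ _ _ (matZariski n) F := by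
  let _ := matZariski n
  refine continuous_iff_isClosed.2 fun Z hZ => ?_
  obtain ⟨S, hS, rfl⟩ := matZariski_isClosed_iff.1 hZ
  have : F ⁻¹' {x | ∀ φ ∈ S, φ x = 0} = ⋂ φ ∈ S, {x | φ (F x) = 0} := by
    ext x; simp
  rw [this]
  exact isClosed_biInter fun φ hφ => hF φ (hS hφ)

/-- Multiplication by a power of `det`, which never vanishes on `GL_n`, clears the denominator and
keeps the zero set. -/
theorem isClosed_zero_regFun {n : ℕ} {φ : GL (Fin n) ℂ → ℂ} (h : φ ∈ regFun n) :
    IsClosed[glZariski n] {g | φ g = 0} := by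
  obtain ⟨d, q, hq, h⟩ := h
  refine (@isClosed_induced_iff _ _ (matZariski n) _ _).2 ⟨_, isClosed_zero_polyFun hq, ?_⟩
  ext g
  have hg : (g : Matrix (Fin n) (Fin n) ℂ).det ≠ 0 :=
    ((Matrix.isUnit_iff_isUnit_det _).1 g.isUnit).ne_zero
  simp only [Set.mem_preimage, Set.mem_ofPred_eq]
  rw [← h g, mul_eq_zero, or_iff_left (pow_ne_zero d hg)]

theorem continuous_mat_of_polyFun {n m : ℕ}
    (F : Matrix (Fin m) (Fin m) ℂ → Matrix (Fin n) (Fin n) ℂ)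
    (hF : ∀ i j, (fun x => F x i j) ∈ polyFun m) :
    @Continuous _ _ (matZariski m) (matZariski n) F := by
  let _ := matZariski m
  exact continuous_matZariski F fun φ hφ => isClosed_zero_polyFun (polyFun_comp _ F hF hφ)

theorem continuous_gl_of_regFun {n m : ℕ} (F : GL (Fin m) ℂ → Matrix (Fin n) (Fin n) ℂ)
    (hF : ∀ i j, (fun x => F x i j) ∈ regFun m) :
    @Continuous _ _ (glZariski m) (matZariski n) F := by
  let _ := glZariski m
  exact continuous_matZariski F fun φ hφ => isClosed_zero_regFun (polyFun_comp _ F hF hφ)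

theorem continuous_adj {n : ℕ} (g : GL (Fin n) ℂ) :
    @Continuous _ _ (matZariski n) (matZariski n) (adj g) := by
  refine continuous_mat_of_polyFun _ fun i j => ?_
  exact mul_mem_subalgebra (polyFun n) (fun x => (g : Matrix (Fin n) (Fin n) ℂ) * x)
    (fun _ => ((g⁻¹ : GL (Fin n) ℂ) : Matrix (Fin n) (Fin n) ℂ))
    (mul_mem_subalgebra (polyFun n) (fun _ => (g : Matrix (Fin n) (Fin n) ℂ)) (fun x => x)
      (fun _ _ => const_mem_polyFun _) entry_mem_polyFun)
    (fun _ _ => const_mem_polyFun _) i j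

theorem continuous_adj_left {n : ℕ} (x : Matrix (Fin n) (Fin n) ℂ) :
    @Continuous _ _ (glZariski n) (matZariski n) (fun g => adj g x) :=
  continuous_gl_of_regFun _ (adj_entry_regFun x)

theorem continuous_adj_inv_left {n : ℕ} (x : Matrix (Fin n) (Fin n) ℂ) :
    @Continuous _ _ (glZariski n) (matZariski n) (fun g => adj g⁻¹ x) :=
  continuous_gl_of_regFun _ (adj_inv_entry_regFun x)

theorem continuous_gl_mul_right {n : ℕ} (h : GL (Fin n) ℂ) :
    @Continuous _ _ (glZariski n) (glZariski n) (fun g => g * h) := by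
  refine continuous_induced_rng.2 (continuous_gl_of_regFun _ fun i j => ?_)
  simp only [Function.comp_apply, Units.val_mul]
  exact mul_mem_subalgebra (regFun n) _ _ (fun i j => polyFun_regFun (entry_mem_polyFun i j))
    (fun i j => (regFun n).algebraMap_mem _) i j

/-! ## Irreducibility of linear sections -/

theorem exists_polynomial_on_line {n : ℕ} {φ : Matrix (Fin n) (Fin n) ℂ → ℂ}
    (hφ : φ ∈ polyFun n) (a b : Matrix (Fin n) (Fin n) ℂ) :
    ∃ q : Polynomial ℂ, ∀ t : ℂ, q.eval t = φ (a + t • (b - a)) := by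
  obtain ⟨p, hp⟩ := mem_polyFun.1 hφ
  refine ⟨MvPolynomial.aeval (fun c : Fin n × Fin n => Polynomial.C (a c.1 c.2) +
    Polynomial.X * Polynomial.C (b c.1 c.2 - a c.1 c.2)) p, fun t => ?_⟩
  rw [hp]
  clear hp
  induction p using MvPolynomial.induction_on with
  | C a => simp
  | add p q hp hq => rw [map_add, map_add, Polynomial.eval_add, hp, hq]
  | mul_X p i hp =>
    rw [map_mul, map_mul, Polynomial.eval_mul, hp]
    simp

/-- On the line through `a` and `b` both functions are nonzero polynomials in one variable, as the
values at t = 0 and t = 1 show, and their product has a non-root. This is the basic source of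
irreducible sets below. -/
theorem exists_ne_zero_on_line {n : ℕ} {φ ψ : Matrix (Fin n) (Fin n) ℂ → ℂ}
    (hφ : φ ∈ polyFun n) (hψ : ψ ∈ polyFun n) {a b : Matrix (Fin n) (Fin n) ℂ}
    (ha : φ a ≠ 0) (hb : ψ b ≠ 0) :
    ∃ t : ℂ, φ (a + t • (b - a)) ≠ 0 ∧ ψ (a + t • (b - a)) ≠ 0 := by
  obtain ⟨p, hp⟩ := exists_polynomial_on_line hφ a b
  obtain ⟨q, hq⟩ := exists_polynomial_on_line hψ a b
  have hp0 : p ≠ 0 := by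
    rintro rfl
    exact ha (by simpa using (hp 0).symm)
  have hq0 : q ≠ 0 := by
    rintro rfl
    exact hb (by simpa using (hq 1).symm)
  by_contra! hcon
  refine mul_ne_zero hp0 hq0 (Polynomial.funext fun t => ?_)
  rw [Polynomial.eval_mul, Polynomial.eval_zero, hp, hq]
  by_cases h : φ (a + t • (b - a)) = 0
  · rw [h, zero_mul]
  · rw [hcon t h, mul_zero]

theorem isPreirreducible_linear_section_mat {n : ℕ} (V : Set (Matrix (Fin n) (Fin n) ℂ))
    (hV : ∀ a ∈ V, ∀ b ∈ V, ∀ t : ℂ, a + t • (b - a) ∈ V) :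
    @IsPreirreducible _ (matZariski n) V := by
  rintro U U' hU hU' ⟨a, ha, haU⟩ ⟨b, hb, hbU⟩
  obtain ⟨φ, hφ, hφa, hφU⟩ := exists_polyFun_of_mem_isOpen hU haU
  obtain ⟨ψ, hψ, hψb, hψU⟩ := exists_polyFun_of_mem_isOpen hU' hbU
  obtain ⟨t, h1, h2⟩ := exists_ne_zero_on_line hφ hψ hφa hψb
  exact ⟨_, hV a ha b hb t, hφU _ h1, hψU _ h2⟩

theorem isPreirreducible_linear_section_gl {n : ℕ} (V : Set (Matrix (Fin n) (Fin n) ℂ))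
    (hV : ∀ a ∈ V, ∀ b ∈ V, ∀ t : ℂ, a + t • (b - a) ∈ V) :
    @IsPreirreducible _ (glZariski n) {g | (g : Matrix (Fin n) (Fin n) ℂ) ∈ V} := by
  rintro U U' hU hU' ⟨a, ha, haU⟩ ⟨b, hb, hbU⟩
  obtain ⟨U, hU, rfl⟩ := hU
  obtain ⟨U', hU', rfl⟩ := hU'
  obtain ⟨φ, hφ, hφa, hφU⟩ := exists_polyFun_of_mem_isOpen hU haU
  obtain ⟨ψ, hψ, hψb, hψU⟩ := exists_polyFun_of_mem_isOpen hU' hbU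
  have hdet := det_mem_subalgebra (polyFun n) (fun x => x) entry_mem_polyFun
  have hdet0 : ∀ g : GL (Fin n) ℂ, (g : Matrix (Fin n) (Fin n) ℂ).det ≠ 0 := fun g =>
    ((Matrix.isUnit_iff_isUnit_det _).1 g.isUnit).ne_zero
  -- The factor `det` forces the chosen point of the line to be invertible.
  obtain ⟨t, h1, h2⟩ := exists_ne_zero_on_line (mul_mem hφ hdet) hψ
    (mul_ne_zero hφa (hdet0 a)) hψb
  have h1' := mul_ne_zero_iff.1 h1
  refine ⟨Matrix.GeneralLinearGroup.mkOfDetNeZero _ h1'.2, hV a ha b hb t, hφU _ h1'.1, hψU _ h2⟩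

/-! ## The adjoint action -/

theorem adj_one {n : ℕ} (x : Matrix (Fin n) (Fin n) ℂ) : adj 1 x = x := by
  simp [adj]

theorem adj_mul {n : ℕ} (g h : GL (Fin n) ℂ) (x : Matrix (Fin n) (Fin n) ℂ) :
    adj (g * h) x = adj g (adj h x) := by
  simp only [adj, mul_inv_rev, Units.val_mul, Matrix.mul_assoc]

theorem adj_inv_adj {n : ℕ} (g : GL (Fin n) ℂ) (x : Matrix (Fin n) (Fin n) ℂ) :
    adj g⁻¹ (adj g x) = x := by
  rw [← adj_mul, inv_mul_cancel, adj_one]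

theorem adj_adj_inv {n : ℕ} (g : GL (Fin n) ℂ) (x : Matrix (Fin n) (Fin n) ℂ) :
    adj g (adj g⁻¹ x) = x := by
  rw [← adj_mul, mul_inv_cancel, adj_one]

theorem adj_mul_adj {n : ℕ} (g : GL (Fin n) ℂ) (x y : Matrix (Fin n) (Fin n) ℂ) :
    adj g x * adj g y = adj g (x * y) := by
  simp only [adj, Matrix.mul_assoc]
  rw [← Matrix.mul_assoc _ (g : Matrix (Fin n) (Fin n) ℂ), ← Units.val_mul, inv_mul_cancel,
    Units.val_one, Matrix.one_mul]

theorem adj_zero {n : ℕ} (g : GL (Fin n) ℂ) : adj g (0 : Matrix (Fin n) (Fin n) ℂ) = 0 := by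
  simp [adj]

theorem eq_adj_iff {n : ℕ} {g : GL (Fin n) ℂ} {x y : Matrix (Fin n) (Fin n) ℂ} :
    y = adj g x ↔ y * (g : Matrix (Fin n) (Fin n) ℂ) = g * x := by
  constructor
  · rintro rfl
    simp only [adj, Matrix.mul_assoc]
    rw [← Units.val_mul, inv_mul_cancel, Units.val_one, Matrix.mul_one]
  · intro h
    rw [adj, ← h, Matrix.mul_assoc, ← Units.val_mul, mul_inv_cancel, Units.val_one, Matrix.mul_one]

theorem rank_adj {n : ℕ} (g : GL (Fin n) ℂ) (x : Matrix (Fin n) (Fin n) ℂ) :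
    (adj g x).rank = x.rank := by
  have h : ∀ (g : GL (Fin n) ℂ) (x : Matrix (Fin n) (Fin n) ℂ), (adj g x).rank ≤ x.rank :=
    fun g x => (Matrix.rank_mul_le_left _ _).trans (Matrix.rank_mul_le_right _ _)
  refine le_antisymm (h g x) ?_
  conv_lhs => rw [← adj_inv_adj g x]
  exact h _ _

theorem mem_borelOrbit_self {n : ℕ} (x : Matrix (Fin n) (Fin n) ℂ) : x ∈ borelOrbit x :=
  ⟨1, one_mem _, (adj_one x).symm⟩

theorem mem_borelOrbit_symm {n : ℕ} {x y : Matrix (Fin n) (Fin n) ℂ} (h : y ∈ borelOrbit x) :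
    x ∈ borelOrbit y := by
  obtain ⟨b, hb, rfl⟩ := h
  exact ⟨b⁻¹, inv_mem hb, (adj_inv_adj b x).symm⟩

theorem mem_borelOrbit_trans {n : ℕ} {x y z : Matrix (Fin n) (Fin n) ℂ} (h : y ∈ borelOrbit x)
    (h' : z ∈ borelOrbit y) : z ∈ borelOrbit x := by
  obtain ⟨b, hb, rfl⟩ := h
  obtain ⟨c, hc, rfl⟩ := h'
  exact ⟨c * b, mul_mem hc hb, (adj_mul _ _ _).symm⟩

/-! ## Principal blocks of block triangular matrices -/

/-- A set of indices is convex for `f` if it contains all indices whose `f`-value lies between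
`f`-values of members. -/
def LevelConvex {n : ℕ} (f : Fin n → ℕ) (s : Finset (Fin n)) : Prop :=
  ∀ l ∈ s, ∀ m ∈ s, ∀ k, f l ≤ f k → f k ≤ f m → k ∈ s

/-- A level-convex set of indices describes a subquotient of the flag attached to `f`, and block
triangular matrices act on that subquotient. -/
theorem principalBlock_mul {n : ℕ} {f : Fin n → ℕ} {s : Finset (Fin n)} (hs : LevelConvex f s)
    {x y : Matrix (Fin n) (Fin n) ℂ} (hx : x.BlockTriangular f) (hy : y.BlockTriangular f) :
    principalBlock s (x * y) = principalBlock s x * principalBlock s y := by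
  ext l m
  simp only [principalBlock, Matrix.submatrix_apply, Matrix.mul_apply]
  rw [Finset.sum_coe_sort s (fun k => x l k * y k m)]
  refine (Finset.sum_subset (Finset.subset_univ s) fun k _ hk => ?_).symm
  by_cases h1 : f k < f l
  · rw [hx h1, zero_mul]
  · by_cases h2 : f m < f k
    · rw [hy h2, mul_zero]
    · exact absurd (hs l l.2 m m.2 k (not_lt.1 h1) (not_lt.1 h2)) hk

theorem blockTriangular_coe_inv {n : ℕ} {f : Fin n → ℕ} {g : GL (Fin n) ℂ}
    (hg : (g : Matrix (Fin n) (Fin n) ℂ).BlockTriangular f) :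
    ((g⁻¹ : GL (Fin n) ℂ) : Matrix (Fin n) (Fin n) ℂ).BlockTriangular f := by
  have : Invertible (g : Matrix (Fin n) (Fin n) ℂ) := g.invertible
  simpa using Matrix.blockTriangular_inv_of_blockTriangular hg

theorem blockTriangular_adj {n : ℕ} {f : Fin n → ℕ} {g : GL (Fin n) ℂ}
    (hg : (g : Matrix (Fin n) (Fin n) ℂ).BlockTriangular f) {x : Matrix (Fin n) (Fin n) ℂ}
    (hx : x.BlockTriangular f) : (adj g x).BlockTriangular f :=
  (hg.mul hx).mul (blockTriangular_coe_inv hg)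

theorem principalBlock_adj {n : ℕ} {f : Fin n → ℕ} {s : Finset (Fin n)} (hs : LevelConvex f s)
    {g : GL (Fin n) ℂ} (hg : (g : Matrix (Fin n) (Fin n) ℂ).BlockTriangular f)
    {x : Matrix (Fin n) (Fin n) ℂ} (hx : x.BlockTriangular f) :
    principalBlock s (adj g x) = principalBlock s (g : Matrix (Fin n) (Fin n) ℂ) *
      principalBlock s x * principalBlock s ((g⁻¹ : GL (Fin n) ℂ) : Matrix (Fin n) (Fin n) ℂ) := by
  rw [adj, principalBlock_mul hs (hg.mul hx) (blockTriangular_coe_inv hg),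
    principalBlock_mul hs hg hx]

theorem rank_principalBlock_adj {n : ℕ} {f : Fin n → ℕ} {s : Finset (Fin n)}
    (hs : LevelConvex f s) {g : GL (Fin n) ℂ}
    (hg : (g : Matrix (Fin n) (Fin n) ℂ).BlockTriangular f)
    {x : Matrix (Fin n) (Fin n) ℂ} (hx : x.BlockTriangular f) :
    (principalBlock s (adj g x)).rank = (principalBlock s x).rank := by
  have h : ∀ (g : GL (Fin n) ℂ) (_ : (g : Matrix (Fin n) (Fin n) ℂ).BlockTriangular f)
      (x : Matrix (Fin n) (Fin n) ℂ) (_ : x.BlockTriangular f),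
      (principalBlock s (adj g x)).rank ≤ (principalBlock s x).rank := by
    intro g hg x hx
    rw [principalBlock_adj hs hg hx]
    exact (Matrix.rank_mul_le_left _ _).trans (Matrix.rank_mul_le_right _ _)
  refine le_antisymm (h g hg x hx) ?_
  conv_lhs => rw [← adj_inv_adj g x]
  exact h _ (blockTriangular_coe_inv hg) _ (blockTriangular_adj hg hx)

theorem blockTriangular_of_strictlyUpper {n : ℕ} {f : Fin n → ℕ} (hf : Monotone f)
    {x : Matrix (Fin n) (Fin n) ℂ} (hx : x ∈ strictlyUpper n) : x.BlockTriangular f := by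
  intro i j hij
  exact hx i j (le_of_lt (hf.reflect_lt hij))

/-- With zero diagonal blocks, `x` lies in the nilradical of the parabolic algebra of `f`, which the
parabolic group preserves. -/
theorem adj_mem_strictlyUpper {n : ℕ} {f : Fin n → ℕ} (hf : Monotone f) {g : GL (Fin n) ℂ}
    (hg : (g : Matrix (Fin n) (Fin n) ℂ).BlockTriangular f) {x : Matrix (Fin n) (Fin n) ℂ}
    (hx : x ∈ strictlyUpper n) (hx0 : ∀ p q, f p = f q → x p q = 0) :
    adj g x ∈ strictlyUpper n := by
  intro p q hqp
  have hxf := blockTriangular_of_strictlyUpper hf hx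
  rcases (hf hqp).lt_or_eq with h | h
  · exact blockTriangular_adj hg hxf h
  · set s : Finset (Fin n) := Finset.univ.filter fun k => f k = f p with hs
    have hconv : LevelConvex f s := by
      intro l hl m hm k h1 h2
      simp only [hs, Finset.mem_filter, Finset.mem_univ, true_and] at *
      omega
    have hzero : principalBlock s x = 0 := by
      ext ⟨l, hl⟩ ⟨m, hm⟩
      simp only [hs, Finset.mem_filter, Finset.mem_univ, true_and] at hl hm
      exact hx0 l m (hl.trans hm.symm)
    have h0 := principalBlock_adj hconv hg hxf
    rw [hzero, Matrix.mul_zero, Matrix.zero_mul] at h0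
    exact congrFun (congrFun h0 ⟨p, by simp [hs]⟩) ⟨q, by simp [hs, h]⟩

theorem upperGroup_blockTriangular {n : ℕ} {b : GL (Fin n) ℂ} (hb : b ∈ upperGroup n) :
    (b : Matrix (Fin n) (Fin n) ℂ).BlockTriangular (fun k : Fin n => (k : ℕ)) :=
  fun _ _ hij => hb hij

theorem levelConvex_Icc {n : ℕ} (i j : Fin n) :
    LevelConvex (fun k : Fin n => (k : ℕ)) (Finset.Icc i j) := by
  intro l hl m hm k h1 h2
  simp only [Finset.mem_Icc, Fin.le_def] at *
  omega

theorem levelConvex_Iic {n : ℕ} (j : Fin n) :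
    LevelConvex (fun k : Fin n => (k : ℕ)) (Finset.Iic j) := by
  intro l hl m hm k h1 h2
  simp only [Finset.mem_Iic, Fin.le_def] at *
  omega

theorem borelOrbit_subset_strictlyUpper {n : ℕ} {x : Matrix (Fin n) (Fin n) ℂ}
    (hx : x ∈ strictlyUpper n) : borelOrbit x ⊆ strictlyUpper n := by
  rintro _ ⟨b, hb, rfl⟩
  exact adj_mem_strictlyUpper (f := fun k : Fin n => (k : ℕ)) Fin.val_strictMono.monotone
    (upperGroup_blockTriangular hb) hx fun p q h => hx p q (Fin.ext h).ge

theorem rank_principalBlock_of_mem_borelOrbit {n : ℕ} {x y : Matrix (Fin n) (Fin n) ℂ}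
    (hx : x ∈ strictlyUpper n) (hy : y ∈ borelOrbit x) {s : Finset (Fin n)}
    (hs : LevelConvex (fun k : Fin n => (k : ℕ)) s) :
    (principalBlock s y).rank = (principalBlock s x).rank := by
  obtain ⟨b, hb, rfl⟩ := hy
  exact rank_principalBlock_adj hs (upperGroup_blockTriangular hb)
    (blockTriangular_of_strictlyUpper Fin.val_strictMono.monotone hx)

theorem rankMatrix_of_mem_borelOrbit {n : ℕ} {x y : Matrix (Fin n) (Fin n) ℂ}
    (hx : x ∈ strictlyUpper n) (hy : y ∈ borelOrbit x) : rankMatrix y = rankMatrix x := by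
  ext i j
  simp only [rankMatrix, Matrix.of_apply]
  rw [rank_principalBlock_of_mem_borelOrbit hx hy (levelConvex_Icc i j)]

/-! ## Involutions -/

theorem involution_apply_apply {n : ℕ} {σ : Equiv.Perm (Fin n)} (hσ : σ ∈ involutions n)
    (i : Fin n) : σ (σ i) = i := by
  have h : σ ^ 2 = 1 := hσ
  simpa [pow_two] using congrArg (fun τ : Equiv.Perm (Fin n) => τ i) h

theorem mem_involutions_of_apply_apply {n : ℕ} {σ : Equiv.Perm (Fin n)}
    (h : ∀ i, σ (σ i) = i) : σ ∈ involutions n := by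
  change σ ^ 2 = 1
  ext i
  simp [pow_two, h]

theorem upperPart_mem_strictlyUpper {n : ℕ} (σ : Equiv.Perm (Fin n)) :
    upperPart σ ∈ strictlyUpper n := by
  intro i j hij
  simp [upperPart, hij.not_gt]

theorem upperPart_mul_self {n : ℕ} {σ : Equiv.Perm (Fin n)} (hσ : σ ∈ involutions n) :
    upperPart σ * upperPart σ = 0 := by
  ext i j
  rw [Matrix.mul_apply]
  refine Finset.sum_eq_zero fun k _ => ?_
  simp only [upperPart, Matrix.of_apply, mul_ite, mul_one, mul_zero, ← ite_and]
  rw [if_neg]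
  rintro ⟨⟨h1, rfl⟩, h2, rfl⟩
  rw [involution_apply_apply hσ] at h1
  exact absurd h2 h1.not_gt

/-- The number of pairs `p < σ p` with `a ≤ p` and `σ p < b`. -/
def linkCount {n : ℕ} (σ : Equiv.Perm (Fin n)) (a b : ℕ) : ℕ :=
  (Finset.univ.filter fun p : Fin n => a ≤ p ∧ p < σ p ∧ (σ p : ℕ) < b).card

/-- The nonzero columns of the block are distinct unit vectors, one for each link inside `s`. -/
theorem rank_principalBlock_upperPart {n : ℕ} {σ : Equiv.Perm (Fin n)} (hσ : σ ∈ involutions n)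
    (s : Finset (Fin n)) :
    (principalBlock s (upperPart σ)).rank =
      (Finset.univ.filter fun p : Fin n => p ∈ s ∧ p < σ p ∧ σ p ∈ s).card := by
  set t : Finset s := Finset.univ.filter fun p : s => p.1 < σ p ∧ σ p ∈ s with ht
  have hcard : (Finset.univ.filter fun p : Fin n => p ∈ s ∧ p < σ p ∧ σ p ∈ s).card = t.card := by
    rw [← Finset.card_map (Function.Embedding.subtype _)]
    congr 1
    ext p
    simp [ht]
    tauto
  have hspan : Submodule.span ℂ (Set.range (principalBlock s (upperPart σ)).col) =
      Submodule.span ℂ (Set.range fun p : t => (Pi.single p.1 1 : s → ℂ)) := by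
    apply le_antisymm
    · rw [Submodule.span_le]
      rintro _ ⟨q, rfl⟩
      by_cases h : σ q ∈ s ∧ σ q < q
      · have : (principalBlock s (upperPart σ)).col q = Pi.single ⟨σ q, h.1⟩ 1 := by
          ext p
          simp only [Matrix.col_apply, principalBlock, upperPart, Matrix.submatrix_apply,
            Matrix.of_apply, Pi.single_apply]
          refine if_congr ⟨?_, ?_⟩ rfl rfl
          · rintro ⟨_, h2⟩
            exact Subtype.ext ((involution_apply_apply hσ p).symm.trans (congrArg σ h2))
          · rintro rfl
            simp [involution_apply_apply hσ, h.2]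
        rw [this]
        refine Submodule.subset_span ⟨⟨⟨σ q, h.1⟩, ?_⟩, rfl⟩
        simp [ht, involution_apply_apply hσ, h.2]
      · have : (principalBlock s (upperPart σ)).col q = 0 := by
          ext p
          simp only [Matrix.col_apply, principalBlock, upperPart, Matrix.submatrix_apply,
            Matrix.of_apply, Pi.zero_apply]
          rw [if_neg]
          rintro ⟨h1, h2⟩
          apply h
          rw [← h2, involution_apply_apply hσ]
          exact ⟨p.2, h2 ▸ h1⟩
        rw [this]
        exact zero_mem _
    · rw [Submodule.span_le]
      rintro _ ⟨⟨p, hp⟩, rfl⟩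
      simp only [ht, Finset.mem_filter, Finset.mem_univ, true_and] at hp
      refine Submodule.subset_span ⟨⟨σ p, hp.2⟩, ?_⟩
      ext r
      simp only [Matrix.col_apply, principalBlock, upperPart, Matrix.submatrix_apply,
        Matrix.of_apply, Pi.single_apply]
      refine if_congr ⟨?_, ?_⟩ rfl rfl
      · rintro ⟨_, h2⟩
        exact Subtype.ext (σ.injective h2)
      · rintro rfl
        exact ⟨hp.1, rfl⟩
  have hli : LinearIndependent ℂ (fun p : t => (Pi.single p.1 1 : s → ℂ)) := by
    have := (Pi.basisFun ℂ s).linearIndependent.comp (fun p : t => p.1) Subtype.val_injective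
    convert this using 1
    funext p
    simp
  rw [Matrix.rank_eq_finrank_span_cols, hspan, finrank_span_eq_card hli, hcard]
  simp

theorem rank_Icc_upperPart {n : ℕ} {σ : Equiv.Perm (Fin n)} (hσ : σ ∈ involutions n)
    (i j : Fin n) :
    (principalBlock (Finset.Icc i j) (upperPart σ)).rank = linkCount σ i (j + 1) := by
  rw [rank_principalBlock_upperPart hσ, linkCount]
  congr 1
  ext p
  simp only [Finset.mem_filter, Finset.mem_univ, true_and, Finset.mem_Icc, Fin.le_def, Fin.lt_def]
  omega

theorem rank_Iic_upperPart {n : ℕ} {σ : Equiv.Perm (Fin n)} (hσ : σ ∈ involutions n)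
    (j : Fin n) :
    (principalBlock (Finset.Iic j) (upperPart σ)).rank = linkCount σ 0 (j + 1) := by
  rw [rank_principalBlock_upperPart hσ, linkCount]
  congr 1
  ext p
  simp only [Finset.mem_filter, Finset.mem_univ, true_and, Finset.mem_Iic, Fin.le_def, Fin.lt_def]
  omega

theorem rank_principalBlock_univ {n : ℕ} (x : Matrix (Fin n) (Fin n) ℂ) :
    (principalBlock Finset.univ x).rank = x.rank :=
  Matrix.rank_submatrix x (Equiv.subtypeUnivEquiv (p := fun k => k ∈ Finset.univ)
    (fun k => Finset.mem_univ k)) (Equiv.subtypeUnivEquiv (fun k => Finset.mem_univ k))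

theorem rank_upperPart {n : ℕ} {σ : Equiv.Perm (Fin n)} (hσ : σ ∈ involutions n) :
    (upperPart σ).rank = linkCount σ 0 n := by
  rw [← rank_principalBlock_univ, rank_principalBlock_upperPart hσ, linkCount]
  congr 1
  ext p
  simp

theorem invRankMatrix_apply {n : ℕ} {σ : Equiv.Perm (Fin n)} (hσ : σ ∈ involutions n)
    (i j : Fin n) : invRankMatrix σ i j = if i < j then linkCount σ i (j + 1) else 0 := by
  rw [invRankMatrix, rankMatrix, Matrix.of_apply, rank_Icc_upperPart hσ]

/-! ## The normal form -/

theorem exists_gl_of_upperTriangular {n : ℕ} (b : Matrix (Fin n) (Fin n) ℂ)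
    (hb : b.BlockTriangular id) (hd : ∀ i, b i i ≠ 0) :
    ∃ g ∈ upperGroup n, (g : Matrix (Fin n) (Fin n) ℂ) = b := by
  have hdet : b.det ≠ 0 := by
    rw [Matrix.det_of_isUpperTriangular hb]
    exact Finset.prod_ne_zero_iff.2 fun i _ => hd i
  exact ⟨Matrix.GeneralLinearGroup.mkOfDetNeZero b hdet, hb, rfl⟩

theorem mul_self_of_mem_borelOrbit {n : ℕ} {x y : Matrix (Fin n) (Fin n) ℂ}
    (hx : x * x = 0) (hy : y ∈ borelOrbit x) : y * y = 0 := by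
  obtain ⟨b, _, rfl⟩ := hy
  rw [adj_mul_adj, hx, adj_zero]

/-- One step of elimination by columns. Replacing e_m by e_m + w reduces column `m` to a vector `c`
supported on fixed points of `σ` below `m`. If `c` is zero, `m` stays fixed. Otherwise `y` kills
`c`, so `c` may replace the basis vector e_p at the last index p of its support, and p becomes
linked to `m`. -/
theorem normal_form_step {n : ℕ} {y : Matrix (Fin n) (Fin n) ℂ} (hy : y ∈ strictlyUpper n)
    (hyy : y * y = 0) (m : Fin n) {σ : Equiv.Perm (Fin n)} (hσ : σ ∈ involutions n)
    (hfix : ∀ j, m ≤ j → σ j = j) (hcol : ∀ j < m, ∀ i, y i j = upperPart σ i j) :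
    ∃ b ∈ upperGroup n, ∃ τ ∈ involutions n, (∀ j, m < j → τ j = j) ∧
      ∀ j ≤ m, ∀ i, (y * (b : Matrix (Fin n) (Fin n) ℂ)) i j =
        ((b : Matrix (Fin n) (Fin n) ℂ) * upperPart τ) i j := by
  have hσσ := involution_apply_apply hσ
  have hlt : ∀ i, i < m → σ i < m := by
    intro i hi
    by_contra h
    have := hfix _ (not_lt.1 h)
    rw [hσσ] at this
    exact h (this ▸ hi)
  set w : Fin n → ℂ := fun k => if k < m ∧ σ k < k then -y (σ k) m else 0 with hw
  set c : Fin n → ℂ := fun k => if k < m ∧ σ k = k then y k m else 0 with hc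
  -- The entry of `y * y` at `(σ i, m)` equals `y i m`: rows of right ends are already zero in
  -- column `m`.
  have hR : ∀ i, i < m → σ i < i → y i m = 0 := by
    intro i him hi
    have h := congrFun (congrFun hyy (σ i)) m
    rw [Matrix.mul_apply, Finset.sum_eq_single i] at h
    · rw [hcol i him] at h
      simpa [upperPart, hi, hσσ] using h
    · intro k _ hk
      by_cases hkm : k < m
      · rw [hcol k hkm]
        simp only [upperPart, Matrix.of_apply, hσσ]
        rw [if_neg (fun h => hk h.2.symm), zero_mul]
      · rw [hy k m (not_lt.1 hkm), mul_zero]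
    · simp
  have hcw : ∀ i, y i m + ∑ k, y i k * w k = c i := by
    intro i
    have hsum : ∑ k, y i k * w k = if i < σ i then -y i m else 0 := by
      split_ifs with hi
      · have him : i < m := by
          by_contra h
          rw [hfix i (not_lt.1 h)] at hi
          exact lt_irrefl _ hi
        rw [Finset.sum_eq_single (σ i)]
        · rw [hcol _ (hlt i him)]
          simp [upperPart, hw, hi, hσσ, hlt i him]
        · intro k _ hk
          by_cases hkm : k < m
          · rw [hcol k hkm]
            simp only [upperPart, Matrix.of_apply]
            rw [if_neg (fun h => hk h.2.symm), zero_mul]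
          · simp [hw, hkm]
        · simp
      · refine Finset.sum_eq_zero fun k _ => ?_
        by_cases hkm : k < m
        · rw [hcol k hkm]
          simp only [upperPart, Matrix.of_apply]
          rw [if_neg, zero_mul]
          rintro ⟨h1, rfl⟩
          exact hi h1
        · simp [hw, hkm]
    rw [hsum, hc]
    by_cases him : i < m
    · rcases lt_trichotomy (σ i) i with h | h | h
      · simp [h.not_gt, h.ne, hR i him h]
      · simp [h, him]
      · simp [h, h.ne']
    · have := hfix i (not_lt.1 him)
      simp [this, him, hy i m (not_lt.1 him)]
  have hcF : ∀ k, c k ≠ 0 → k < m ∧ σ k = k := by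
    intro k hk
    by_contra h
    exact hk (by simp only [hc]; rw [if_neg h])
  have hwm : ∀ k, m ≤ k → w k = 0 := by
    intro k hk
    simp [hw, hk.not_gt]
  by_cases h0 : ∀ k, c k = 0
  · set b : Matrix (Fin n) (Fin n) ℂ := Matrix.of fun k j =>
      if k = j then 1 else if j = m then w k else 0 with hb
    obtain ⟨g, hg, hgb⟩ := exists_gl_of_upperTriangular b (by
      intro i j hij
      have hij : j < i := hij
      simp only [hb, Matrix.of_apply, if_neg hij.ne']
      split_ifs with h
      · exact hwm i (h ▸ hij.le)
      · rfl) (by simp [hb])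
    refine ⟨g, hg, σ, hσ, fun j hj => hfix j hj.le, fun j hj i => ?_⟩
    rw [hgb]
    rcases hj.lt_or_eq with hj | rfl
    · have h1 : (y * b) i j = y i j := by
        rw [Matrix.mul_apply, Finset.sum_eq_single j]
        · simp [hb]
        · intro k _ hk
          simp [hb, hk, hj.ne]
        · simp
      have h2 : (b * upperPart σ) i j = upperPart σ i j := by
        rw [Matrix.mul_apply, Finset.sum_eq_single i]
        · simp [hb]
        · intro k _ hk
          by_cases hkm : k = m
          · subst hkm
            simp [upperPart, hj.not_gt]
          · simp [hb, hk.symm, hkm]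
        · simp
      rw [h1, h2, hcol j hj]
    · have h1 : (y * b) i j = 0 := by
        rw [Matrix.mul_apply, ← h0 i, ← hcw i, ← Finset.add_sum_erase _ _ (Finset.mem_univ j)]
        congr 1
        · simp [hb]
        · rw [← Finset.add_sum_erase (a := j) _ _ (Finset.mem_univ j), hwm j le_rfl, mul_zero,
            zero_add]
          refine Finset.sum_congr rfl fun k hk => ?_
          simp [hb, Finset.ne_of_mem_erase hk]
      have h2 : (b * upperPart σ) i j = 0 := by
        rw [Matrix.mul_apply]
        refine Finset.sum_eq_zero fun k _ => ?_
        simp only [upperPart, Matrix.of_apply]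
        rw [if_neg, mul_zero]
        rintro ⟨h1, h2⟩
        have := hfix j le_rfl
        rw [← h2, hσσ] at this
        exact h1.ne (this.trans h2)
      rw [h1, h2]
  · have hne : (Finset.univ.filter fun k => c k ≠ 0).Nonempty := by
      push Not at h0
      obtain ⟨k, hk⟩ := h0
      exact ⟨k, by simp [hk]⟩
    -- Taking the last index of the support keeps `b` upper triangular, with the nonzero diagonal
    -- entry `c p`.
    set p := (Finset.univ.filter fun k => c k ≠ 0).max' hne with hp
    have hcp : c p ≠ 0 := (Finset.mem_filter.1 (Finset.max'_mem _ hne)).2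
    have hpmax : ∀ k, p < k → c k = 0 := by
      intro k hk
      by_contra h
      exact hk.not_ge (Finset.le_max' _ _ (by simp [h]))
    obtain ⟨hpm, hσp⟩ := hcF p hcp
    have hσm := hfix m le_rfl
    set τ := σ * Equiv.swap p m with hτ
    have hτp : τ p = m := by simp [hτ, hσm]
    have hτm : τ m = p := by simp [hτ, hσp]
    have hτo : ∀ k, k ≠ p → k ≠ m → τ k = σ k := by
      intro k h1 h2
      simp [hτ, Equiv.swap_apply_of_ne_of_ne h1 h2]
    have hσne : ∀ k, k ≠ p → σ k ≠ p := by
      intro k hk h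
      apply hk
      rw [← hσσ k, h, hσp]
    have hσnem : ∀ k, k ≠ m → σ k ≠ m := by
      intro k hk h
      apply hk
      rw [← hσσ k, h, hσm]
    have hτinv : τ ∈ involutions n := by
      refine mem_involutions_of_apply_apply fun k => ?_
      by_cases h1 : k = p
      · rw [h1, hτp, hτm]
      · by_cases h2 : k = m
        · rw [h2, hτm, hτp]
        · rw [hτo k h1 h2, hτo _ (hσne k h1) (hσnem k h2), hσσ]
    set b : Matrix (Fin n) (Fin n) ℂ := Matrix.of fun k j =>
      if j = p then c k else if k = j then 1 else if j = m then w k else 0 with hb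
    have hbp : ∀ k, b k p = c k := by
      intro k
      simp [hb]
    obtain ⟨g, hg, hgb⟩ := exists_gl_of_upperTriangular b (by
      intro i j hij
      have hij : j < i := hij
      simp only [hb, Matrix.of_apply, if_neg hij.ne']
      split_ifs with h h
      · exact hpmax i (h ▸ hij)
      · exact hwm i (h ▸ hij.le)
      · rfl) (by
      intro i
      by_cases h : i = p
      · subst h
        rw [hbp]
        exact hcp
      · simp [hb, h])
    refine ⟨g, hg, τ, hτinv, fun j hj => ?_, fun j hj i => ?_⟩
    · rw [hτo j (hpm.trans hj).ne' hj.ne', hfix j hj.le]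
    rw [hgb]
    by_cases hjp : j = p
    · rw [hjp]
      have h1 : (y * b) i p = 0 := by
        rw [Matrix.mul_apply]
        refine Finset.sum_eq_zero fun k _ => ?_
        rw [hbp]
        by_cases hck : c k = 0
        · rw [hck, mul_zero]
        · obtain ⟨hkm, hk⟩ := hcF k hck
          rw [hcol k hkm]
          simp only [upperPart, Matrix.of_apply]
          rw [if_neg, zero_mul]
          rintro ⟨h1, h2⟩
          rw [← h2, hσσ] at hk
          exact h1.ne (hk.trans h2)
      have h2 : (b * upperPart τ) i p = 0 := by
        rw [Matrix.mul_apply]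
        refine Finset.sum_eq_zero fun k _ => ?_
        simp only [upperPart, Matrix.of_apply]
        rw [if_neg, mul_zero]
        rintro ⟨h1, h2⟩
        rw [← hτm] at h2
        have := τ.injective h2
        rw [this] at h1
        exact h1.not_gt hpm
      rw [h1, h2]
    · rcases hj.lt_or_eq with hj | hj
      · have h1 : (y * b) i j = y i j := by
          rw [Matrix.mul_apply, Finset.sum_eq_single j]
          · simp [hb, hjp]
          · intro k _ hk
            simp [hb, hk, hj.ne, hjp]
          · simp
        have h2 : (b * upperPart τ) i j = upperPart σ i j := by
          have hτj : ∀ k, (k < j ∧ τ k = j) ↔ (k < j ∧ σ k = j) := by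
            intro k
            by_cases hkp : k = p
            · rw [hkp]
              simp only [hτp, hσp]
              exact ⟨fun h => absurd h.2 hj.ne', fun h => absurd h.2.symm hjp⟩
            · by_cases hkm : k = m
              · rw [hkm]
                exact ⟨fun h => absurd h.1 hj.not_gt, fun h => absurd h.1 hj.not_gt⟩
              · rw [hτo k hkp hkm]
          have hup : ∀ k, upperPart τ k j = upperPart σ k j := by
            intro k
            simp only [upperPart, Matrix.of_apply, hτj]
          have hupp : upperPart σ p j = 0 := by
            simp only [upperPart, Matrix.of_apply, hσp]
            rw [if_neg (fun h => hjp h.2.symm)]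
          have hupm : upperPart σ m j = 0 := by
            simp [upperPart, hj.not_gt]
          simp only [Matrix.mul_apply, hup]
          by_cases hip : i = p
          · rw [hip, hupp]
            refine Finset.sum_eq_zero fun k _ => ?_
            by_cases hkp : k = p
            · rw [hkp, hupp, mul_zero]
            · by_cases hkm : k = m
              · rw [hkm, hupm, mul_zero]
              · simp [hb, hkp, Ne.symm hkp, hkm]
          · rw [Finset.sum_eq_single i]
            · simp [hb, hip]
            · intro k _ hk
              by_cases hkp : k = p
              · rw [hkp, hupp, mul_zero]
              · by_cases hkm : k = m
                · rw [hkm, hupm, mul_zero]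
                · simp [hb, hkp, Ne.symm hk, hkm]
            · simp
        rw [h1, h2, hcol j hj]
      · rw [hj]
        have h1 : (y * b) i m = c i := by
          rw [Matrix.mul_apply, ← hcw i, ← Finset.add_sum_erase _ _ (Finset.mem_univ m)]
          congr 1
          · simp [hb, hpm.ne']
          · rw [← Finset.add_sum_erase (a := m) _ _ (Finset.mem_univ m), hwm m le_rfl, mul_zero,
              zero_add]
            refine Finset.sum_congr rfl fun k hk => ?_
            simp [hb, Finset.ne_of_mem_erase hk, hpm.ne']
        have h2 : (b * upperPart τ) i m = c i := by
          rw [Matrix.mul_apply, Finset.sum_eq_single p]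
          · simp [hbp, upperPart, hpm, hτp]
          · intro k _ hk
            simp only [upperPart, Matrix.of_apply]
            rw [if_neg, mul_zero]
            rintro ⟨h1, h2⟩
            rw [← hτp] at h2
            exact hk (τ.injective h2)
          · simp
        rw [h1, h2]

/-- Every strictly upper triangular matrix of square zero is conjugate under the Borel subgroup to
the upper part of an involution. -/
theorem exists_involution_mem_borelOrbit {n : ℕ} {x : Matrix (Fin n) (Fin n) ℂ}
    (hx : x ∈ strictlyUpper n) (hxx : x * x = 0) :
    ∃ σ ∈ involutions n, x ∈ borelOrbit (upperPart σ) := by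
  -- Columns are normalised one at a time from the left; the involution built so far moves only
  -- indices below `m`.
  have key : ∀ m ≤ n, ∃ y ∈ borelOrbit x, ∃ σ ∈ involutions n,
      (∀ j : Fin n, m ≤ j → σ j = j) ∧ ∀ j : Fin n, (j : ℕ) < m → ∀ i, y i j = upperPart σ i j := by
    intro m
    induction m with
    | zero =>
      intro _
      exact ⟨x, mem_borelOrbit_self x, 1, by simp [involutions], by simp, by simp⟩
    | succ m ih =>
      intro hm
      obtain ⟨y, hy, σ, hσ, hfix, hcol⟩ := ih (by omega)
      obtain ⟨b, hb, τ, hτ, hfix', hcol'⟩ := normal_form_step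
        (borelOrbit_subset_strictlyUpper hx hy) (mul_self_of_mem_borelOrbit hxx hy) ⟨m, hm⟩ hσ
        (fun j hj => hfix j hj) (fun j hj => hcol j hj)
      refine ⟨adj b⁻¹ y, mem_borelOrbit_trans hy ⟨b⁻¹, inv_mem hb, rfl⟩, τ, hτ,
        fun j hj => hfix' j hj, fun j hj i => ?_⟩
      have h1 : adj b⁻¹ y = ((b⁻¹ : GL (Fin n) ℂ) : Matrix (Fin n) (Fin n) ℂ) *
          (y * (b : Matrix (Fin n) (Fin n) ℂ)) := by
        rw [adj, inv_inv, Matrix.mul_assoc]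
      rw [h1, Matrix.mul_apply]
      rw [Finset.sum_congr rfl fun k _ => by
        rw [hcol' j (Nat.lt_succ_iff.1 hj) k]]
      rw [← Matrix.mul_apply, ← Matrix.mul_assoc, ← Units.val_mul, inv_mul_cancel, Units.val_one,
        Matrix.one_mul]
  obtain ⟨y, hy, σ, hσ, -, hcol⟩ := key n le_rfl
  obtain rfl : y = upperPart σ := by
    ext i j
    exact hcol j j.2 i
  exact ⟨σ, hσ, mem_borelOrbit_symm hy⟩

/-! ## Counting links -/

section LinkCount

variable {n : ℕ} {σ τ : Equiv.Perm (Fin n)}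

theorem linkCount_succ_left (σ : Equiv.Perm (Fin n)) (i : Fin n) (b : ℕ) :
    linkCount σ i b = linkCount σ (i + 1) b + if i < σ i ∧ (σ i : ℕ) < b then 1 else 0 := by
  unfold linkCount
  split_ifs with h
  · rw [← Finset.card_insert_of_notMem (a := i)]
    · congr 1
      ext p
      simp only [Finset.mem_filter, Finset.mem_univ, true_and, Finset.mem_insert]
      constructor
      · rintro ⟨h1, h2⟩
        by_cases hp : p = i
        · exact Or.inl hp
        · exact Or.inr ⟨by have := Fin.val_ne_of_ne hp; omega, h2⟩
      · rintro (rfl | ⟨h1, h2⟩)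
        · exact ⟨le_rfl, h⟩
        · exact ⟨by omega, h2⟩
    · simp
  · rw [add_zero]
    congr 1
    ext p
    simp only [Finset.mem_filter, Finset.mem_univ, true_and]
    constructor
    · rintro ⟨h1, h2⟩
      refine ⟨?_, h2⟩
      by_contra hp
      obtain rfl : p = i := Fin.ext (by omega)
      exact h h2
    · rintro ⟨h1, h2⟩
      exact ⟨by omega, h2⟩

theorem linkCount_succ_right (hσ : σ ∈ involutions n) (i : Fin n) (a : ℕ) :
    linkCount σ a (i + 1) = linkCount σ a i + if σ i < i ∧ a ≤ (σ i : ℕ) then 1 else 0 := by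
  have hσσ := involution_apply_apply hσ
  unfold linkCount
  split_ifs with h
  · rw [← Finset.card_insert_of_notMem (a := σ i)]
    · congr 1
      ext p
      simp only [Finset.mem_filter, Finset.mem_univ, true_and, Finset.mem_insert]
      constructor
      · rintro ⟨h1, h2, h3⟩
        by_cases hp : p = σ i
        · exact Or.inl hp
        · refine Or.inr ⟨h1, h2, ?_⟩
          have : σ p ≠ i := fun h => hp (by rw [← h, hσσ])
          have := Fin.val_ne_of_ne this
          omega
      · rintro (rfl | ⟨h1, h2, h3⟩)
        · rw [hσσ]
          exact ⟨h.2, h.1, by omega⟩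
        · exact ⟨h1, h2, by omega⟩
    · simp [hσσ]
  · rw [add_zero]
    congr 1
    ext p
    simp only [Finset.mem_filter, Finset.mem_univ, true_and]
    constructor
    · rintro ⟨h1, h2, h3⟩
      refine ⟨h1, h2, ?_⟩
      by_contra hp
      have : σ p = i := Fin.ext (by omega)
      apply h
      rw [← this, hσσ]
      exact ⟨h2, h1⟩
    · rintro ⟨h1, h2, h3⟩
      exact ⟨h1, h2, by omega⟩

theorem linkCount_mono (σ : Equiv.Perm (Fin n)) {a a' b b' : ℕ} (ha : a' ≤ a) (hb : b ≤ b') :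
    linkCount σ a b ≤ linkCount σ a' b' := by
  refine Finset.card_le_card fun p => ?_
  simp only [Finset.mem_filter, Finset.mem_univ, true_and]
  rintro ⟨h1, h2, h3⟩
  exact ⟨by omega, h2, by omega⟩

theorem linkCount_eq_zero (σ : Equiv.Perm (Fin n)) {a b : ℕ} (h : b ≤ a + 1) :
    linkCount σ a b = 0 := by
  rw [linkCount, Finset.card_eq_zero, Finset.filter_eq_empty_iff]
  rintro p - ⟨h1, h2, h3⟩
  rw [Fin.lt_def] at h2
  omega

theorem linkCount_of_le (σ : Equiv.Perm (Fin n)) {a b : ℕ} (h : n ≤ b) :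
    linkCount σ a b = linkCount σ a n := by
  unfold linkCount
  congr 1
  ext p
  have := (σ p).2
  simp only [Finset.mem_filter, Finset.mem_univ, true_and]
  constructor
  · rintro ⟨h1, h2, _⟩
    exact ⟨h1, h2, this⟩
  · rintro ⟨h1, h2, _⟩
    exact ⟨h1, h2, by omega⟩

theorem two_mul_linkCount_le (hσ : σ ∈ involutions n) (a b : ℕ) :
    2 * linkCount σ a b ≤ b - a := by
  have hσσ := involution_apply_apply hσ
  set S := Finset.univ.filter fun p : Fin n => a ≤ p ∧ p < σ p ∧ (σ p : ℕ) < b with hS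
  have hdisj : Disjoint S (S.map σ.toEmbedding) := by
    rw [Finset.disjoint_left]
    intro p hp hp'
    simp only [hS, Finset.mem_map, Finset.mem_filter, Finset.mem_univ, true_and,
      Equiv.coe_toEmbedding] at hp hp'
    obtain ⟨q, ⟨_, h2, _⟩, rfl⟩ := hp'
    rw [hσσ] at hp
    exact absurd hp.2.1 h2.not_gt
  have h1 : (S ∪ S.map σ.toEmbedding).card = 2 * linkCount σ a b := by
    rw [Finset.card_union_of_disjoint hdisj, Finset.card_map, linkCount]
    ring
  rw [← h1, ← Nat.card_Ico, ← Finset.card_map Fin.valEmbedding]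
  refine Finset.card_le_card fun p => ?_
  simp only [Finset.mem_map, Finset.mem_union, hS, Finset.mem_filter, Finset.mem_univ, true_and,
    Equiv.coe_toEmbedding, Fin.valEmbedding_apply, Finset.mem_Ico, Fin.lt_def]
  rintro ⟨q, ⟨h1, h2, h3⟩ | ⟨r, ⟨h1, h2, h3⟩, rfl⟩, rfl⟩ <;> omega

/-- The order on permutations given by comparing all link counts. -/
def LinkLE (σ τ : Equiv.Perm (Fin n)) : Prop :=
  ∀ a b, linkCount σ a b ≤ linkCount τ a b

/-- Rank matrices only see closed intervals with two distinct ends in `Fin n`. The other half-open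
intervals add nothing: those with at most one index contain no link, and an end beyond `n` counts as
`n`. -/
theorem linkCount_le_of_invRankMatrix {f : ℕ → ℕ → ℕ} (hσ : σ ∈ involutions n)
    (h : ∀ i j : Fin n, i < j → invRankMatrix σ i j ≤ f i (j + 1))
    (hf : ∀ a b, n ≤ b → f a b = f a n) (a b : ℕ) :
    linkCount σ a b ≤ f a b := by
  have key : ∀ b ≤ n, linkCount σ a b ≤ f a b := by
    intro b hb
    by_cases hab : b ≤ a + 1
    · rw [linkCount_eq_zero σ hab]
      exact Nat.zero_le _
    · obtain ⟨j, rfl⟩ : ∃ j, b = j + 1 := ⟨b - 1, by omega⟩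
      have := h ⟨a, by omega⟩ ⟨j, by omega⟩ (by rw [Fin.lt_def]; simp only; omega)
      rw [invRankMatrix_apply hσ, if_pos (by rw [Fin.lt_def]; simp only; omega)] at this
      exact this
  by_cases hb : b ≤ n
  · exact key b hb
  · rw [linkCount_of_le σ (by omega : n ≤ b), hf a b (by omega)]
    exact key n le_rfl

theorem entrywiseLE_iff_linkLE (hσ : σ ∈ involutions n) (hτ : τ ∈ involutions n) :
    EntrywiseLE (invRankMatrix σ) (invRankMatrix τ) ↔ LinkLE σ τ := by
  constructor
  · intro h
    refine linkCount_le_of_invRankMatrix hσ (fun i j hij => ?_)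
      (fun a b hb => linkCount_of_le τ hb)
    have := h i j
    rwa [invRankMatrix_apply hτ, if_pos hij] at this
  · intro h i j
    rw [invRankMatrix_apply hσ, invRankMatrix_apply hτ]
    split_ifs
    · exact h _ _
    · exact le_rfl

theorem linkCount_injective (hσ : σ ∈ involutions n) (hτ : τ ∈ involutions n)
    (h : ∀ a b, linkCount σ a b = linkCount τ a b) : σ = τ := by
  have key : ∀ {σ τ : Equiv.Perm (Fin n)}, (∀ a b, linkCount σ a b = linkCount τ a b) →
      ∀ i, i < σ i → τ i = σ i := by
    intro σ τ h i hi
    -- The jump of the count as the left end passes `i` tells whether `i` is linked to a larger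
    -- index below `b`; varying `b` recovers `σ i`.
    have hb : ∀ b : ℕ, (i < σ i ∧ (σ i : ℕ) < b) ↔ (i < τ i ∧ (τ i : ℕ) < b) := by
      intro b
      have h1 := linkCount_succ_left σ i b
      have h2 := linkCount_succ_left τ i b
      rw [h, h] at h1
      split_ifs at h1 h2 with h3 h4 h4 <;> first | tauto | omega
    have h1 := (hb (σ i + 1)).1 ⟨hi, by omega⟩
    have h2 := (hb (τ i + 1)).2 ⟨h1.1, by omega⟩
    exact Fin.ext (by omega)
  have hσσ := involution_apply_apply hσ
  have hττ := involution_apply_apply hτ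
  refine Equiv.ext fun i => ?_
  rcases lt_trichotomy (σ i) i with hi | hi | hi
  · have := key h (σ i) (by rwa [hσσ])
    rw [hσσ] at this
    rw [← this, hττ, this]
  · rw [hi]
    rcases lt_trichotomy (τ i) i with hi' | hi' | hi'
    · have := key (fun a b => (h a b).symm) (τ i) (by rwa [hττ])
      rw [hττ] at this
      have h3 := congrArg σ this
      rw [hσσ] at h3
      exact hi.symm.trans h3.symm
    · exact hi'.symm
    · have := key (fun a b => (h a b).symm) i hi'
      exact absurd (this.symm.trans hi) hi'.ne'
  · exact (key h i hi).symm

theorem LinkLE.antisymm (hσ : σ ∈ involutions n) (hτ : τ ∈ involutions n)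
    (h : LinkLE σ τ) (h' : LinkLE τ σ) : σ = τ :=
  linkCount_injective hσ hτ fun a b => le_antisymm (h a b) (h' a b)

end LinkCount

/-! ## Closed conditions -/

/-- Take `k` vectors with independent images and a left inverse of the resulting injection. A lower
bound on the rank thus becomes the nonvanishing of a determinant that is polynomial in the matrix,
for fixed `A` and `B`. -/
theorem exists_mul_mul_eq_one {m : Type*} [Fintype m] [DecidableEq m] {X : Matrix m m ℂ} {k : ℕ}
    (h : k ≤ X.rank) : ∃ (A : Matrix (Fin k) m ℂ) (B : Matrix m (Fin k) ℂ), A * X * B = 1 := by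
  obtain ⟨v, hv⟩ := exists_linearIndependent_of_le_finrank h
  have hv' : ∀ i, ∃ w, X.mulVecLin w = v i := fun i => (v i).2
  choose w hw using hv'
  set B : Matrix m (Fin k) ℂ := Matrix.of fun p i => w i p with hB
  have hcol : ∀ i, (X * B).col i = v i := by
    intro i
    rw [← hw i]
    rfl
  have hli : LinearIndependent ℂ (X * B).col := by
    have : (X * B).col = fun i => (v i : m → ℂ) := funext hcol
    rw [this]
    exact hv.map' (Submodule.subtype _) (Submodule.ker_subtype _)
  have hinj : Function.Injective (X * B).mulVecLin := by
    rw [Matrix.coe_mulVecLin]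
    exact Matrix.mulVec_injective_iff.2 hli
  obtain ⟨g, hg⟩ := LinearMap.exists_leftInverse_of_injective (X * B).mulVecLin
    (LinearMap.ker_eq_bot.2 hinj)
  refine ⟨LinearMap.toMatrix' g, B, ?_⟩
  rw [Matrix.mul_assoc]
  have : LinearMap.toMatrix' (g ∘ₗ (X * B).mulVecLin) = 1 := by rw [hg, LinearMap.toMatrix'_id]
  rw [LinearMap.toMatrix'_comp] at this
  rwa [← Matrix.toLin'_apply', LinearMap.toMatrix'_toLin'] at this

theorem isClosed_rank_principalBlock_le {n : ℕ} (s : Finset (Fin n)) (r : ℕ) :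
    IsClosed[matZariski n] {x | (principalBlock s x).rank ≤ r} := by
  have : {x : Matrix (Fin n) (Fin n) ℂ | (principalBlock s x).rank ≤ r} =
      ⋂ (A : Matrix (Fin (r + 1)) s ℂ), ⋂ (B : Matrix s (Fin (r + 1)) ℂ),
        {x | (A * principalBlock s x * B).det = 0} := by
    ext x
    simp only [Set.mem_ofPred_eq, Set.mem_iInter]
    constructor
    · intro h A B
      by_contra hdet
      have h1 := Matrix.rank_of_det_ne_zero hdet
      have h2 : (A * principalBlock s x * B).rank ≤ (principalBlock s x).rank :=
        (Matrix.rank_mul_le_left _ _).trans (Matrix.rank_mul_le_right _ _)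
      rw [h1, Fintype.card_fin] at h2
      omega
    · intro h
      by_contra hr
      obtain ⟨A, B, hAB⟩ := exists_mul_mul_eq_one (k := r + 1) (X := principalBlock s x) (by omega)
      have := h A B
      rw [hAB, Matrix.det_one] at this
      exact one_ne_zero this
  rw [this]
  let _ := matZariski n
  refine isClosed_iInter fun A => isClosed_iInter fun B => isClosed_zero_polyFun ?_
  refine det_mem_subalgebra (polyFun n) _ fun i j => ?_
  exact mul_mem_subalgebra (polyFun n) (fun x => A * principalBlock s x) (fun _ => B)
    (mul_mem_subalgebra (polyFun n) (fun _ => A) (fun x => principalBlock s x)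
      (fun _ _ => const_mem_polyFun _) fun i j => entry_mem_polyFun _ _)
    (fun _ _ => const_mem_polyFun _) i j

/-- The strictly upper triangular matrices of square zero. -/
def squareZero (n : ℕ) : Set (Matrix (Fin n) (Fin n) ℂ) :=
  {x | x ∈ strictlyUpper n ∧ x * x = 0}

theorem isClosed_squareZero (n : ℕ) : IsClosed[matZariski n] (squareZero n) := by
  have : squareZero n = (⋂ i : Fin n, ⋂ j : Fin n, ⋂ _ : j ≤ i, {x | x i j = 0}) ∩
      ⋂ i : Fin n, ⋂ j : Fin n, {x | (x * x) i j = 0} := by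
    ext x
    simp only [squareZero, strictlyUpper, Set.mem_ofPred_eq, Set.mem_inter_iff, Set.mem_iInter]
    refine and_congr Iff.rfl ⟨fun h i j => by rw [h]; rfl, fun h => ?_⟩
    ext i j
    exact h i j
  rw [this]
  let _ := matZariski n
  refine IsClosed.inter ?_ ?_
  · exact isClosed_iInter fun i => isClosed_iInter fun j => isClosed_iInter fun _ =>
      isClosed_zero_polyFun (entry_mem_polyFun i j)
  · exact isClosed_iInter fun i => isClosed_iInter fun j => isClosed_zero_polyFun
      (mul_mem_subalgebra (polyFun n) (fun x => x) (fun x => x) entry_mem_polyFun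
        entry_mem_polyFun i j)

theorem isClosed_entrywiseLE {n : ℕ} (R : Matrix (Fin n) (Fin n) ℕ) :
    IsClosed[matZariski n] {x | EntrywiseLE (rankMatrix x) R} := by
  have : {x : Matrix (Fin n) (Fin n) ℂ | EntrywiseLE (rankMatrix x) R} =
      ⋂ i : Fin n, ⋂ j : Fin n, ⋂ _ : i < j,
        {x | (principalBlock (Finset.Icc i j) x).rank ≤ R i j} := by
    ext x
    simp only [EntrywiseLE, Set.mem_ofPred_eq, Set.mem_iInter, rankMatrix, Matrix.of_apply]
    refine forall_congr' fun i => forall_congr' fun j => ⟨fun h hij => ?_, fun h => ?_⟩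
    · rwa [if_pos hij] at h
    · split_ifs with hij
      · exact h hij
      · exact Nat.zero_le _
  rw [this]
  let _ := matZariski n
  exact isClosed_iInter fun i => isClosed_iInter fun j => isClosed_iInter fun _ =>
    isClosed_rank_principalBlock_le _ _

theorem upperPart_mem_squareZero {n : ℕ} {σ : Equiv.Perm (Fin n)} (hσ : σ ∈ involutions n) :
    upperPart σ ∈ squareZero n :=
  ⟨upperPart_mem_strictlyUpper σ, upperPart_mul_self hσ⟩

theorem borelOrbit_subset_squareZero {n : ℕ} {x : Matrix (Fin n) (Fin n) ℂ}
    (hx : x ∈ squareZero n) : borelOrbit x ⊆ squareZero n := fun _ hy =>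
  ⟨borelOrbit_subset_strictlyUpper hx.1 hy, mul_self_of_mem_borelOrbit hx.2 hy⟩

theorem closure_borelOrbit_subset {n : ℕ} {σ : Equiv.Perm (Fin n)} (hσ : σ ∈ involutions n) :
    closure[matZariski n] (borelOrbit (upperPart σ)) ⊆
      squareZero n ∩ {x | EntrywiseLE (rankMatrix x) (invRankMatrix σ)} := by
  let _ := matZariski n
  refine closure_minimal (fun y hy =>
    ⟨borelOrbit_subset_squareZero (upperPart_mem_squareZero hσ) hy, ?_⟩)
    ((isClosed_squareZero n).inter (isClosed_entrywiseLE _))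
  have := rankMatrix_of_mem_borelOrbit (upperPart_mem_strictlyUpper σ) hy
  intro i j
  rw [this]
  rfl

theorem adj_mem_closure_borelOrbit {n : ℕ} {x y : Matrix (Fin n) (Fin n) ℂ}
    (hy : y ∈ closure[matZariski n] (borelOrbit x)) {b : GL (Fin n) ℂ} (hb : b ∈ upperGroup n) :
    adj b y ∈ closure[matZariski n] (borelOrbit x) := by
  let _ := matZariski n
  refine map_mem_closure (continuous_adj b) hy fun z hz => ?_
  exact mem_borelOrbit_trans hz ⟨b, hb, rfl⟩

theorem borelOrbit_subset_closure {n : ℕ} {x y : Matrix (Fin n) (Fin n) ℂ}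
    (hy : y ∈ closure[matZariski n] (borelOrbit x)) :
    borelOrbit y ⊆ closure[matZariski n] (borelOrbit x) := by
  rintro _ ⟨b, hb, rfl⟩
  exact adj_mem_closure_borelOrbit hy hb

/-- `B` is the invertible part of the linear space of upper triangular matrices, and the orbit is
its continuous image. -/
theorem isIrreducible_borelOrbit {n : ℕ} (x : Matrix (Fin n) (Fin n) ℂ) :
    @IsIrreducible _ (matZariski n) (borelOrbit x) := by
  refine ⟨⟨x, mem_borelOrbit_self x⟩, ?_⟩
  have h1 := isPreirreducible_linear_section_gl (n := n) {b | b.BlockTriangular id}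
    (fun a ha b hb t => ha.add (by
      intro i j hij
      rw [Matrix.smul_apply, (hb.sub ha) hij, smul_zero]))
  let _ := matZariski n
  let _ := glZariski n
  have h2 := h1.image (fun g => adj g x) (continuous_adj_left x).continuousOn
  convert h2 using 1
  ext y
  constructor
  · rintro ⟨b, hb, rfl⟩
    exact ⟨b, hb, rfl⟩
  · rintro ⟨b, hb, rfl⟩
    exact ⟨b, hb, rfl⟩

/-- An irreducible set of square-zero matrices lies in one orbit closure. -/
theorem exists_subset_closure_borelOrbit {n : ℕ} {Y : Set (Matrix (Fin n) (Fin n) ℂ)}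
    (hY : @IsIrreducible _ (matZariski n) Y) (hsub : Y ⊆ squareZero n) :
    ∃ τ ∈ involutions n, (borelOrbit (upperPart τ) ∩ Y).Nonempty ∧
      Y ⊆ closure[matZariski n] (borelOrbit (upperPart τ)) := by
  let _ := matZariski n
  classical
  -- A finite closed cover of `Y`, consisting of the closures of the orbits that meet `Y`.
  set F : Finset (Set (Matrix (Fin n) (Fin n) ℂ)) := (Finset.univ.filter
    fun τ : Equiv.Perm (Fin n) => τ ∈ involutions n ∧
      (borelOrbit (upperPart τ) ∩ Y).Nonempty).image
      fun τ => closure[matZariski n] (borelOrbit (upperPart τ)) with hF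
  obtain ⟨Z, hZ, hYZ⟩ := isIrreducible_iff_sUnion_isClosed.1 hY F (by
    intro Z hZ
    simp only [hF, Finset.mem_image] at hZ
    obtain ⟨τ, _, rfl⟩ := hZ
    exact isClosed_closure) (by
    intro y hy
    obtain ⟨τ, hτ, hyτ⟩ := exists_involution_mem_borelOrbit (hsub hy).1 (hsub hy).2
    refine ⟨_, ?_, subset_closure hyτ⟩
    simp only [hF, Finset.coe_image, Set.mem_image, Finset.mem_coe, Finset.mem_filter,
      Finset.mem_univ, true_and]
    exact ⟨τ, ⟨hτ, y, hyτ, hy⟩, rfl⟩)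
  simp only [hF, Finset.mem_image, Finset.mem_filter, Finset.mem_univ, true_and] at hZ
  obtain ⟨τ, ⟨hτ, hne⟩, rfl⟩ := hZ
  exact ⟨τ, hτ, hne, hYZ⟩

/-- Some orbit meeting `Y` has a closure containing `Y`. Its involution is below `σ` by hypothesis,
and above `σ` by the rank conditions at `upperPart σ`. This replaces a comparison of dimensions. -/
theorem subset_closure_borelOrbit_of_irreducible {n : ℕ} {Y : Set (Matrix (Fin n) (Fin n) ℂ)}
    (hY : @IsPreirreducible _ (matZariski n) Y) (hsub : Y ⊆ squareZero n)
    {σ : Equiv.Perm (Fin n)} (hσ : σ ∈ involutions n) (hσY : upperPart σ ∈ Y)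
    (hle : ∀ τ ∈ involutions n, (borelOrbit (upperPart τ) ∩ Y).Nonempty → LinkLE τ σ) :
    Y ⊆ closure[matZariski n] (borelOrbit (upperPart σ)) := by
  obtain ⟨τ, hτ, hne, hYτ⟩ := exists_subset_closure_borelOrbit ⟨⟨_, hσY⟩, hY⟩ hsub
  have h1 := (closure_borelOrbit_subset hτ (hYτ hσY)).2
  have : τ = σ := LinkLE.antisymm hτ hσ (hle τ hτ hne) ((entrywiseLE_iff_linkLE hσ hτ).1 h1)
  rwa [← this]

/-! ## Conjugation by adjacent transpositions -/

section Adjacent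

variable {n : ℕ} {σ τ : Equiv.Perm (Fin n)} {i i' : Fin n}

/-- The conjugate of `σ` by the transposition of `i` and `i'`. -/
def conjSwap (σ : Equiv.Perm (Fin n)) (i i' : Fin n) : Equiv.Perm (Fin n) :=
  Equiv.swap i i' * σ * Equiv.swap i i'

theorem conjSwap_apply (σ : Equiv.Perm (Fin n)) (i i' p : Fin n) :
    conjSwap σ i i' p = Equiv.swap i i' (σ (Equiv.swap i i' p)) := rfl

theorem conjSwap_mem (hσ : σ ∈ involutions n) (i i' : Fin n) :
    conjSwap σ i i' ∈ involutions n := by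
  refine mem_involutions_of_apply_apply fun p => ?_
  simp [conjSwap_apply, involution_apply_apply hσ]

theorem conjSwap_conjSwap (σ : Equiv.Perm (Fin n)) (i i' : Fin n) :
    conjSwap (conjSwap σ i i') i i' = σ := by
  ext p
  simp [conjSwap_apply]

theorem conjSwap_not_linked (hσ : σ ∈ involutions n) (hl : σ i ≠ i') :
    conjSwap σ i i' i ≠ i' := by
  intro h
  apply hl
  rw [conjSwap_apply, Equiv.swap_apply_left, Equiv.swap_apply_eq_iff,
    Equiv.swap_apply_right] at h
  rw [← h, involution_apply_apply hσ]

theorem swap_val_cases (hi : (i' : ℕ) = i + 1) (p : Fin n) :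
    ((p : ℕ) = i ∧ (Equiv.swap i i' p : ℕ) = i + 1) ∨
      ((p : ℕ) = i + 1 ∧ (Equiv.swap i i' p : ℕ) = i) ∨
      ((p : ℕ) ≠ i ∧ (p : ℕ) ≠ i + 1 ∧ (Equiv.swap i i' p : ℕ) = p) := by
  by_cases h : p = i
  · exact Or.inl ⟨by rw [h], by rw [h, Equiv.swap_apply_left, hi]⟩
  · by_cases h' : p = i'
    · exact Or.inr (Or.inl ⟨by rw [h', hi], by rw [h', Equiv.swap_apply_right]⟩)
    · refine Or.inr (Or.inr ⟨Fin.val_ne_of_ne h, ?_, by rw [Equiv.swap_apply_of_ne_of_ne h h']⟩)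
      rw [← hi]
      exact Fin.val_ne_of_ne h'

/-- An interval with neither end at `i + 1` contains both or none of `i` and `i'`, so the
transposition carries links inside it to links inside it. Only a link joining `i` to `i'` would be
reversed. -/
theorem linkCount_conjSwap_le (hi : (i' : ℕ) = i + 1) (hl : σ i ≠ i')
    {a b : ℕ} (ha : a ≠ i + 1) (hb : b ≠ i + 1) :
    linkCount σ a b ≤ linkCount (conjSwap σ i i') a b := by
  unfold linkCount
  refine Finset.card_le_card_of_injOn (Equiv.swap i i') ?_ (Equiv.injective _).injOn
  intro p hp
  simp only [Finset.coe_filter, Finset.mem_univ, true_and, Set.mem_ofPred_eq] at hp ⊢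
  rw [conjSwap_apply, Equiv.swap_apply_self]
  obtain ⟨h1, h2, h3⟩ := hp
  have hl1 : (p : ℕ) = i → (σ p : ℕ) ≠ i + 1 := by
    intro h h'
    obtain rfl : p = i := Fin.ext h
    exact hl (Fin.ext (h'.trans hi.symm))
  rw [Fin.lt_def] at h2 ⊢
  have q1 := swap_val_cases hi p
  have q2 := swap_val_cases hi (σ p)
  omega

theorem linkCount_conjSwap (hi : (i' : ℕ) = i + 1) (hσ : σ ∈ involutions n) (hl : σ i ≠ i')
    {a b : ℕ} (ha : a ≠ i + 1) (hb : b ≠ i + 1) :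
    linkCount (conjSwap σ i i') a b = linkCount σ a b := by
  refine le_antisymm ?_ (linkCount_conjSwap_le hi hl ha hb)
  have hl' := conjSwap_not_linked hσ hl
  have := linkCount_conjSwap_le hi hl' ha hb
  rwa [conjSwap_conjSwap] at this

/-- The link counts of `σ` at an interval separating `i` and `i + 1` are as small as the other link
counts allow. -/
def IsMinAt (σ : Equiv.Perm (Fin n)) (i : ℕ) : Prop :=
  (∀ b, linkCount σ (i + 1) b = max (linkCount σ (i + 2) b) (linkCount σ i b - 1)) ∧
  ∀ a, linkCount σ a (i + 1) = max (linkCount σ a i) (linkCount σ a (i + 2) - 1)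

/-- The link counts of `σ` at an interval separating `i` and `i + 1` are as large as the other link
counts allow. -/
def IsMaxAt (σ : Equiv.Perm (Fin n)) (i : ℕ) : Prop :=
  (∀ b, b ≠ i + 1 → linkCount σ (i + 1) b = min (linkCount σ (i + 2) b + 1) (linkCount σ i b)) ∧
  ∀ a, a ≠ i + 1 → linkCount σ a (i + 1) = min (linkCount σ a i + 1) (linkCount σ a (i + 2))

/-- Moving an end point past one index changes a count by 0 or 1. Minimality on the left fails at
`b` only if `i'` starts a link ending before `b` while `i` does not; `h1` excludes this, and `h2`
excludes the mirror case. -/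
theorem isMinAt_of (hi : (i' : ℕ) = i + 1) (hσ : σ ∈ involutions n)
    (h1 : i' < σ i' → i < σ i ∧ σ i ≤ σ i') (h2 : σ i < i → σ i' < i' ∧ σ i ≤ σ i') :
    IsMinAt σ i := by
  simp only [Fin.lt_def, Fin.le_def] at h1 h2
  constructor
  · intro b
    have e1 := linkCount_succ_left σ i b
    have e2 := linkCount_succ_left σ i' b
    rw [hi] at e2
    simp only [Fin.lt_def] at e1 e2
    rw [show (i : ℕ) + 1 + 1 = i + 2 from rfl] at e2
    split_ifs at e1 e2 <;> omega
  · intro a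
    have e1 := linkCount_succ_right hσ i a
    have e2 := linkCount_succ_right hσ i' a
    rw [hi] at e2
    simp only [Fin.lt_def] at e1 e2
    rw [show (i : ℕ) + 1 + 1 = i + 2 from rfl] at e2
    split_ifs at e1 e2 <;> omega

theorem isMaxAt_of (hi : (i' : ℕ) = i + 1) (hσ : σ ∈ involutions n)
    (h1 : i < σ i → i' < σ i' ∧ σ i' ≤ σ i) (h2 : σ i' < i' → σ i < i ∧ σ i' ≤ σ i) :
    IsMaxAt σ i := by
  simp only [Fin.lt_def, Fin.le_def] at h1 h2
  constructor
  · intro b _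
    have e1 := linkCount_succ_left σ i b
    have e2 := linkCount_succ_left σ i' b
    rw [hi] at e2
    simp only [Fin.lt_def] at e1 e2
    rw [show (i : ℕ) + 1 + 1 = i + 2 from rfl] at e2
    split_ifs at e1 e2 <;> omega
  · intro a _
    have e1 := linkCount_succ_right hσ i a
    have e2 := linkCount_succ_right hσ i' a
    rw [hi] at e2
    simp only [Fin.lt_def] at e1 e2
    rw [show (i : ℕ) + 1 + 1 = i + 2 from rfl] at e2
    split_ifs at e1 e2 <;> omega

theorem isMinAt_conjSwap_of (hi : (i' : ℕ) = i + 1) (hσ : σ ∈ involutions n) (hl : σ i ≠ i')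
    (h1 : i < σ i → i' < σ i' ∧ σ i' ≤ σ i) (h2 : σ i' < i' → σ i < i ∧ σ i' ≤ σ i) :
    IsMinAt (conjSwap σ i i') i := by
  have hl' : σ i' ≠ i := fun h => hl (by rw [← h, involution_apply_apply hσ])
  have hne : σ i ≠ σ i' := fun h => by
    have := congrArg Fin.val (σ.injective h)
    omega
  have e1 := Fin.val_ne_of_ne hl
  have e2 := Fin.val_ne_of_ne hl'
  have e3 := Fin.val_ne_of_ne hne
  refine isMinAt_of hi (conjSwap_mem hσ i i') ?_ ?_ <;>
  rw [conjSwap_apply, conjSwap_apply, Equiv.swap_apply_left, Equiv.swap_apply_right] <;>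
  simp only [Fin.lt_def, Fin.le_def] at h1 h2 ⊢ <;>
  have q1 := swap_val_cases hi (σ i) <;>
  have q2 := swap_val_cases hi (σ i') <;>
  omega

/-- A link joining `i` and `i'` gives minimality. Without it, the partners of `i` and `i'` satisfy
either the inequalities for minimality or the reversed ones, and conjugation turns the latter into
the former. -/
theorem isMinAt_or_isMaxAt (hi : (i' : ℕ) = i + 1) (hσ : σ ∈ involutions n) :
    IsMinAt σ i ∨ (σ i ≠ i' ∧ IsMaxAt σ i ∧ IsMinAt (conjSwap σ i i') i) := by
  have hσσ := involution_apply_apply hσ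
  by_cases hl : σ i = i'
  · left
    have hl' : σ i' = i := by rw [← hl, hσσ]
    refine isMinAt_of hi hσ ?_ ?_ <;> rw [hl, hl'] <;> simp only [Fin.lt_def, Fin.le_def] <;> omega
  · have hl' : σ i' ≠ i := fun h => hl (by rw [← h, hσσ])
    have e1 := Fin.val_ne_of_ne hl
    have e2 := Fin.val_ne_of_ne hl'
    by_cases hmin : (i' < σ i' → i < σ i ∧ σ i ≤ σ i') ∧ (σ i < i → σ i' < i' ∧ σ i ≤ σ i')
    · exact Or.inl (isMinAt_of hi hσ hmin.1 hmin.2)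
    · right
      have hmax : (i < σ i → i' < σ i' ∧ σ i' ≤ σ i) ∧ (σ i' < i' → σ i < i ∧ σ i' ≤ σ i) := by
        simp only [Fin.lt_def, Fin.le_def] at hmin ⊢
        omega
      exact ⟨hl, isMaxAt_of hi hσ hmax.1 hmax.2, isMinAt_conjSwap_of hi hσ hl hmax.1 hmax.2⟩

theorem linkCount_eq_zero_of_le (σ : Equiv.Perm (Fin n)) {a b : ℕ} (h : n ≤ a + 1) :
    linkCount σ a b = 0 := by
  have := linkCount_mono σ (le_refl a) (le_max_left b n)
  rw [linkCount_of_le σ (le_max_right b n), linkCount_eq_zero σ h] at this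
  omega

theorem linkCount_pos_of_linked (hi : i < σ i) : 0 < linkCount σ i (σ i + 1) :=
  Finset.card_pos.2 ⟨i, by simp [hi]⟩

/-- The interval [i, i + 2) contains a link only when its two indices are linked to each other. -/
theorem ne_of_linkLE (hi : (i' : ℕ) = i + 1) (hl : σ i ≠ i')
    (h : LinkLE τ σ) : τ i ≠ i' := by
  intro hτ
  have h1 := linkCount_pos_of_linked (σ := τ) (i := i) (by rw [hτ, Fin.lt_def]; omega)
  rw [hτ] at h1
  have h2 := h i (i' + 1)
  have e1 := linkCount_succ_left σ i (i' + 1)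
  rw [linkCount_eq_zero σ (by omega : (i' : ℕ) + 1 ≤ i + 1 + 1)] at e1
  have := Fin.val_ne_of_ne hl
  simp only [Fin.lt_def] at e1
  split_ifs at e1 <;> omega

/-- Away from `i + 1` the counts of `σ` and its conjugate agree. The remaining counts of `ρ` and of
the conjugate are given by one and the same monotone formula in those. -/
theorem linkLE_conjSwap_of_isMinAt (hi : (i' : ℕ) = i + 1) (hσ : σ ∈ involutions n)
    (hσl : σ i ≠ i') (hσ' : IsMinAt (conjSwap σ i i') i) {ρ : Equiv.Perm (Fin n)}
    (hρ : IsMinAt ρ i)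
    (h : ∀ a b, a ≠ (i : ℕ) + 1 → b ≠ (i : ℕ) + 1 → linkCount ρ a b ≤ linkCount σ a b) :
    LinkLE ρ (conjSwap σ i i') := by
  have key : ∀ a b, a ≠ (i : ℕ) + 1 → b ≠ (i : ℕ) + 1 →
      linkCount ρ a b ≤ linkCount (conjSwap σ i i') a b := by
    intro a b ha hb
    rw [linkCount_conjSwap hi hσ hσl ha hb]
    exact h a b ha hb
  intro a b
  by_cases ha : a = (i : ℕ) + 1
  · subst ha
    by_cases hb : b = (i : ℕ) + 1
    · subst hb
      rw [linkCount_eq_zero ρ (by omega)]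
      exact Nat.zero_le _
    · rw [hρ.1, hσ'.1]
      have h1 := key (i + 2) b (by omega) hb
      have h2 := key i b (by omega) hb
      omega
  · by_cases hb : b = (i : ℕ) + 1
    · subst hb
      rw [hρ.2, hσ'.2]
      have h1 := key a i ha (by omega)
      have h2 := key a (i + 2) ha (by omega)
      omega
    · exact key a b ha hb

/-- The lifting property of adjacent transpositions. -/
theorem exists_linkLE_conjSwap (hi : (i' : ℕ) = i + 1) (hσ : σ ∈ involutions n)
    (hτ : τ ∈ involutions n) (hσl : σ i ≠ i') (hσ' : IsMinAt (conjSwap σ i i') i)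
    (h : LinkLE τ σ) :
    LinkLE τ (conjSwap σ i i') ∨ LinkLE (conjSwap τ i i') (conjSwap σ i i') := by
  have hτl := ne_of_linkLE hi hσl h
  rcases isMinAt_or_isMaxAt hi hτ with hmin | ⟨_, _, hmin⟩
  · exact Or.inl (linkLE_conjSwap_of_isMinAt hi hσ hσl hσ' hmin fun a b _ _ => h a b)
  · refine Or.inr (linkLE_conjSwap_of_isMinAt hi hσ hσl hσ' hmin fun a b ha hb => ?_)
    rw [linkCount_conjSwap hi hτ hτl ha hb]
    exact h a b

theorem conjSwap_linkLE (hi : (i' : ℕ) = i + 1) (hσ : σ ∈ involutions n) (hσl : σ i ≠ i')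
    (hmax : IsMaxAt σ i) (hmin : IsMinAt (conjSwap σ i i') i) : LinkLE (conjSwap σ i i') σ := by
  intro a b
  by_cases ha : a = (i : ℕ) + 1
  · subst ha
    by_cases hb : b = (i : ℕ) + 1
    · subst hb
      rw [linkCount_eq_zero (conjSwap σ i i') (by omega)]
      exact Nat.zero_le _
    · rw [hmin.1, hmax.1 b hb, linkCount_conjSwap hi hσ hσl (by omega) hb,
        linkCount_conjSwap hi hσ hσl (by omega) hb]
      have e1 := linkCount_succ_left σ i b
      have e2 := linkCount_succ_left σ i' b
      rw [hi, show (i : ℕ) + 1 + 1 = i + 2 from rfl] at e2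
      split_ifs at e1 e2 <;> omega
  · by_cases hb : b = (i : ℕ) + 1
    · subst hb
      rw [hmin.2, hmax.2 a ha, linkCount_conjSwap hi hσ hσl ha (by omega),
        linkCount_conjSwap hi hσ hσl ha (by omega)]
      have e1 := linkCount_succ_right hσ i a
      have e2 := linkCount_succ_right hσ i' a
      rw [hi, show (i : ℕ) + 1 + 1 = i + 2 from rfl] at e2
      split_ifs at e1 e2 <;> omega
    · rw [linkCount_conjSwap hi hσ hσl ha hb]

end Adjacent

/-! ## The minimal parabolic subgroups -/

section Parabolic

variable {n : ℕ} {σ τ : Equiv.Perm (Fin n)} {i i' : Fin n}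

/-- The monotone function on indices whose only fibre with two elements is `{i, i + 1}`. -/
def fuse (i : Fin n) (k : Fin n) : ℕ := if k ≤ i then k else k - 1

theorem monotone_fuse (i : Fin n) : Monotone (fuse i) := by
  intro k l hkl
  rw [Fin.le_def] at hkl
  simp only [fuse, Fin.le_def]
  split_ifs <;> omega

/-- The matrix of a permutation as an element of `GL_n`. -/
def permGL (w : Equiv.Perm (Fin n)) : GL (Fin n) ℂ :=
  Matrix.GeneralLinearGroup.mkOfDetNeZero (w.permMatrix ℂ) (by
    rw [Matrix.det_permutation]
    exact_mod_cast (Equiv.Perm.sign w).ne_zero)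

/-- As `i` and `i'` are not linked, the transposition moves the entries of N_σ without leaving the
strictly upper triangle. -/
theorem adj_swap_upperPart (hi : (i' : ℕ) = i + 1) (hσ : σ ∈ involutions n) (hl : σ i ≠ i') :
    adj (permGL (Equiv.swap i i')) (upperPart σ) = upperPart (conjSwap σ i i') := by
  have hσσ := involution_apply_apply hσ
  symm
  rw [eq_adj_iff]
  change upperPart (conjSwap σ i i') * (Equiv.swap i i').permMatrix ℂ =
    (Equiv.swap i i').permMatrix ℂ * upperPart σ
  ext p q
  rw [PEquiv.mul_toMatrix_toPEquiv, PEquiv.toMatrix_toPEquiv_mul]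
  simp only [Matrix.submatrix_apply, id, upperPart, Matrix.of_apply, Equiv.symm_swap,
    conjSwap_apply]
  refine if_congr ?_ rfl rfl
  rw [(Equiv.swap i i').injective.eq_iff]
  refine and_congr_left fun h => ?_
  obtain ⟨r, rfl⟩ := (Equiv.swap i i').surjective p
  rw [Equiv.swap_apply_self] at *
  subst h
  have hl1 : (r : ℕ) = i → (σ r : ℕ) ≠ i + 1 := by
    intro h h'
    obtain rfl : r = i := Fin.ext h
    exact hl (Fin.ext (h'.trans hi.symm))
  have hl2 : (r : ℕ) = i + 1 → (σ r : ℕ) ≠ i := by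
    intro h h'
    obtain rfl : r = i' := Fin.ext (h.trans hi.symm)
    exact hl (by rw [← (Fin.ext h' : σ r = i), hσσ])
  simp only [Fin.lt_def]
  have q1 := swap_val_cases hi r
  have q2 := swap_val_cases hi (σ r)
  have q3 : (r : ℕ) ≠ σ r ∨ (r : ℕ) = σ r := by omega
  omega

theorem permGL_swap_blockTriangular (hi : (i' : ℕ) = i + 1) :
    (permGL (Equiv.swap i i') : Matrix (Fin n) (Fin n) ℂ).BlockTriangular (fuse i) := by
  intro p q hpq
  change (Equiv.swap i i').permMatrix ℂ p q = 0
  rw [Equiv.Perm.permMatrix, PEquiv.toMatrix_apply, if_neg]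
  rw [Equiv.toPEquiv_apply, Option.mem_some_iff]
  rintro rfl
  have := swap_val_cases hi p
  simp only [fuse, Fin.le_def] at hpq
  split_ifs at hpq <;> omega

/-- Let P_i be the group of invertible matrices that are block triangular for `fuse i`. The set
P_i.N_σ is irreducible and contains every P_i-translate of the orbit of the conjugate. On it, ranks
over intervals not separating `i` from `i'` are constant, and maximality of `σ` at `i` bounds the
other ranks, so each orbit meeting it lies below `σ`. -/
theorem closure_invariant_parabolic (hi : (i' : ℕ) = i + 1) (hσ : σ ∈ involutions n)
    (hl : σ i ≠ i') (hmax : IsMaxAt σ i) {y : Matrix (Fin n) (Fin n) ℂ}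
    (hy : y ∈ closure[matZariski n] (borelOrbit (upperPart (conjSwap σ i i'))))
    {g : GL (Fin n) ℂ} (hg : (g : Matrix (Fin n) (Fin n) ℂ).BlockTriangular (fuse i)) :
    adj g y ∈ closure[matZariski n] (borelOrbit (upperPart σ)) := by
  set Y : Set (Matrix (Fin n) (Fin n) ℂ) := (fun g : GL (Fin n) ℂ => adj g (upperPart σ)) ''
    {g | (g : Matrix (Fin n) (Fin n) ℂ).BlockTriangular (fuse i)} with hY
  have hYirr : @IsPreirreducible _ (matZariski n) Y := by
    have h1 := isPreirreducible_linear_section_gl (n := n) {b | b.BlockTriangular (fuse i)}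
      (fun a ha b hb t => ha.add (by
        intro i j hij
        rw [Matrix.smul_apply, (hb.sub ha) hij, smul_zero]))
    let _ := matZariski n
    let _ := glZariski n
    exact h1.image (fun g => adj g (upperPart σ)) (continuous_adj_left _).continuousOn
  -- The only fused pair is `i`, `i'`, which is unlinked; hence the P_i-orbit stays strictly upper
  -- triangular.
  have hzero : ∀ p q, fuse i p = fuse i q → upperPart σ p q = 0 := by
    intro p q hpq
    simp only [upperPart, Matrix.of_apply]
    rw [if_neg]
    rintro ⟨h1, h2⟩
    rw [Fin.lt_def] at h1
    simp only [fuse, Fin.le_def] at hpq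
    have hp : p = i := Fin.ext (by split_ifs at hpq <;> omega)
    have hq : q = i' := Fin.ext (by split_ifs at hpq <;> omega)
    exact hl (hp ▸ hq ▸ h2)
  have hYsub : Y ⊆ squareZero n := by
    rintro _ ⟨g, hg, rfl⟩
    refine ⟨adj_mem_strictlyUpper (monotone_fuse i) hg (upperPart_mem_strictlyUpper σ) hzero, ?_⟩
    rw [adj_mul_adj, upperPart_mul_self hσ, adj_zero]
  have hYmem : upperPart σ ∈ Y := ⟨1, Matrix.blockTriangular_one, adj_one _⟩
  have hYcl := subset_closure_borelOrbit_of_irreducible hYirr hYsub hσ hYmem (by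
    rintro τ hτ ⟨_, hyτ, g, hg, rfl⟩
    have key : ∀ a b, a ≠ (i : ℕ) + 1 → b ≠ (i : ℕ) + 1 →
        linkCount τ a b = linkCount σ a b := by
      -- Here `b` is the last index of a closed interval, which separates `i` from `i'` only when it
      -- starts at `i + 1` or ends at `i`.
      have key1 : ∀ a b : Fin n, (a : ℕ) ≠ (i : ℕ) + 1 → (b : ℕ) ≠ (i : ℕ) →
          linkCount τ a (b + 1) = linkCount σ a (b + 1) := by
        intro a b ha hb
        rw [← rank_Icc_upperPart hτ, ← rank_Icc_upperPart hσ,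
          ← rank_principalBlock_of_mem_borelOrbit (upperPart_mem_strictlyUpper τ) hyτ
            (levelConvex_Icc a b)]
        refine rank_principalBlock_adj (f := fuse i) ?_ hg
          (blockTriangular_of_strictlyUpper (monotone_fuse i) (upperPart_mem_strictlyUpper σ))
        intro l hl m hm k h1 h2
        simp only [Finset.mem_Icc, Fin.le_def, fuse] at *
        split_ifs at h1 h2 <;> omega
      intro a b ha hb
      by_cases hab : b ≤ a + 1
      · rw [linkCount_eq_zero τ hab, linkCount_eq_zero σ hab]
      · by_cases hbn : n ≤ b
        · rw [linkCount_of_le τ hbn, linkCount_of_le σ hbn]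
          by_cases han : n ≤ a + 1
          · rw [linkCount_eq_zero τ han, linkCount_eq_zero σ han]
          · have h := key1 ⟨a, by omega⟩ ⟨n - 1, by omega⟩ ha (by
              have := i'.2
              simp only
              omega)
            simp only at h
            rwa [show n - 1 + 1 = n by omega] at h
        · have h := key1 ⟨a, by omega⟩ ⟨b - 1, by omega⟩ ha (by simp only; omega)
          simp only at h
          rwa [show b - 1 + 1 = b by omega] at h
    intro a b
    by_cases ha : a = (i : ℕ) + 1
    · subst ha
      by_cases hb : b = (i : ℕ) + 1
      · subst hb
        rw [linkCount_eq_zero τ (by omega)]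
        exact Nat.zero_le _
      · rw [hmax.1 b hb, ← key _ b (by omega) hb, ← key _ b (by omega) hb]
        have e1 := linkCount_succ_left τ i b
        have e2 := linkCount_succ_left τ i' b
        rw [hi, show (i : ℕ) + 1 + 1 = i + 2 from rfl] at e2
        split_ifs at e1 e2 <;> omega
    · by_cases hb : b = (i : ℕ) + 1
      · subst hb
        rw [hmax.2 a ha, ← key a _ ha (by omega), ← key a _ ha (by omega)]
        have e1 := linkCount_succ_right hτ i a
        have e2 := linkCount_succ_right hτ i' a
        rw [hi, show (i : ℕ) + 1 + 1 = i + 2 from rfl] at e2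
        split_ifs at e1 e2 <;> omega
      · rw [key a b ha hb])
  let _ := matZariski n
  rw [← closure_closure]
  refine map_mem_closure (continuous_adj g) hy ?_
  rintro _ ⟨b, hb, rfl⟩
  apply hYcl
  refine ⟨g * b * permGL (Equiv.swap i i'), ?_, ?_⟩
  · change ((g : Matrix (Fin n) (Fin n) ℂ) * b * permGL (Equiv.swap i i')).BlockTriangular (fuse i)
    refine (hg.mul ?_).mul (permGL_swap_blockTriangular hi)
    intro p q hpq
    exact hb ((monotone_fuse i).reflect_lt hpq)
  · beta_reduce
    rw [adj_mul, adj_mul, adj_swap_upperPart hi hσ hl]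

end Parabolic

/-! ## The closure order -/

section ClosureOrder

variable {n : ℕ} {σ τ : Equiv.Perm (Fin n)}

/-- Minimality everywhere makes a count drop by one whenever an end moves inwards, until it is zero.
The formula, with truncated subtraction, says that p is linked to p + (n - k) for each p < k, where
k is the number of links. -/
theorem linkCount_of_isMinAt (hσ : σ ∈ involutions n) (h : ∀ i, i + 1 < n → IsMinAt σ i) {b : ℕ}
    (hb : b ≤ n) (a : ℕ) : linkCount σ a b = linkCount σ 0 n - a - (n - b) := by
  have row : ∀ b d a, a + d + 1 = n → linkCount σ (a + 1) b = linkCount σ a b - 1 := by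
    intro b d
    induction d with
    | zero =>
      intro a ha
      have e1 := linkCount_succ_left σ ⟨a, by omega⟩ b
      have e2 : linkCount σ (a + 1) b = 0 := linkCount_eq_zero_of_le σ (by omega)
      have e3 : linkCount σ a b = 0 := linkCount_eq_zero_of_le σ (by omega)
      simp only at e1
      split_ifs at e1 <;> omega
    | succ d ih =>
      intro a ha
      have e1 := ih (a + 1) (by omega)
      have e2 := (h a (by omega)).1 b
      have e3 := linkCount_succ_left σ ⟨a, by omega⟩ b
      rw [show a + 1 + 1 = a + 2 from rfl] at e1
      simp only at e3
      split_ifs at e3 <;> omega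
  have col : ∀ a b, b + 1 ≤ n → linkCount σ a b = linkCount σ a (b + 1) - 1 := by
    intro a b
    induction b with
    | zero =>
      intro _
      rw [linkCount_eq_zero σ (by omega), linkCount_eq_zero σ (by omega)]
    | succ b ih =>
      intro hb
      have e1 := ih (by omega)
      have e2 := (h b (by omega)).2 a
      have e3 := linkCount_succ_right hσ ⟨b + 1, by omega⟩ a
      simp only at e3
      rw [show b + 1 + 1 = b + 2 from rfl] at e3 ⊢
      split_ifs at e3 <;> omega
  have row' : ∀ b a, linkCount σ a b = linkCount σ 0 b - a := by
    intro b a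
    induction a with
    | zero => rfl
    | succ a ih =>
      by_cases ha : a + 1 ≤ n
      · rw [row b (n - 1 - a) a (by omega), ih]
        omega
      · have h1 := linkCount_mono σ (show a ≤ a + 1 by omega) (le_refl b)
        have h2 : linkCount σ a b = 0 := linkCount_eq_zero_of_le σ (by omega)
        omega
  have col' : ∀ d, d ≤ n → linkCount σ 0 (n - d) = linkCount σ 0 n - d := by
    intro d
    induction d with
    | zero => intro _; rfl
    | succ d ih =>
      intro hd
      have := col 0 (n - (d + 1)) (by omega)
      rw [show n - (d + 1) + 1 = n - d by omega, ih (by omega)] at this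
      omega
  rw [row' b a]
  have := col' (n - b) (by omega)
  rw [show n - (n - b) = b by omega] at this
  omega

theorem mem_closure_of_isMinAt (hσ : σ ∈ involutions n) (h : ∀ i, i + 1 < n → IsMinAt σ i)
    (hle : LinkLE τ σ) :
    upperPart τ ∈ closure[matZariski n] (borelOrbit (upperPart σ)) := by
  set k := linkCount σ 0 n with hk
  have h2k := two_mul_linkCount_le hσ 0 n
  rw [← hk, Nat.sub_zero] at h2k
  have hcount : ∀ a b, b ≤ n → linkCount σ a b = k - a - (n - b) := fun a b hb =>
    linkCount_of_isMinAt hσ h hb a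
  -- The linear space of matrices supported at distance at least n - k above the diagonal. The bound
  -- 2k ≤ n makes all its products vanish.
  set Y : Set (Matrix (Fin n) (Fin n) ℂ) :=
    {y | ∀ a b : Fin n, (b : ℕ) < a + (n - k) → y a b = 0} with hY
  have hYirr : @IsPreirreducible _ (matZariski n) Y :=
    isPreirreducible_linear_section_mat Y fun x hx y hy t a b hab => by
      simp [hx a b hab, hy a b hab]
  have hYsub : Y ⊆ squareZero n := by
    intro y hy
    constructor
    · intro a b hba
      rw [Fin.le_def] at hba
      have := a.2
      exact hy a b (by omega)
    · ext a b
      rw [Matrix.mul_apply]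
      refine Finset.sum_eq_zero fun c _ => ?_
      by_cases hc : (c : ℕ) < a + (n - k)
      · rw [hy a c hc, zero_mul]
      · rw [hy c b (by have := b.2; omega), mul_zero]
  have hYmem : ∀ ρ : Equiv.Perm (Fin n), LinkLE ρ σ → upperPart ρ ∈ Y := by
    intro ρ hρ a b hab
    simp only [upperPart, Matrix.of_apply]
    rw [if_neg]
    rintro ⟨h1, rfl⟩
    have h2 := linkCount_pos_of_linked h1
    have h3 := hρ a (ρ a + 1)
    have := (ρ a).2
    rw [hcount a _ (by omega)] at h3
    omega
  refine subset_closure_borelOrbit_of_irreducible hYirr hYsub hσ (hYmem σ fun _ _ => le_rfl) ?_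
    (hYmem τ hle)
  rintro ρ hρ ⟨y, hyρ, hy⟩
  -- A shorter link would give positive rank to a block on which all of `Y` vanishes.
  have hlink : ∀ p : Fin n, p < ρ p → (p : ℕ) + (n - k) ≤ ρ p := by
    intro p hp
    by_contra hcon
    have h1 := linkCount_pos_of_linked hp
    rw [← rank_Icc_upperPart hρ,
      ← rank_principalBlock_of_mem_borelOrbit (upperPart_mem_strictlyUpper ρ) hyρ
        (levelConvex_Icc _ _)] at h1
    have h0 : principalBlock (Finset.Icc p (ρ p)) y = 0 := by
      ext ⟨a, ha⟩ ⟨b, hb⟩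
      simp only [Finset.mem_Icc, Fin.le_def] at ha hb
      exact hy a b (by omega)
    rw [h0, Matrix.rank_zero] at h1
    exact lt_irrefl _ h1
  have key : ∀ a b, b ≤ n → linkCount ρ a b ≤ linkCount σ a b := by
    intro a b hb
    rw [hcount a b hb]
    have : linkCount ρ a b ≤ (Finset.Ico a (b - (n - k))).card := by
      rw [linkCount, ← Finset.card_map Fin.valEmbedding]
      refine Finset.card_le_card fun p => ?_
      simp only [Finset.mem_map, Finset.mem_filter, Finset.mem_univ, true_and,
        Fin.valEmbedding_apply, Finset.mem_Ico]
      rintro ⟨q, ⟨h1, h2, h3⟩, rfl⟩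
      have := hlink q h2
      omega
    rw [Nat.card_Ico] at this
    omega
  intro a b
  by_cases hb : b ≤ n
  · exact key a b hb
  · rw [linkCount_of_le ρ (by omega : n ≤ b), linkCount_of_le σ (by omega : n ≤ b)]
    exact key a n le_rfl

/-- The closure order on the Borel orbits of square-zero matrices is given by link counts. -/
theorem upperPart_mem_closure_of_linkLE (hσ : σ ∈ involutions n) (hτ : τ ∈ involutions n)
    (hle : LinkLE τ σ) : upperPart τ ∈ closure[matZariski n] (borelOrbit (upperPart σ)) := by
  induction hN : ∑ a ∈ Finset.range (n + 1), ∑ b ∈ Finset.range (n + 1), linkCount σ a b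
    using Nat.strong_induction_on generalizing σ τ with
  | _ N ih =>
  by_cases hall : ∀ i, i + 1 < n → IsMinAt σ i
  · exact mem_closure_of_isMinAt hσ hall hle
  · push Not at hall
    obtain ⟨j, hj, hnot⟩ := hall
    set i : Fin n := ⟨j, by omega⟩
    set i' : Fin n := ⟨j + 1, hj⟩
    have hi : (i' : ℕ) = i + 1 := rfl
    rcases isMinAt_or_isMaxAt hi hσ with hmin | ⟨hl, hmax, hmin⟩
    · exact absurd hmin hnot
    have hle' := conjSwap_linkLE hi hσ hl hmax hmin
    have hlt : ∑ a ∈ Finset.range (n + 1), ∑ b ∈ Finset.range (n + 1),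
        linkCount (conjSwap σ i i') a b < N := by
      rw [← hN]
      have h1 : ∀ a, ∑ b ∈ Finset.range (n + 1), linkCount (conjSwap σ i i') a b ≤
          ∑ b ∈ Finset.range (n + 1), linkCount σ a b := fun a =>
        Finset.sum_le_sum fun b _ => hle' a b
      -- Equal sums would force all counts to agree, so that `conjSwap σ i i'` would be `σ`, against
      -- the failure of minimality at `i`.
      refine lt_of_le_of_ne (Finset.sum_le_sum fun a _ => h1 a) fun heq => hnot ?_
      have h2 := (Finset.sum_eq_sum_iff_of_le fun a _ => h1 a).1 heq
      have h3 : ∀ a ≤ n, ∀ b ≤ n, linkCount (conjSwap σ i i') a b = linkCount σ a b :=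
        fun a ha b hb => (Finset.sum_eq_sum_iff_of_le fun b _ => hle' a b).1
          (h2 a (Finset.mem_range.2 (by omega))) b (Finset.mem_range.2 (by omega))
      have h4 : conjSwap σ i i' = σ := by
        refine linkCount_injective (conjSwap_mem hσ i i') hσ fun a b => ?_
        by_cases ha : a ≤ n
        · by_cases hb : b ≤ n
          · exact h3 a ha b hb
          · rw [linkCount_of_le _ (by omega : n ≤ b), linkCount_of_le σ (by omega : n ≤ b)]
            exact h3 a ha n le_rfl
        · rw [linkCount_eq_zero_of_le _ (by omega), linkCount_eq_zero_of_le _ (by omega)]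
      rwa [h4] at hmin
    -- In the first case the identity of P_i suffices; in the second the transposition, as an
    -- element of P_i, brings the conjugate of `τ` back to `τ`.
    rcases exists_linkLE_conjSwap hi hσ hτ hl hmin hle with h | h
    · have h1 := ih _ hlt (conjSwap_mem hσ i i') hτ h rfl
      have h2 := closure_invariant_parabolic hi hσ hl hmax h1 (g := 1)
        Matrix.blockTriangular_one
      rwa [adj_one] at h2
    · have h1 := ih _ hlt (conjSwap_mem hσ i i') (conjSwap_mem hτ i i') h rfl
      have h2 := closure_invariant_parabolic hi hσ hl hmax h1 (permGL_swap_blockTriangular hi)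
      have hτl := ne_of_linkLE hi hl hle
      have hτl' := conjSwap_not_linked hτ hτl
      rwa [adj_swap_upperPart hi (conjSwap_mem hτ i i') hτl', conjSwap_conjSwap] at h2

/-- The closure of a Borel orbit is cut out by rank conditions. -/
theorem closure_borelOrbit (hσ : σ ∈ involutions n) :
    closure[matZariski n] (borelOrbit (upperPart σ)) =
      squareZero n ∩ {x | EntrywiseLE (rankMatrix x) (invRankMatrix σ)} := by
  refine Set.Subset.antisymm (closure_borelOrbit_subset hσ) ?_
  rintro x ⟨hx, hle⟩
  obtain ⟨τ, hτ, hxτ⟩ := exists_involution_mem_borelOrbit hx.1 hx.2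
  rw [Set.mem_ofPred_eq, rankMatrix_of_mem_borelOrbit (upperPart_mem_strictlyUpper τ) hxτ] at hle
  exact borelOrbit_subset_closure (upperPart_mem_closure_of_linkLE hσ hτ
    ((entrywiseLE_iff_linkLE hτ hσ).1 hle)) hxτ

end ClosureOrder

/-! ## Inequalities between link counts -/

section Inequalities

variable {n : ℕ} {σ : Equiv.Perm (Fin n)}

theorem linkCount_le_add_left (σ : Equiv.Perm (Fin n)) (a b d : ℕ) :
    linkCount σ a b ≤ linkCount σ (a + d) b + d := by
  induction d with
  | zero => exact le_rfl
  | succ d ih =>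
    by_cases h : a + d < n
    · have e := linkCount_succ_left σ ⟨a + d, h⟩ b
      simp only at e
      rw [show a + (d + 1) = a + d + 1 from rfl]
      split_ifs at e <;> omega
    · rw [linkCount_eq_zero_of_le σ (a := a + d) (by omega)] at ih
      omega

theorem linkCount_le_add_right (hσ : σ ∈ involutions n) (a b d : ℕ) :
    linkCount σ a (b + d) ≤ linkCount σ a b + d := by
  induction d with
  | zero => exact le_rfl
  | succ d ih =>
    by_cases h : b + d < n
    · have e := linkCount_succ_right hσ ⟨b + d, h⟩ a
      simp only at e
      rw [show b + (d + 1) = b + d + 1 from rfl]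
      split_ifs at e <;> omega
    · have h1 := linkCount_of_le σ (a := a) (by omega : n ≤ b + (d + 1))
      have h2 := linkCount_of_le σ (a := a) (by omega : n ≤ b + d)
      omega

/-- Removing one index from an interval destroys at most one link. -/
theorem linkCount_le_shrink (hσ : σ ∈ involutions n) (i e a b : ℕ) :
    linkCount σ i e ≤ linkCount σ a b + (a - i) + (e - b) := by
  have h1 := linkCount_le_add_left σ i e (a - i)
  have h2 := linkCount_le_add_right hσ (i + (a - i)) b (e - b)
  have h3 := linkCount_mono σ (le_refl (i + (a - i))) (show e ≤ b + (e - b) by omega)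
  have h4 := linkCount_mono σ (show a ≤ i + (a - i) by omega) (le_refl b)
  omega

/-- Left ends below `a` and right ends below `a` are disjoint sets of indices below `a`. -/
theorem card_links_left (hσ : σ ∈ involutions n) (a : ℕ) :
    (Finset.univ.filter fun p : Fin n => p < σ p ∧ (p : ℕ) < a).card + linkCount σ 0 a ≤ a := by
  have hσσ := involution_apply_apply hσ
  set S := Finset.univ.filter fun p : Fin n => p < σ p ∧ (p : ℕ) < a with hS
  set S' := Finset.univ.filter fun p : Fin n => 0 ≤ (p : ℕ) ∧ p < σ p ∧ (σ p : ℕ) < a with hS'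
  have hdisj : Disjoint S (S'.map σ.toEmbedding) := by
    rw [Finset.disjoint_left]
    intro p hp hp'
    simp only [hS, hS', Finset.mem_map, Finset.mem_filter, Finset.mem_univ, true_and,
      Equiv.coe_toEmbedding] at hp hp'
    obtain ⟨q, ⟨_, h2, _⟩, rfl⟩ := hp'
    rw [hσσ] at hp
    exact absurd hp.1 h2.not_gt
  have h1 : (S ∪ S'.map σ.toEmbedding).card = S.card + linkCount σ 0 a := by
    rw [Finset.card_union_of_disjoint hdisj, Finset.card_map]
    rfl
  rw [← h1]
  conv_rhs => rw [← Finset.card_range a]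
  rw [← Finset.card_map Fin.valEmbedding]
  refine Finset.card_le_card fun p => ?_
  simp only [Finset.mem_map, Finset.mem_union, hS, hS', Finset.mem_filter, Finset.mem_univ,
    true_and, Equiv.coe_toEmbedding, Fin.valEmbedding_apply, Finset.mem_range]
  rintro ⟨q, ⟨h1, h2⟩ | ⟨r, ⟨h1, h2, h3⟩, rfl⟩, rfl⟩ <;> omega

theorem card_links_right (hσ : σ ∈ involutions n) (b : ℕ) :
    (Finset.univ.filter fun p : Fin n => p < σ p ∧ b ≤ (σ p : ℕ)).card + linkCount σ b n ≤
      n - b := by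
  have hσσ := involution_apply_apply hσ
  set S := Finset.univ.filter fun p : Fin n => p < σ p ∧ b ≤ (σ p : ℕ) with hS
  set S' := Finset.univ.filter fun p : Fin n => b ≤ (p : ℕ) ∧ p < σ p ∧ (σ p : ℕ) < n with hS'
  have hdisj : Disjoint (S.map σ.toEmbedding) S' := by
    rw [Finset.disjoint_left]
    intro p hp hp'
    simp only [hS, hS', Finset.mem_map, Finset.mem_filter, Finset.mem_univ, true_and,
      Equiv.coe_toEmbedding] at hp hp'
    obtain ⟨q, ⟨h2, _⟩, rfl⟩ := hp
    rw [hσσ] at hp'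
    exact absurd hp'.2.1 h2.not_gt
  have h1 : (S.map σ.toEmbedding ∪ S').card = S.card + linkCount σ b n := by
    rw [Finset.card_union_of_disjoint hdisj, Finset.card_map]
    rfl
  rw [← h1, ← Nat.card_Ico, ← Finset.card_map Fin.valEmbedding]
  refine Finset.card_le_card fun p => ?_
  simp only [Finset.mem_map, Finset.mem_union, hS, hS', Finset.mem_filter, Finset.mem_univ,
    true_and, Equiv.coe_toEmbedding, Fin.valEmbedding_apply, Finset.mem_Ico]
  rintro ⟨q, ⟨r, ⟨h1, h2⟩, rfl⟩ | ⟨h1, h2, h3⟩, rfl⟩ <;> omega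

/-- A link not inside [a, b) starts before `a` or ends at `b` or later. -/
theorem linkCount_le_middle (hσ : σ ∈ involutions n) (a b : ℕ) :
    linkCount σ 0 n ≤
      linkCount σ a b + (a - linkCount σ 0 a) + ((n - b) - linkCount σ b n) := by
  have h1 := card_links_left hσ a
  have h2 := card_links_right hσ b
  have h3 : linkCount σ 0 n ≤ linkCount σ a b +
      (Finset.univ.filter fun p : Fin n => p < σ p ∧ (p : ℕ) < a).card +
      (Finset.univ.filter fun p : Fin n => p < σ p ∧ b ≤ (σ p : ℕ)).card := by
    refine le_trans (Finset.card_le_card ?_)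
      ((Finset.card_union_le _ _).trans (Nat.add_le_add_right (Finset.card_union_le _ _) _))
    intro p
    simp only [Finset.mem_union, Finset.mem_filter, Finset.mem_univ, true_and]
    rintro ⟨_, h, _⟩
    simp only [h, true_and]
    omega
  omega

end Inequalities

/-! ## Involutions with prescribed links -/

theorem exists_involution_of_links {n k : ℕ} (l r : Fin k → Fin n) (hl : Function.Injective l)
    (hr : Function.Injective r) (hlr : ∀ s t, l s ≠ r t) (hlt : ∀ s, l s < r s) :
    ∃ σ ∈ involutions n, ∀ a b, linkCount σ a b =
      (Finset.univ.filter fun s : Fin k => a ≤ l s ∧ (r s : ℕ) < b).card := by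
  classical
  set F : Fin n → Fin n := fun p => if h : ∃ s, l s = p then r h.choose else
    if h : ∃ s, r s = p then l h.choose else p with hF
  have hFl : ∀ s, F (l s) = r s := by
    intro s
    have h : ∃ t, l t = l s := ⟨s, rfl⟩
    simp only [hF]
    rw [dif_pos h, hl h.choose_spec]
  have hFr : ∀ s, F (r s) = l s := by
    intro s
    have h0 : ¬∃ t, l t = r s := fun ⟨t, ht⟩ => hlr t s ht
    have h : ∃ t, r t = r s := ⟨s, rfl⟩
    simp only [hF]
    rw [dif_neg h0, dif_pos h, hr h.choose_spec]
  have hFo : ∀ p, (∀ s, l s ≠ p) → (∀ s, r s ≠ p) → F p = p := by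
    intro p h1 h2
    simp only [hF]
    rw [dif_neg (by simpa using h1), dif_neg (by simpa using h2)]
  have hcases : ∀ p, (∃ s, l s = p) ∨ (∃ s, r s = p) ∨ F p = p := by
    intro p
    by_cases h1 : ∃ s, l s = p
    · exact Or.inl h1
    · by_cases h2 : ∃ s, r s = p
      · exact Or.inr (Or.inl h2)
      · exact Or.inr (Or.inr (hFo p (by simpa using h1) (by simpa using h2)))
  have hFF : Function.Involutive F := by
    intro p
    rcases hcases p with ⟨s, rfl⟩ | ⟨s, rfl⟩ | h
    · rw [hFl, hFr]
    · rw [hFr, hFl]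
    · rw [h, h]
  obtain ⟨σ, hσ⟩ : ∃ σ : Equiv.Perm (Fin n), ∀ p, σ p = F p := ⟨hFF.toPerm, fun _ => rfl⟩
  refine ⟨σ, mem_involutions_of_apply_apply fun p => by rw [hσ, hσ, hFF], fun a b => ?_⟩
  rw [linkCount, ← Finset.card_map ⟨l, hl⟩]
  congr 1
  ext p
  simp only [Finset.mem_filter, Finset.mem_univ, true_and, Finset.mem_map,
    Function.Embedding.coeFn_mk, hσ]
  constructor
  · rintro ⟨h1, h2, h3⟩
    rcases hcases p with ⟨s, rfl⟩ | ⟨s, rfl⟩ | h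
    · rw [hFl] at h3
      exact ⟨s, ⟨h1, h3⟩, rfl⟩
    · rw [hFr] at h2
      exact absurd h2 (hlt s).not_gt
    · exact absurd h.symm h2.ne
  · rintro ⟨s, ⟨h1, h2⟩, rfl⟩
    rw [hFl]
    exact ⟨h1, hlt s, h2⟩

/-- The increasing enumeration of the complement of the first and the last `r` elements of the
interval from `i` to `e - 1`. -/
def gapEnum (i e r t : ℕ) : ℕ :=
  if t < i then t else if t < e - 2 * r then t + r else t + 2 * r

/-- The number of `t` with `gapEnum i e r t < a`. -/
def gapIndex (i e r a : ℕ) : ℕ :=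
  if a ≤ i then a else if a ≤ i + r then i else if a ≤ e - r then a - r else
    if a ≤ e then e - 2 * r else a - 2 * r

/-- The left side bounds the links of the extremal involution inside [a, b), inner ones plus outer
ones. The numbers `c`, `c₁`, `c₂` stand for the counts of a competing involution on [a, b), [0, a)
and [b, n). -/
theorem gapIndex_inequality {n i e r k a b c c₁ c₂ : ℕ} (hie : i ≤ e) (hen : e ≤ n) (hrk : r ≤ k)
    (hk : 2 * k ≤ n) (hr : 2 * r ≤ e - i) (hkr : k ≤ r + i + (n - e)) (hab : a < b) (hb : b ≤ n)
    (h1 : k + c₁ + c₂ + b ≤ c + a + n) (h2 : r ≤ c + (a - i) + (e - b)) (h3 : r ≤ c₁ + (e - a))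
    (h4 : r ≤ c₂ + (b - i)) :
    (min r (b - (e - r)) - (a - i)) +
      ((gapIndex i e r b + 2 * r + k - n) - (gapIndex i e r a + r)) ≤ c := by
  obtain ⟨f, hf⟩ : ∃ f, f = min r (b - (e - r)) := ⟨_, rfl⟩
  have hf1 : f ≤ r := hf ▸ min_le_left _ _
  have hf2 : f ≤ b - (e - r) := hf ▸ min_le_right _ _
  rw [← hf]
  clear hf
  unfold gapIndex
  split_ifs <;> omega

/-- Among the involutions with at least `k` links, of which at least `r` lie in a given interval,
there is a smallest one. -/
theorem exists_least_involution {n i e r k : ℕ} (hie : i ≤ e) (hen : e ≤ n) (hrk : r ≤ k)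
    (hk : 2 * k ≤ n) (hr : 2 * r ≤ e - i) (hkr : k ≤ r + i + (n - e)) :
    ∃ τ ∈ involutions n, linkCount τ 0 n = k ∧ r ≤ linkCount τ i e ∧
      ∀ σ ∈ involutions n, r ≤ linkCount σ i e → k ≤ linkCount σ 0 n → LinkLE τ σ := by
  -- The first `r` indices of [i, e) are linked in order to its last `r`. Among the remaining n - 2r
  -- indices the first k - r are linked in order to the last k - r, whence the shift n - k - r in
  -- `u`.
  set l : ℕ → ℕ := fun s => if s < r then i + s else gapEnum i e r (s - r) with hl
  set u : ℕ → ℕ := fun s => if s < r then e - r + s else gapEnum i e r (s - r + (n - k - r)) with hu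
  have hln : ∀ s < k, l s < n := by
    intro s hs
    simp only [hl, gapEnum]
    split_ifs <;> omega
  have hun : ∀ s < k, u s < n := by
    intro s hs
    simp only [hu, gapEnum]
    split_ifs <;> omega
  obtain ⟨τ, hτ, hcount⟩ := exists_involution_of_links
    (fun s : Fin k => (⟨l s, hln s s.2⟩ : Fin n)) (fun s : Fin k => (⟨u s, hun s s.2⟩ : Fin n))
    (by
      rintro ⟨s, hs⟩ ⟨t, ht⟩ h
      have h : l s = l t := congrArg Fin.val h
      ext
      simp only [hl, gapEnum] at h ⊢
      split_ifs at h <;> omega)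
    (by
      rintro ⟨s, hs⟩ ⟨t, ht⟩ h
      have h : u s = u t := congrArg Fin.val h
      ext
      simp only [hu, gapEnum] at h ⊢
      split_ifs at h <;> omega)
    (by
      rintro ⟨s, hs⟩ ⟨t, ht⟩ h
      have h : l s = u t := congrArg Fin.val h
      simp only [hl, hu, gapEnum] at h
      split_ifs at h <;> omega)
    (by
      rintro ⟨s, hs⟩
      rw [Fin.lt_def]
      simp only [hl, hu, gapEnum]
      split_ifs <;> omega)
  simp only at hcount
  refine ⟨τ, hτ, ?_, ?_, ?_⟩
  · rw [hcount, Finset.filter_true_of_mem, Finset.card_univ, Fintype.card_fin]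
    exact fun s _ => ⟨Nat.zero_le _, hun s s.2⟩
  · rw [hcount]
    calc r = (Finset.univ : Finset (Fin r)).card := by simp
      _ ≤ _ := by
        refine Finset.card_le_card_of_injOn (Fin.castLE hrk) ?_ (Fin.castLE_injective hrk).injOn
        rintro ⟨s, hs⟩ -
        simp only [Finset.coe_filter, Finset.mem_univ, true_and, Set.mem_ofPred_eq,
          Fin.val_castLE, hl, hu, if_pos hs]
        omega
  · intro σ hσ h1 h2
    -- Links inside [a, b) have consecutive numbers: the inner ones lie between `a - i` and `b - (e
    -- - r)`, the outer ones between bounds read off from `gapIndex`.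
    have hupper : ∀ a b, linkCount τ a b ≤ (min r (b - (e - r)) - (a - i)) +
        ((gapIndex i e r b + 2 * r + k - n) - (gapIndex i e r a + r)) := by
      intro a b
      rw [hcount, ← Finset.card_map Fin.valEmbedding, ← Nat.card_Ico (a - i),
        ← Nat.card_Ico (gapIndex i e r a + r)]
      refine le_trans (Finset.card_le_card fun s => ?_) (Finset.card_union_le _ _)
      simp only [Finset.mem_map, Finset.mem_filter, Finset.mem_univ, true_and,
        Fin.valEmbedding_apply, Finset.mem_union, Finset.mem_Ico]
      rintro ⟨⟨t, ht⟩, ⟨h3, h4⟩, rfl⟩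
      simp only [hl, hu] at h3 h4 ⊢
      by_cases htr : t < r
      · rw [if_pos htr] at h3 h4
        left
        omega
      · rw [if_neg htr] at h3 h4
        right
        simp only [gapEnum] at h3 h4
        simp only [gapIndex]
        constructor
        · split_ifs at h3 ⊢ <;> omega
        · split_ifs at h4 ⊢ <;> omega
    have key : ∀ a b, b ≤ n → linkCount τ a b ≤ linkCount σ a b := by
      intro a b hb
      by_cases hab : b ≤ a
      · rw [linkCount_eq_zero τ (by omega)]
        exact Nat.zero_le _
      refine (hupper a b).trans ?_
      have f1 := linkCount_le_shrink hσ i e a b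
      have f2 := linkCount_le_middle hσ a b
      have f3 := linkCount_le_shrink hσ i e 0 a
      have f4 := linkCount_le_shrink hσ i e b n
      have g1 := two_mul_linkCount_le hσ 0 a
      have g2 := two_mul_linkCount_le hσ b n
      exact gapIndex_inequality (c₁ := linkCount σ 0 a) (c₂ := linkCount σ b n) hie hen
        hrk hk hr hkr (not_le.1 hab) hb (by omega) (by omega) (by omega) (by omega)
    intro a b
    by_cases hb : b ≤ n
    · exact key a b hb
    · rw [linkCount_of_le τ (by omega : n ≤ b), linkCount_of_le σ (by omega : n ≤ b)]
      exact key a n le_rfl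

/-! ## Intersections of orbit closures -/

section Intersection

variable {n : ℕ} {σ σ' τ : Equiv.Perm (Fin n)}

theorem borelOrbit_pairwiseDisjoint (n : ℕ) :
    (involutions n).PairwiseDisjoint (fun ς => borelOrbit (upperPart ς)) := by
  intro σ hσ τ hτ hne
  rw [Function.onFun, Set.disjoint_left]
  intro x hxσ hxτ
  apply hne
  have h1 := rankMatrix_of_mem_borelOrbit (upperPart_mem_strictlyUpper σ) hxσ
  have h2 := rankMatrix_of_mem_borelOrbit (upperPart_mem_strictlyUpper τ) hxτ
  have h : invRankMatrix σ = invRankMatrix τ := h1.symm.trans h2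
  exact LinkLE.antisymm hσ hτ ((entrywiseLE_iff_linkLE hσ hτ).1 fun i j => by rw [h])
    ((entrywiseLE_iff_linkLE hτ hσ).1 fun i j => by rw [h])

theorem entrywiseLE_minRankMatrix {A : Matrix (Fin n) (Fin n) ℕ} :
    EntrywiseLE A (minRankMatrix σ σ') ↔
      EntrywiseLE A (invRankMatrix σ) ∧ EntrywiseLE A (invRankMatrix σ') := by
  simp only [EntrywiseLE, minRankMatrix, Matrix.of_apply, le_min_iff, forall_and]

theorem closure_inter_closure (hσ : σ ∈ involutions n) (hσ' : σ' ∈ involutions n) :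
    closure[matZariski n] (borelOrbit (upperPart σ)) ∩
        closure[matZariski n] (borelOrbit (upperPart σ')) =
      squareZero n ∩ {x | EntrywiseLE (rankMatrix x) (minRankMatrix σ σ')} := by
  rw [closure_borelOrbit hσ, closure_borelOrbit hσ']
  ext x
  simp only [Set.mem_inter_iff, Set.mem_ofPred_eq, entrywiseLE_minRankMatrix]
  tauto

theorem closure_inter_closure_eq_iUnion (hσ : σ ∈ involutions n) (hσ' : σ' ∈ involutions n) :
    closure[matZariski n] (borelOrbit (upperPart σ)) ∩
        closure[matZariski n] (borelOrbit (upperPart σ')) =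
      ⋃ ς ∈ {ς | ς ∈ involutions n ∧ EntrywiseLE (invRankMatrix ς) (minRankMatrix σ σ')},
        borelOrbit (upperPart ς) := by
  rw [closure_inter_closure hσ hσ']
  ext x
  simp only [Set.mem_inter_iff, Set.mem_ofPred_eq, Set.mem_iUnion, exists_prop]
  constructor
  · rintro ⟨hx, hle⟩
    obtain ⟨τ, hτ, hxτ⟩ := exists_involution_mem_borelOrbit hx.1 hx.2
    refine ⟨τ, ⟨hτ, ?_⟩, hxτ⟩
    rwa [rankMatrix_of_mem_borelOrbit (upperPart_mem_strictlyUpper τ) hxτ] at hle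
  · rintro ⟨τ, ⟨hτ, hle⟩, hxτ⟩
    refine ⟨borelOrbit_subset_squareZero (upperPart_mem_squareZero hτ) hxτ, ?_⟩
    rwa [rankMatrix_of_mem_borelOrbit (upperPart_mem_strictlyUpper τ) hxτ]

theorem mem_closure_inter_closure (hσ : σ ∈ involutions n) (hσ' : σ' ∈ involutions n)
    (hτ : τ ∈ involutions n) (h : LinkLE τ σ) (h' : LinkLE τ σ') :
    upperPart τ ∈ closure[matZariski n] (borelOrbit (upperPart σ)) ∩
      closure[matZariski n] (borelOrbit (upperPart σ')) :=
  ⟨upperPart_mem_closure_of_linkLE hσ hτ h, upperPart_mem_closure_of_linkLE hσ' hτ h'⟩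

theorem closure_inter_closure_of_eq (hσ : σ ∈ involutions n) (hσ' : σ' ∈ involutions n)
    (hτ : τ ∈ involutions n) (h : invRankMatrix τ = minRankMatrix σ σ') :
    closure[matZariski n] (borelOrbit (upperPart σ)) ∩
      closure[matZariski n] (borelOrbit (upperPart σ')) =
      closure[matZariski n] (borelOrbit (upperPart τ)) := by
  rw [closure_inter_closure hσ hσ', closure_borelOrbit hτ, h]

/-- If an irreducible subset of the intersection of two orbit closures attains all entries of the
minimum of the rank matrices, then this minimum is the rank matrix of an involution. -/
theorem minRankMatrix_mem_of_isIrreducible (hσ : σ ∈ involutions n) (hσ' : σ' ∈ involutions n)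
    {Y : Set (Matrix (Fin n) (Fin n) ℂ)} (hY : @IsIrreducible _ (matZariski n) Y)
    (hsub : Y ⊆ closure[matZariski n] (borelOrbit (upperPart σ)) ∩
      closure[matZariski n] (borelOrbit (upperPart σ')))
    (hatt : ∀ i j : Fin n, i < j → ∃ τ ∈ involutions n, upperPart τ ∈ Y ∧
      min (linkCount σ i (j + 1)) (linkCount σ' i (j + 1)) ≤ linkCount τ i (j + 1)) :
    minRankMatrix σ σ' ∈ involutionRankMatrices n := by
  rw [closure_inter_closure hσ hσ'] at hsub
  -- The rank matrix of `ρ` is below the minimum because its orbit meets `Y`, and above every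
  -- attained entry because `Y` lies in its closure.
  obtain ⟨ρ, hρ, ⟨y, hyρ, hy⟩, hYρ⟩ :=
    exists_subset_closure_borelOrbit hY fun y hy => (hsub hy).1
  refine ⟨ρ, hρ, ?_⟩
  ext i j
  apply le_antisymm
  · have h := (hsub hy).2 i j
    rwa [rankMatrix_of_mem_borelOrbit (upperPart_mem_strictlyUpper ρ) hyρ] at h
  · simp only [minRankMatrix, Matrix.of_apply, invRankMatrix_apply hσ, invRankMatrix_apply hσ']
    by_cases hij : i < j
    · rw [if_pos hij, if_pos hij]
      obtain ⟨τ, hτ, hτY, hle⟩ := hatt i j hij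
      have h := (closure_borelOrbit_subset hρ (hYρ hτY)).2 i j
      change invRankMatrix τ i j ≤ _ at h
      rw [invRankMatrix_apply hτ, if_pos hij] at h
      exact hle.trans h
    · rw [if_neg hij, if_neg hij]
      simp

theorem isIrreducible_closure_inter_closure_iff (hσ : σ ∈ involutions n)
    (hσ' : σ' ∈ involutions n) :
    @IsIrreducible _ (matZariski n) (closure[matZariski n] (borelOrbit (upperPart σ)) ∩
        closure[matZariski n] (borelOrbit (upperPart σ'))) ↔
      minRankMatrix σ σ' ∈ involutionRankMatrices n := by
  constructor
  · intro hY
    refine minRankMatrix_mem_of_isIrreducible hσ hσ' hY subset_rfl fun i j hij => ?_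
    have hr : 2 * min (linkCount σ i (j + 1)) (linkCount σ' i (j + 1)) ≤ j + 1 - i := by
      have := two_mul_linkCount_le hσ i (j + 1)
      omega
    rw [Fin.lt_def] at hij
    have := j.2
    -- No total rank is prescribed here, so `k` is taken equal to `r`.
    obtain ⟨τ, hτ, -, h1, h2⟩ := exists_least_involution (n := n) (i := i) (e := j + 1)
      (r := min (linkCount σ i (j + 1)) (linkCount σ' i (j + 1))) (by omega) (by omega) le_rfl
      (by omega) hr (by omega)
    have m1 := linkCount_mono σ (Nat.zero_le i) (show (j : ℕ) + 1 ≤ n by omega)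
    have m2 := linkCount_mono σ' (Nat.zero_le i) (show (j : ℕ) + 1 ≤ n by omega)
    exact ⟨τ, hτ, mem_closure_inter_closure hσ hσ' hτ (h2 σ hσ (min_le_left _ _) (by omega))
      (h2 σ' hσ' (min_le_right _ _) (by omega)), h1⟩
  · rintro ⟨τ, hτ, h⟩
    rw [closure_inter_closure_of_eq hσ hσ' hτ h]
    let _ := matZariski n
    exact isIrreducible_iff_closure.2 (isIrreducible_borelOrbit _)

end Intersection

/-! ## The greedy matching -/

/-- The counting hypothesis ensures that every `j` finds a partner; it survives the removal of the
first pair because both sides drop by one. No element of `A` or `l` lies under the first arc, by the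
choice of its ends, and a later arc contains either end of the first one exactly when it contains
the other. -/
theorem greedyInvolution_spec {n : ℕ} (l : List (Fin n)) (A : Finset (Fin n))
    (hsort : l.Pairwise (· < ·)) (hdisj : ∀ j ∈ l, j ∉ A)
    (hcount : ∀ j ∈ l, (l.filter (· ≤ j)).length ≤ (A.filter (· < j)).card) :
    (∀ p, p ∉ A → p ∉ l → greedyInvolution l A p = p) ∧
    (∀ j ∈ l, greedyInvolution l A j ∈ A ∧ greedyInvolution l A j < j ∧
      greedyInvolution l A (greedyInvolution l A j) = j) ∧
    (∀ d ∈ A, greedyInvolution l A d = d ∨ (greedyInvolution l A d ∈ l ∧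
      d < greedyInvolution l A d ∧ greedyInvolution l A (greedyInvolution l A d) = d)) ∧
    ∀ j ∈ l, ∀ d, greedyInvolution l A j < d → d < j → (d ∈ A ∨ d ∈ l) →
      greedyInvolution l A d ≠ d ∧ greedyInvolution l A j < greedyInvolution l A d ∧
        greedyInvolution l A d < j := by
  induction l generalizing A with
  | nil => simp [greedyInvolution]
  | cons j js ih =>
    rw [List.pairwise_cons] at hsort
    obtain ⟨hjlt, hsort⟩ := hsort
    have hne : (A.filter fun d => d < j).Nonempty := by
      rw [← Finset.card_pos]
      refine lt_of_lt_of_le ?_ (hcount j List.mem_cons_self)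
      rw [List.filter_cons_of_pos (by simp)]
      simp
    set x := (A.filter fun d => d < j).max' hne with hx
    obtain ⟨hxA, hxj⟩ := Finset.mem_filter.1 (Finset.max'_mem _ hne)
    rw [← hx] at hxA hxj
    have hxmax : ∀ d ∈ A, d < j → d ≤ x := fun d hd hdj =>
      Finset.le_max' _ _ (Finset.mem_filter.2 ⟨hd, hdj⟩)
    have hjA : j ∉ A := hdisj j List.mem_cons_self
    have hxjs : x ∉ js := fun h => hdisj x (List.mem_cons_of_mem _ h) hxA
    have hjjs : j ∉ js := fun h => lt_irrefl _ (hjlt j h)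
    have hdef : greedyInvolution (j :: js) A =
        Equiv.swap x j * greedyInvolution js (A.erase x) := by
      rw [greedyInvolution, dif_pos hne]
    obtain ⟨i1, i2, i3, i4⟩ := ih (A.erase x) hsort
      (fun j' hj' h => hdisj j' (List.mem_cons_of_mem _ hj') (Finset.mem_of_mem_erase h)) (by
        intro j' hj'
        have h1 := hcount j' (List.mem_cons_of_mem _ hj')
        rw [List.filter_cons_of_pos (by simpa using (hjlt j' hj').le), List.length_cons] at h1
        rw [Finset.filter_erase, Finset.card_erase_of_mem]
        · omega
        · exact Finset.mem_filter.2 ⟨hxA, hxj.trans (hjlt j' hj')⟩)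
    set g := greedyInvolution js (A.erase x) with hg
    have hgx : g x = x := i1 x (Finset.notMem_erase x A) hxjs
    have hgj : g j = j := i1 j (fun h => hjA (Finset.mem_of_mem_erase h)) hjjs
    rw [hdef]
    set τ := Equiv.swap x j * g with hτ
    have hτx : τ x = j := by simp [hτ, hgx]
    have hτj : τ j = x := by simp [hτ, hgj]
    have hτo : ∀ p, p ≠ x → p ≠ j → τ p = g p := by
      intro p hpx hpj
      rw [hτ, Equiv.Perm.mul_apply, Equiv.swap_apply_of_ne_of_ne]
      · rw [← hgx]
        exact fun h => hpx (g.injective h)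
      · rw [← hgj]
        exact fun h => hpj (g.injective h)
    have hne_of_mem : ∀ j' ∈ js, j' ≠ x ∧ j' ≠ j := fun j' hj' =>
      ⟨fun h => hxjs (h ▸ hj'), fun h => hjjs (h ▸ hj')⟩
    have hne_of_mem' : ∀ d ∈ A.erase x, d ≠ x ∧ d ≠ j := fun d hd =>
      ⟨Finset.ne_of_mem_erase hd, fun h => hjA (h ▸ Finset.mem_of_mem_erase hd)⟩
    refine ⟨?_, ?_, ?_, ?_⟩
    · intro p hpA hpl
      rw [List.mem_cons, not_or] at hpl
      rw [hτo p (fun h => hpA (h ▸ hxA)) hpl.1]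
      exact i1 p (fun h => hpA (Finset.mem_of_mem_erase h)) hpl.2
    · intro j' hj'
      rcases List.mem_cons.1 hj' with rfl | hj'
      · rw [hτj]
        exact ⟨hxA, hxj, hτx⟩
      · obtain ⟨h1, h2, h3⟩ := i2 j' hj'
        obtain ⟨n1, n2⟩ := hne_of_mem j' hj'
        obtain ⟨n3, n4⟩ := hne_of_mem' _ h1
        rw [hτo j' n1 n2, hτo _ n3 n4]
        exact ⟨Finset.mem_of_mem_erase h1, h2, h3⟩
    · intro d hd
      by_cases hdx : d = x
      · subst hdx
        rw [hτx]
        exact Or.inr ⟨List.mem_cons_self, hxj, hτj⟩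
      · have hd' := Finset.mem_erase.2 ⟨hdx, hd⟩
        obtain ⟨n1, n2⟩ := hne_of_mem' d hd'
        rcases i3 d hd' with h | ⟨h1, h2, h3⟩
        · left
          rw [hτo d n1 n2, h]
        · right
          obtain ⟨n3, n4⟩ := hne_of_mem _ h1
          rw [hτo d n1 n2, hτo _ n3 n4]
          exact ⟨List.mem_cons_of_mem _ h1, h2, h3⟩
    · intro j' hj' d hd1 hd2 hd
      rcases List.mem_cons.1 hj' with rfl | hj'
      · exfalso
        rw [hτj] at hd1
        rcases hd with hd | hd
        · exact (hxmax d hd hd2).not_gt hd1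
        · rcases List.mem_cons.1 hd with rfl | hd
          · exact lt_irrefl _ hd2
          · exact (hjlt d hd).not_gt hd2
      · obtain ⟨n1, n2⟩ := hne_of_mem j' hj'
        rw [hτo j' n1 n2] at hd1 ⊢
        by_cases hdx : d = x
        · subst hdx
          rw [hτx]
          exact ⟨hxj.ne', hd1.trans hxj, hjlt j' hj'⟩
        · by_cases hdj : d = j
          -- The left end of the later arc is in `A` and below `j`, hence strictly below the maximal
          -- choice `x`.
          · rw [hdj] at hd1 hd2 ⊢
            rw [hτj]
            obtain ⟨h1, h2, h3⟩ := i2 j' hj'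
            refine ⟨hxj.ne, ?_, hxj.trans hd2⟩
            exact lt_of_le_of_ne (hxmax _ (Finset.mem_of_mem_erase h1) hd1) (hne_of_mem' _ h1).1
          · rw [hτo d hdx hdj]
            refine i4 j' hj' d hd1 hd2 ?_
            rcases hd with hd | hd
            · exact Or.inl (Finset.mem_erase.2 ⟨hdx, hd⟩)
            · exact Or.inr ((List.mem_cons.1 hd).resolve_left hdj)

/-! ## Involutions with prescribed right end points -/

section RightEnds

variable {n : ℕ} {σ τ : Equiv.Perm (Fin n)}

theorem linkCount_zero_eq_card (hσ : σ ∈ involutions n) (b : ℕ) :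
    linkCount σ 0 b = (Finset.univ.filter fun q : Fin n => σ q < q ∧ (q : ℕ) < b).card := by
  have hσσ := involution_apply_apply hσ
  rw [linkCount, ← Finset.card_map σ.toEmbedding]
  congr 1
  ext q
  simp only [Finset.mem_map, Finset.mem_filter, Finset.mem_univ, true_and, Equiv.coe_toEmbedding]
  constructor
  · rintro ⟨p, ⟨_, h1, h2⟩, rfl⟩
    rw [hσσ]
    exact ⟨h1, h2⟩
  · rintro ⟨h1, h2⟩
    refine ⟨σ q, ⟨Nat.zero_le _, ?_, ?_⟩, hσσ q⟩
    · rwa [hσσ]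
    · rwa [hσσ]

/-- A noncrossing involution without fixed points under its links is the largest one among the
involutions with the same right end points. -/
theorem linkLE_of_noncrossing (hσ : σ ∈ involutions n) (hτ : τ ∈ involutions n)
    (hends : ∀ v, τ v < v ↔ σ v < v)
    (hnc : ∀ j, σ j < j → ∀ d, σ j < d → d < j → σ d ≠ d ∧ σ j < σ d ∧ σ d < j) :
    LinkLE τ σ := by
  intro a b
  induction b with
  | zero =>
    rw [linkCount_eq_zero τ (by omega)]
    exact Nat.zero_le _
  | succ b ih =>
    by_cases hb : b < n
    · obtain ⟨v, rfl⟩ : ∃ v : Fin n, (v : ℕ) = b := ⟨⟨b, hb⟩, rfl⟩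
      have e1 := linkCount_succ_right hσ v a
      have e2 := linkCount_succ_right hτ v a
      by_cases h1 : σ v < v
      · by_cases h2 : a ≤ (σ v : ℕ)
        · rw [if_pos ⟨h1, h2⟩] at e1
          split_ifs at e2 <;> omega
        · rw [if_neg (fun h => h2 h.2)] at e1
          -- Here `a` lies beyond `σ v`. A left end of `τ` in [a, v) is not a right end of `σ` and
          -- lies under the arc ending at `v`, so it starts a link of `σ` that closes before `v`.
          rw [e1, add_zero]
          refine Finset.card_le_card fun p => ?_
          simp only [Finset.mem_filter, Finset.mem_univ, true_and]
          rintro ⟨h3, h4, h5⟩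
          have h6 : ¬σ p < p := by
            rw [← hends]
            exact h4.not_gt
          obtain ⟨h7, h8, h9⟩ := hnc v h1 p (by rw [Fin.lt_def]; omega)
            (by rw [Fin.lt_def] at h4 ⊢; omega)
          exact ⟨h3, lt_of_le_of_ne (not_lt.1 h6) (Ne.symm h7), h9⟩
      · rw [if_neg (fun h => h1 h.1)] at e1
        rw [if_neg (fun h => h1 ((hends v).1 h.1))] at e2
        omega
    · rw [linkCount_of_le τ (by omega : n ≤ b + 1), linkCount_of_le σ (by omega : n ≤ b + 1)]
      rwa [linkCount_of_le τ (by omega : n ≤ b), linkCount_of_le σ (by omega : n ≤ b)] at ih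

end RightEnds

/-! ## Tableaux with at most two columns -/

section Tableaux

variable {n : ℕ} {μ : YoungDiagram}

namespace Tableau

theorem mem_column {T : Tableau n μ} {c : ℕ} {v : Fin n} :
    v ∈ T.column c ↔ (T.entry.symm v).1.2 = c := by
  simp [Tableau.column]

/-- Entries increase down the column and `P` is closed downwards, so the boxes satisfying `P` fill
an initial segment of the column. -/
theorem exists_entry_iff (T : Tableau n μ) (P : Fin n → Prop) [DecidablePred P]
    (hP : ∀ v w, w ≤ v → P v → P w) (i c : ℕ) :
    (∃ h : (i, c) ∈ μ.cells, P (T.entry ⟨(i, c), h⟩)) ↔ i < ((T.column c).filter P).card := by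
  set D : Finset ℕ := ((T.column c).filter P).image fun v => (T.entry.symm v).1.1 with hD
  have hcard : D.card = ((T.column c).filter P).card := by
    refine Finset.card_image_of_injOn fun v hv w hw h => ?_
    simp only [Finset.coe_filter, Set.mem_ofPred_eq, mem_column] at hv hw
    exact T.entry.symm.injective (Subtype.ext (Prod.ext h (hv.1.trans hw.1.symm)))
  have hmem : ∀ i, i ∈ D ↔ ∃ h : (i, c) ∈ μ.cells, P (T.entry ⟨(i, c), h⟩) := by
    intro i
    simp only [hD, Finset.mem_image, Finset.mem_filter, mem_column]
    constructor
    · rintro ⟨v, ⟨hv, hPv⟩, rfl⟩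
      have h : T.entry.symm v = ⟨((T.entry.symm v).1.1, c), hv ▸ (T.entry.symm v).2⟩ :=
        Subtype.ext (Prod.ext rfl hv)
      refine ⟨hv ▸ (T.entry.symm v).2, ?_⟩
      rw [← h, Equiv.apply_symm_apply]
      exact hPv
    · rintro ⟨h, hPv⟩
      exact ⟨T.entry ⟨(i, c), h⟩, ⟨by simp, hPv⟩, by simp⟩
  have hlower : ∀ i j, j ≤ i → i ∈ D → j ∈ D := by
    intro i j hji hi
    obtain ⟨h, hPi⟩ := (hmem i).1 hi
    have hj : (j, c) ∈ μ.cells := μ.isLowerSet (Prod.mk_le_mk.2 ⟨hji, le_rfl⟩) h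
    refine (hmem j).2 ⟨hj, ?_⟩
    rcases hji.lt_or_eq with hlt | rfl
    · exact hP _ _ (T.col_lt ⟨(j, c), hj⟩ ⟨(i, c), h⟩ rfl hlt).le hPi
    · exact hPi
  rw [← hmem, ← hcard]
  constructor
  · intro hi
    have : Finset.range (i + 1) ⊆ D := fun j hj => hlower i j (by
      rw [Finset.mem_range] at hj
      omega) hi
    have := Finset.card_le_card this
    rw [Finset.card_range] at this
    omega
  · intro hi
    by_contra hiD
    have : D ⊆ Finset.range i := fun j hj => by
      rw [Finset.mem_range]
      by_contra hji
      exact hiD (hlower j i (by omega) hj)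
    have := Finset.card_le_card this
    rw [Finset.card_range] at this
    omega

theorem mem_boxesUpTo_iff (T : Tableau n μ) (m : Fin n) (c : ℕ × ℕ) :
    c ∈ T.boxesUpTo m ↔ c.1 < ((T.column c.2).filter (· ≤ m)).card :=
  T.exists_entry_iff (· ≤ m) (fun _ _ h h' => h.trans h') c.1 c.2

theorem mem_cells_iff (T : Tableau n μ) (c : ℕ × ℕ) :
    c ∈ μ.cells ↔ c.1 < (T.column c.2).card := by
  have := T.exists_entry_iff (fun _ => True) (fun _ _ _ h => h) c.1 c.2
  simpa using this

theorem column_lt_two (hμ : μ.rowLen 0 ≤ 2) {c : ℕ × ℕ} (hc : c ∈ μ.cells) : c.2 < 2 := by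
  have h1 : (c.1, c.2) ∈ μ := hc
  have h2 := YoungDiagram.mem_iff_lt_rowLen.1 h1
  have h3 := μ.rowLen_anti 0 c.1 (Nat.zero_le _)
  omega

theorem mem_column_zero_iff (hμ : μ.rowLen 0 ≤ 2) (T : Tableau n μ) (v : Fin n) :
    v ∈ T.column 0 ↔ v ∉ T.column 1 := by
  have := column_lt_two hμ (T.entry.symm v).2
  rw [mem_column, mem_column]
  omega

theorem column_eq_empty (hμ : μ.rowLen 0 ≤ 2) (T : Tableau n μ) {c : ℕ} (hc : 2 ≤ c) :
    T.column c = ∅ := by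
  ext v
  have := column_lt_two hμ (T.entry.symm v).2
  rw [mem_column]
  simp only [Finset.notMem_empty, iff_false]
  omega

theorem column_zero_filter_card (hμ : μ.rowLen 0 ≤ 2) (T : Tableau n μ) (P : Fin n → Prop)
    [DecidablePred P] : ((T.column 0).filter P).card =
      (Finset.univ.filter P).card - ((T.column 1).filter P).card := by
  have h : (T.column 0).filter P = (Finset.univ.filter P) \ ((T.column 1).filter P) := by
    ext v
    simp only [Finset.mem_filter, Finset.mem_sdiff, Finset.mem_univ, true_and,
      T.mem_column_zero_iff hμ v]
    tauto
  rw [h, Finset.card_sdiff_of_subset]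
  exact Finset.filter_subset_filter _ (Finset.subset_univ _)

/-- Each entry of the second column is sent to its smaller left neighbour in the same row. -/
theorem card_column_one_le (T : Tableau n μ) {j : Fin n} (_ : j ∈ T.column 1) :
    ((T.column 1).filter (· ≤ j)).card ≤ ((T.column 0).filter (· < j)).card := by
  have hbox : ∀ v ∈ T.column 1, ((T.entry.symm v).1.1, 0) ∈ μ.cells := fun v hv =>
    μ.isLowerSet (Prod.mk_le_mk.2 ⟨le_rfl, Nat.zero_le _⟩) (T.entry.symm v).2
  classical
  set F : Fin n → Fin n := fun v => if h : ((T.entry.symm v).1.1, 0) ∈ μ.cells then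
    T.entry ⟨_, h⟩ else v with hF
  refine Finset.card_le_card_of_injOn F ?_ ?_
  · intro v hv
    simp only [Finset.coe_filter, Set.mem_ofPred_eq] at hv ⊢
    have hb := hbox v hv.1
    have hFv : F v = T.entry ⟨_, hb⟩ := by
      simp only [hF]
      rw [dif_pos hb]
    rw [hFv]
    refine ⟨mem_column.2 (by simp), lt_of_lt_of_le ?_ hv.2⟩
    conv_rhs => rw [← T.entry.apply_symm_apply v]
    refine T.row_lt _ _ rfl ?_
    rw [mem_column.1 hv.1]
    exact Nat.zero_lt_one
  · intro v hv w hw h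
    simp only [Finset.coe_filter, Set.mem_ofPred_eq] at hv hw
    simp only [hF] at h
    rw [dif_pos (hbox v hv.1), dif_pos (hbox w hw.1)] at h
    have h1 := congrArg (fun c => c.1.1) (T.entry.injective h)
    exact T.entry.symm.injective (Subtype.ext (Prod.ext h1
      ((mem_column.1 hv.1).trans (mem_column.1 hw.1).symm)))

theorem involution_spec (hμ : μ.rowLen 0 ≤ 2) (T : Tableau n μ) :
    T.involution ∈ involutions n ∧ (∀ v, T.involution v < v ↔ v ∈ T.column 1) ∧
      ∀ j, T.involution j < j → ∀ d, T.involution j < d → d < j →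
        T.involution d ≠ d ∧ T.involution j < T.involution d ∧ T.involution d < j := by
  have hmem : ∀ v, v ∈ (T.column 1).sort (fun a b => a ≤ b) ↔ v ∈ T.column 1 := fun v =>
    Finset.mem_sort _
  have hcover : ∀ v, v ∈ T.column 0 ∨ v ∈ T.column 1 := by
    intro v
    rw [T.mem_column_zero_iff hμ]
    tauto
  obtain ⟨h1, h2, h3, h4⟩ := greedyInvolution_spec ((T.column 1).sort (fun a b => a ≤ b))
    (T.column 0) (Finset.sortedLT_sort _).pairwise
    (fun j hj h => (T.mem_column_zero_iff hμ j).1 h ((hmem j).1 hj)) (by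
      intro j hj
      refine le_trans (le_of_eq ?_) (T.card_column_one_le ((hmem j).1 hj))
      rw [← List.toFinset_card_of_nodup ((Finset.sort_nodup _ _).filter _), List.toFinset_filter,
        Finset.sort_toFinset]
      congr 1
      ext v
      simp)
  change (∀ p, p ∉ T.column 0 → _ → T.involution p = p) at h1
  simp only [hmem] at h2 h3 h4
  change ∀ j ∈ T.column 1, T.involution j ∈ T.column 0 ∧ T.involution j < j ∧
    T.involution (T.involution j) = j at h2
  change ∀ d ∈ T.column 0, T.involution d = d ∨ (T.involution d ∈ T.column 1 ∧
    d < T.involution d ∧ T.involution (T.involution d) = d) at h3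
  change ∀ j ∈ T.column 1, ∀ d, T.involution j < d → d < j → (d ∈ T.column 0 ∨ d ∈ T.column 1) →
    T.involution d ≠ d ∧ T.involution j < T.involution d ∧ T.involution d < j at h4
  have hends : ∀ v, T.involution v < v ↔ v ∈ T.column 1 := by
    intro v
    refine ⟨fun hv => ?_, fun hv => (h2 v hv).2.1⟩
    rcases hcover v with h | h
    · rcases h3 v h with h' | ⟨_, h', _⟩
      · exact absurd h' hv.ne
      · exact absurd h' hv.not_gt
    · exact h
  refine ⟨mem_involutions_of_apply_apply fun v => ?_, hends, fun j hj d hd1 hd2 =>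
    h4 j ((hends j).1 hj) d hd1 hd2 (hcover d)⟩
  rcases hcover v with h | h
  · rcases h3 v h with h' | ⟨_, _, h'⟩
    · rw [h', h']
    · exact h'
  · exact (h2 v h).2.2

theorem linkCount_involution (hμ : μ.rowLen 0 ≤ 2) (T : Tableau n μ) (b : ℕ) :
    linkCount T.involution 0 b = ((T.column 1).filter fun v : Fin n => (v : ℕ) < b).card := by
  obtain ⟨h1, h2, -⟩ := T.involution_spec hμ
  rw [linkCount_zero_eq_card h1]
  congr 1
  ext v
  simp [h2]

end Tableau

end Tableaux

/-! ## Jordan types -/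

section Jordan

theorem jordanBoxes_congr {V W : Type*} [AddCommGroup V] [Module ℂ V] [AddCommGroup W] [Module ℂ W]
    (e : V ≃ₗ[ℂ] W) {f : V →ₗ[ℂ] V} {g : W →ₗ[ℂ] W} (h : ∀ v, e (f v) = g (e v)) :
    jordanBoxes f = jordanBoxes g := by
  have hpow : ∀ (m : ℕ) v, e ((f ^ m) v) = (g ^ m) (e v) := by
    intro m
    induction m with
    | zero => simp
    | succ m ih =>
      intro v
      rw [pow_succ', pow_succ', Module.End.mul_apply, Module.End.mul_apply, h, ih]
  have hrank : ∀ m : ℕ, Module.finrank ℂ (LinearMap.range (f ^ m)) =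
      Module.finrank ℂ (LinearMap.range (g ^ m)) := by
    intro m
    have : (LinearMap.range (f ^ m)).map (e : V →ₗ[ℂ] W) = LinearMap.range (g ^ m) := by
      ext w
      simp only [Submodule.mem_map, LinearMap.mem_range]
      constructor
      · rintro ⟨_, ⟨v, rfl⟩, rfl⟩
        exact ⟨e v, (hpow m v).symm⟩
      · rintro ⟨u, rfl⟩
        refine ⟨_, ⟨e.symm u, rfl⟩, ?_⟩
        rw [LinearEquiv.coe_coe, hpow, LinearEquiv.apply_symm_apply]
    rw [← this, LinearEquiv.finrank_map_eq]
  simp only [jordanBoxes, hrank]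

theorem mem_jordanBoxes_of_mul_self {V : Type*} [AddCommGroup V] [Module ℂ V]
    {f : V →ₗ[ℂ] V} (hf : f ^ 2 = 0) (c : ℕ × ℕ) :
    c ∈ jordanBoxes f ↔
      (c.2 = 0 ∧ c.1 < Module.finrank ℂ V - Module.finrank ℂ (LinearMap.range f)) ∨
      (c.2 = 1 ∧ c.1 < Module.finrank ℂ (LinearMap.range f)) := by
  have hz : ∀ m : ℕ, 2 ≤ m → Module.finrank ℂ (LinearMap.range (f ^ m)) = 0 := by
    intro m hm
    rw [pow_eq_zero_of_le hm hf, LinearMap.range_zero, finrank_bot]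
  have h0 : Module.finrank ℂ (LinearMap.range (f ^ 0)) = Module.finrank ℂ V := by
    rw [pow_zero, Module.End.one_eq_id, LinearMap.range_id, finrank_top]
  obtain ⟨i, m⟩ := c
  simp only [jordanBoxes, Set.mem_ofPred_eq]
  rcases m with _ | _ | m
  · rw [h0, zero_add, pow_one]
    simp
  · rw [zero_add, pow_one, hz (1 + 1) le_rfl]
    simp
  · rw [hz (m + 1 + 1) (by omega)]
    simp

theorem toLin'_pow_two_eq_zero {m : Type*} [Fintype m] [DecidableEq m] {x : Matrix m m ℂ}
    (hx : x * x = 0) : Matrix.toLin' x ^ 2 = 0 := by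
  rw [pow_two, Module.End.mul_eq_comp, ← Matrix.toLin'_mul, hx, map_zero]

theorem mem_jordanBoxes_toLin' {m : Type*} [Fintype m] [DecidableEq m] {x : Matrix m m ℂ}
    (hx : x * x = 0) (c : ℕ × ℕ) :
    c ∈ jordanBoxes (Matrix.toLin' x) ↔ (c.2 = 0 ∧ c.1 < Fintype.card m - x.rank) ∨
      (c.2 = 1 ∧ c.1 < x.rank) := by
  rw [mem_jordanBoxes_of_mul_self (toLin'_pow_two_eq_zero hx), Module.finrank_pi]
  rfl

/-- Once the decreasing ranges of the powers stop shrinking they remain constant, and nilpotency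
makes the constant value zero. -/
theorem pow_two_eq_zero_of_rank_le {V : Type*} [AddCommGroup V] [Module ℂ V]
    [FiniteDimensional ℂ V] {f : V →ₗ[ℂ] V} (hf : IsNilpotent f)
    (h : Module.finrank ℂ (LinearMap.range (f ^ 2)) ≤
      Module.finrank ℂ (LinearMap.range (f ^ 3))) : f ^ 2 = 0 := by
  have hle : LinearMap.range (f ^ 3) ≤ LinearMap.range (f ^ 2) := by
    rw [pow_succ f 2]
    exact LinearMap.range_comp_le_range _ _
  have heq : LinearMap.range (f ^ 3) = LinearMap.range (f ^ 2) :=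
    Submodule.eq_of_le_of_finrank_le hle h
  have hstab : ∀ m : ℕ, LinearMap.range (f ^ (2 + m)) = LinearMap.range (f ^ 2) := by
    intro m
    induction m with
    | zero => rfl
    | succ m ih =>
      have h1 : LinearMap.range (f ^ (2 + (m + 1))) = (LinearMap.range (f ^ (2 + m))).map f := by
        rw [← add_assoc, pow_succ', Module.End.mul_eq_comp, LinearMap.range_comp]
      have h2 : LinearMap.range (f ^ 3) = (LinearMap.range (f ^ 2)).map f := by
        rw [pow_succ' f 2, Module.End.mul_eq_comp, LinearMap.range_comp]
      rw [h1, ih, ← h2, heq]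
  obtain ⟨m, hm⟩ := hf
  rw [← LinearMap.range_eq_bot, ← hstab m, pow_add, hm, mul_zero, LinearMap.range_zero]

end Jordan

/-! ## Orbital varieties -/

section OrbitalVarieties

variable {n : ℕ} {μ : YoungDiagram}

theorem mul_self_of_mem_nilpotentOrbit (hμ : μ.rowLen 0 ≤ 2) {x : Matrix (Fin n) (Fin n) ℂ}
    (hx : x ∈ nilpotentOrbit n μ) : x * x = 0 := by
  obtain ⟨hnil, hbox⟩ := hx
  -- An empty third column says that a truncated difference of ranks vanishes, that is, the rank of
  -- the square is at most that of the cube.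
  have h1 : ((0, 2) : ℕ × ℕ) ∉ jordanBoxes (Matrix.toLin' x) := by
    rw [hbox]
    intro h
    exact absurd (Tableau.column_lt_two hμ h) (by simp)
  have h2 : IsNilpotent (Matrix.toLin' x) := by
    obtain ⟨m, hm⟩ := hnil
    exact ⟨m, by rw [← Matrix.toLin'_pow, hm, map_zero]⟩
  simp only [jordanBoxes, Set.mem_ofPred_eq, not_lt] at h1
  have h3 := pow_two_eq_zero_of_rank_le h2 (Nat.sub_eq_zero_iff_le.1 (Nat.le_zero.1 h1))
  rw [pow_two, Module.End.mul_eq_comp, ← Matrix.toLin'_mul] at h3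
  exact (LinearEquiv.map_eq_zero_iff Matrix.toLin').1 h3

/-- The tableau only serves to express the column lengths of `μ`; its existence forces `μ` to have
`n` boxes. -/
theorem mem_nilpotentOrbit_iff (hμ : μ.rowLen 0 ≤ 2) (T : Tableau n μ)
    {x : Matrix (Fin n) (Fin n) ℂ} :
    x ∈ nilpotentOrbit n μ ↔ x * x = 0 ∧ x.rank = (T.column 1).card := by
  constructor
  · intro hx
    have hxx := mul_self_of_mem_nilpotentOrbit hμ hx
    refine ⟨hxx, ?_⟩
    have h : ∀ i, i < x.rank ↔ i < (T.column 1).card := by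
      intro i
      have h1 := mem_jordanBoxes_toLin' hxx (i, 1)
      rw [hx.2, Finset.mem_coe, T.mem_cells_iff] at h1
      simpa using h1.symm
    have h1 := h x.rank
    have h2 := h (T.column 1).card
    omega
  · rintro ⟨hxx, hr⟩
    refine ⟨⟨2, by rw [pow_two, hxx]⟩, ?_⟩
    ext ⟨i, c⟩
    rw [mem_jordanBoxes_toLin' hxx, Finset.mem_coe, T.mem_cells_iff, hr]
    have h0 := T.column_zero_filter_card hμ fun _ => True
    simp only [Finset.filter_true, Finset.card_univ] at h0
    rcases c with _ | _ | c
    · simp [h0]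
    · simp
    · simp [T.column_eq_empty hμ (show 2 ≤ c + 1 + 1 by omega)]

theorem principalBlock_Iic_mul_self {x : Matrix (Fin n) (Fin n) ℂ} (hx : x ∈ squareZero n)
    (m : Fin n) :
    principalBlock (Finset.Iic m) x * principalBlock (Finset.Iic m) x = 0 := by
  have ht := blockTriangular_of_strictlyUpper (f := fun k : Fin n => (k : ℕ))
    Fin.val_strictMono.monotone hx.1
  rw [← principalBlock_mul (levelConvex_Iic m) ht ht, hx.2]
  rfl

theorem jordanBoxes_Iic_eq_iff (hμ : μ.rowLen 0 ≤ 2) (T : Tableau n μ)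
    {x : Matrix (Fin n) (Fin n) ℂ} (hx : x ∈ squareZero n) (m : Fin n) :
    jordanBoxes (Matrix.toLin' (principalBlock (Finset.Iic m) x)) = T.boxesUpTo m ↔
      (principalBlock (Finset.Iic m) x).rank = ((T.column 1).filter (· ≤ m)).card := by
  have hxx := principalBlock_Iic_mul_self hx m
  constructor
  · intro h
    have h : ∀ i, i < (principalBlock (Finset.Iic m) x).rank ↔
        i < ((T.column 1).filter (· ≤ m)).card := by
      intro i
      have h1 := mem_jordanBoxes_toLin' hxx (i, 1)
      rw [h, T.mem_boxesUpTo_iff] at h1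
      simpa using h1.symm
    have h1 := h (principalBlock (Finset.Iic m) x).rank
    have h2 := h ((T.column 1).filter (· ≤ m)).card
    omega
  · intro hr
    ext ⟨i, c⟩
    rw [mem_jordanBoxes_toLin' hxx, T.mem_boxesUpTo_iff, hr]
    have h0 := T.column_zero_filter_card hμ (· ≤ m)
    have h1 : Fintype.card (Finset.Iic m) = (Finset.univ.filter (· ≤ m)).card := by
      rw [Fintype.card_coe]
      congr 1
      ext v
      simp
    rw [h1]
    rcases c with _ | _ | c
    · simp [h0]
    · simp
    · simp [T.column_eq_empty hμ (show 2 ≤ c + 1 + 1 by omega)]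

theorem mem_orbitalStratum_iff (hμ : μ.rowLen 0 ≤ 2) (T : Tableau n μ)
    {x : Matrix (Fin n) (Fin n) ℂ} :
    x ∈ orbitalStratum T ↔ x ∈ squareZero n ∧ ∀ m : Fin n,
      (principalBlock (Finset.Iic m) x).rank = ((T.column 1).filter (· ≤ m)).card := by
  constructor
  · rintro ⟨h1, h2, h3⟩
    have hx : x ∈ squareZero n := ⟨h1, mul_self_of_mem_nilpotentOrbit hμ h2⟩
    exact ⟨hx, fun m => (jordanBoxes_Iic_eq_iff hμ T hx m).1 (h3 m)⟩
  · rintro ⟨hx, h⟩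
    refine ⟨hx.1, (mem_nilpotentOrbit_iff hμ T).2 ⟨hx.2, ?_⟩,
      fun m => (jordanBoxes_Iic_eq_iff hμ T hx m).2 (h m)⟩
    -- The total rank is read off at the last index, which is missing for `n = 0`.
    rcases n with _ | n
    · rw [Finset.eq_empty_of_isEmpty (T.column 1)]
      have := Matrix.rank_le_card_width x
      simpa using this
    · have h1 := h (Fin.last n)
      have h2 : Finset.Iic (Fin.last n) = Finset.univ := by
        ext v
        simp [Fin.le_last]
      rw [h2, rank_principalBlock_univ] at h1
      rw [h1]
      congr 1
      exact Finset.filter_true_of_mem fun v _ => Fin.le_last v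

theorem upperPart_mem_orbitalStratum (hμ : μ.rowLen 0 ≤ 2) (T : Tableau n μ) :
    upperPart T.involution ∈ orbitalStratum T := by
  have hσ := (T.involution_spec hμ).1
  refine (mem_orbitalStratum_iff hμ T).2 ⟨upperPart_mem_squareZero hσ, fun m => ?_⟩
  rw [rank_Iic_upperPart hσ, T.linkCount_involution hμ]
  congr 1
  ext v
  simp only [Finset.mem_filter, Fin.le_def]
  exact and_congr_right fun _ => Nat.lt_succ_iff

theorem borelOrbit_subset_orbitalStratum (hμ : μ.rowLen 0 ≤ 2) (T : Tableau n μ)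
    {x : Matrix (Fin n) (Fin n) ℂ} (hx : x ∈ orbitalStratum T) :
    borelOrbit x ⊆ orbitalStratum T := by
  intro y hy
  rw [mem_orbitalStratum_iff hμ] at hx ⊢
  refine ⟨borelOrbit_subset_squareZero hx.1 hy, fun m => ?_⟩
  rw [rank_principalBlock_of_mem_borelOrbit hx.1.1 hy (levelConvex_Iic m), hx.2]

/-- The ranks of the leading blocks determine the right ends, which `τ` therefore shares with the
noncrossing `T.involution`. -/
theorem linkLE_involution_of_mem_orbitalStratum (hμ : μ.rowLen 0 ≤ 2) (T : Tableau n μ)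
    {τ : Equiv.Perm (Fin n)} (hτ : τ ∈ involutions n) (h : upperPart τ ∈ orbitalStratum T) :
    LinkLE τ T.involution := by
  obtain ⟨hσ, hends, hnc⟩ := T.involution_spec hμ
  refine linkLE_of_noncrossing hσ hτ (fun v => ?_) hnc
  have key : ∀ b ≤ n, linkCount τ 0 b = linkCount T.involution 0 b := by
    intro b hb
    rcases b with _ | b
    · rw [linkCount_eq_zero τ (by omega), linkCount_eq_zero _ (by omega)]
    · have h1 := ((mem_orbitalStratum_iff hμ T).1 h).2 ⟨b, hb⟩
      have h2 := ((mem_orbitalStratum_iff hμ T).1 (upperPart_mem_orbitalStratum hμ T)).2 ⟨b, hb⟩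
      rw [rank_Iic_upperPart hτ] at h1
      rw [rank_Iic_upperPart hσ] at h2
      exact h1.trans h2.symm
  have e1 := linkCount_succ_right hτ v 0
  have e2 := linkCount_succ_right hσ v 0
  have k1 := key (v + 1) v.2
  have k2 := key v v.2.le
  split_ifs at e1 e2 with h1 h2 h2
  · exact ⟨fun _ => h2.1, fun _ => h1.1⟩
  · omega
  · omega
  · simp only [Nat.zero_le, and_true] at h1 h2
    exact ⟨fun h => absurd h h1, fun h => absurd h h2⟩

/-- The stratum is a union of orbits whose involutions all lie below `T.involution`, and it contains
the orbit of the latter. -/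
theorem closure_orbitalStratum (hμ : μ.rowLen 0 ≤ 2) (T : Tableau n μ) :
    closure[matZariski n] (orbitalStratum T) =
      closure[matZariski n] (borelOrbit (upperPart T.involution)) := by
  let _ := matZariski n
  refine Set.Subset.antisymm (closure_minimal (fun x hx => ?_) isClosed_closure)
    (closure_mono (borelOrbit_subset_orbitalStratum hμ T (upperPart_mem_orbitalStratum hμ T)))
  have hsq := ((mem_orbitalStratum_iff hμ T).1 hx).1
  obtain ⟨τ, hτ, hxτ⟩ := exists_involution_mem_borelOrbit hsq.1 hsq.2
  have h1 := borelOrbit_subset_orbitalStratum hμ T hx (mem_borelOrbit_symm hxτ)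
  exact borelOrbit_subset_closure (upperPart_mem_closure_of_linkLE (T.involution_spec hμ).1 hτ
    (linkLE_involution_of_mem_orbitalStratum hμ T hτ h1)) hxτ

theorem orbitalVariety_subset_squareZero (hμ : μ.rowLen 0 ≤ 2) (T : Tableau n μ) :
    orbitalVariety T ⊆ squareZero n := by
  rintro x ⟨hx, _⟩
  rw [closure_orbitalStratum hμ T] at hx
  exact (closure_borelOrbit_subset (T.involution_spec hμ).1 hx).1

theorem upperPart_mem_nilpotentOrbit_iff (hμ : μ.rowLen 0 ≤ 2) (T : Tableau n μ)
    {τ : Equiv.Perm (Fin n)} (hτ : τ ∈ involutions n) :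
    upperPart τ ∈ nilpotentOrbit n μ ↔ linkCount τ 0 n = (T.column 1).card := by
  rw [mem_nilpotentOrbit_iff hμ T, rank_upperPart hτ, and_iff_right (upperPart_mul_self hτ)]

theorem linkCount_involution_total (hμ : μ.rowLen 0 ≤ 2) (T : Tableau n μ) :
    linkCount T.involution 0 n = (T.column 1).card := by
  rw [T.linkCount_involution hμ, Finset.filter_true_of_mem fun (v : Fin n) _ => v.2]

theorem card_column_one_eq (T T' : Tableau n μ) : (T.column 1).card = (T'.column 1).card := by
  have h : ∀ i, i < (T.column 1).card ↔ i < (T'.column 1).card := fun i =>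
    (T.mem_cells_iff (i, 1)).symm.trans (T'.mem_cells_iff (i, 1))
  have h1 := h (T.column 1).card
  have h2 := h (T'.column 1).card
  omega

/-- The witnesses for single entries are now chosen with exactly as many links as the second column
has boxes, so that they stay in the nilpotent orbit. Conversely, if the minimum is R_τ, the
intersection lies between the orbit of `upperPart τ` and its closure. -/
theorem isIrreducible_orbitalVariety_inter_iff (hμ : μ.rowLen 0 ≤ 2) (T T' : Tableau n μ) :
    @IsIrreducible _ (matZariski n) (orbitalVariety T ∩ orbitalVariety T') ↔
      minRankMatrix T.involution T'.involution ∈ involutionRankMatrices n := by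
  have hσ := (T.involution_spec hμ).1
  have hσ' := (T'.involution_spec hμ).1
  have hk := linkCount_involution_total hμ T
  have hk' := linkCount_involution_total hμ T'
  rw [card_column_one_eq T' T] at hk'
  have hset : orbitalVariety T ∩ orbitalVariety T' =
      (closure[matZariski n] (borelOrbit (upperPart T.involution)) ∩
        closure[matZariski n] (borelOrbit (upperPart T'.involution))) ∩ nilpotentOrbit n μ := by
    rw [orbitalVariety, orbitalVariety, closure_orbitalStratum hμ, closure_orbitalStratum hμ]
    ext x
    simp only [Set.mem_inter_iff]
    tauto
  rw [hset]
  set σ := T.involution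
  set σ' := T'.involution
  constructor
  · intro hY
    refine minRankMatrix_mem_of_isIrreducible hσ hσ' hY Set.inter_subset_left fun i j hij => ?_
    rw [Fin.lt_def] at hij
    have hj := j.2
    have a1 := two_mul_linkCount_le hσ i (j + 1)
    have a2 := two_mul_linkCount_le hσ 0 n
    have m1 := linkCount_mono σ (Nat.zero_le i) (show (j : ℕ) + 1 ≤ n by omega)
    have b1 := linkCount_le_shrink hσ 0 n i (j + 1)
    have b2 := linkCount_le_shrink hσ' 0 n i (j + 1)
    obtain ⟨τ, hτ, h0, h1, h2⟩ := exists_least_involution (n := n) (i := i) (e := j + 1)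
      (r := min (linkCount σ i (j + 1)) (linkCount σ' i (j + 1))) (k := (T.column 1).card)
      (by omega) (by omega) (by omega) (by omega) (by omega) (by omega)
    exact ⟨τ, hτ, ⟨mem_closure_inter_closure hσ hσ' hτ (h2 σ hσ (min_le_left _ _) hk.ge)
      (h2 σ' hσ' (min_le_right _ _) hk'.ge), (upperPart_mem_nilpotentOrbit_iff hμ T hτ).2 h0⟩, h1⟩
  · rintro ⟨τ, hτ, h⟩
    rw [closure_inter_closure_of_eq hσ hσ' hτ h]
    -- The top right entry of the rank matrix is the total number of links; it lies above the
    -- diagonal only if `n ≥ 2`.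
    have htot : linkCount τ 0 n = (T.column 1).card := by
      by_cases hn : n ≤ 1
      · rw [← hk, linkCount_eq_zero τ (by omega), linkCount_eq_zero σ (by omega)]
      · have h1 := congrFun (congrFun h ⟨0, by omega⟩) ⟨n - 1, by omega⟩
        have hlt : (⟨0, by omega⟩ : Fin n) < ⟨n - 1, by omega⟩ := by
          rw [Fin.lt_def]
          simp only
          omega
        simp only [minRankMatrix, Matrix.of_apply, invRankMatrix_apply hτ, invRankMatrix_apply hσ,
          invRankMatrix_apply hσ', if_pos hlt] at h1
        rw [show n - 1 + 1 = n by omega, hk, hk', min_self] at h1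
        exact h1
    have hmem : upperPart τ ∈ nilpotentOrbit n μ :=
      (upperPart_mem_nilpotentOrbit_iff hμ T hτ).2 htot
    have hsub : borelOrbit (upperPart τ) ⊆ nilpotentOrbit n μ := by
      rintro _ ⟨b, _, rfl⟩
      rw [mem_nilpotentOrbit_iff hμ T] at hmem ⊢
      rw [adj_mul_adj, hmem.1, adj_zero, rank_adj]
      exact ⟨rfl, hmem.2⟩
    let _ := matZariski n
    rw [← isIrreducible_iff_closure]
    have hcl : closure (closure[matZariski n] (borelOrbit (upperPart τ)) ∩ nilpotentOrbit n μ) =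
        closure (borelOrbit (upperPart τ)) :=
      Set.Subset.antisymm (closure_minimal Set.inter_subset_left isClosed_closure)
        (closure_mono (Set.subset_inter subset_closure hsub))
    rw [hcl]
    exact isIrreducible_iff_closure.2 (isIrreducible_borelOrbit _)

end OrbitalVarieties

/-! ## Open continuous maps with irreducible fibres -/

theorem isIrreducible_preimage_iff {X Y : Type*} [TopologicalSpace X] [TopologicalSpace Y]
    {f : X → Y} (hc : Continuous f) (ho : IsOpenMap f) (hf : ∀ y, IsPreirreducible (f ⁻¹' {y}))
    {C : Set Y} (hC : C ⊆ Set.range f) : IsIrreducible (f ⁻¹' C) ↔ IsIrreducible C := by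
  constructor
  · intro h
    rw [← Set.image_preimage_eq_of_subset hC]
    exact h.image f hc.continuousOn
  · intro h
    refine h.preimage_of_isPreirreducible_fiber f ho hf ?_
    rw [Set.inter_eq_left.2 hC]
    exact h.1

theorem isIrreducible_preimage_val_iff {X : Type*} [TopologicalSpace X] {S C : Set X} (h : C ⊆ S) :
    IsIrreducible ((Subtype.val : S → X) ⁻¹' C) ↔ IsIrreducible C := by
  have himage : Subtype.val '' ((Subtype.val : S → X) ⁻¹' C) = C :=
    Set.image_preimage_eq_of_subset (by rwa [Subtype.range_coe])
  constructor
  · intro hC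
    rw [← himage]
    exact hC.image _ continuous_subtype_val.continuousOn
  · rintro ⟨⟨y, hy⟩, hC⟩
    refine ⟨⟨⟨y, h hy⟩, hy⟩, ?_⟩
    rintro _ _ ⟨U, hU, rfl⟩ ⟨V, hV, rfl⟩ ⟨a, ha, haU⟩ ⟨b, hb, hbV⟩
    obtain ⟨z, hz, hzUV⟩ := hC U V hU hV ⟨a, ha, haU⟩ ⟨b, hb, hbV⟩
    exact ⟨⟨z, h hz⟩, hz, hzUV⟩

section Flags

variable {n : ℕ}

/-- The saturation of an open set is a union of its right translates by elements of `B`. -/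
theorem isOpenMap_flag (n : ℕ) :
    @IsOpenMap _ _ (glZariski n) (flagZariski n) (fun g => (g : FlagManifold n)) := by
  let _ := glZariski n
  let _ := flagZariski n
  intro U hU
  refine isOpen_coinduced.2 ?_
  have h : (fun g : GL (Fin n) ℂ => (g : FlagManifold n)) ⁻¹'
      ((fun g : GL (Fin n) ℂ => (g : FlagManifold n)) '' U) =
      ⋃ b : upperGroup n, (fun g => g * (b : GL (Fin n) ℂ)) ⁻¹' U :=
    QuotientGroup.preimage_image_mk _ _
  rw [h]
  exact isOpen_iUnion fun b => hU.preimage (continuous_gl_mul_right _)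

theorem isPreirreducible_flag_fiber (ξ : FlagManifold n) :
    @IsPreirreducible _ (glZariski n) ((fun g : GL (Fin n) ℂ => (g : FlagManifold n)) ⁻¹' {ξ}) := by
  obtain ⟨g, rfl⟩ := QuotientGroup.mk_surjective ξ
  have h : (fun g : GL (Fin n) ℂ => (g : FlagManifold n)) ⁻¹' {(g : FlagManifold n)} =
      {h : GL (Fin n) ℂ | (h : Matrix (Fin n) (Fin n) ℂ) ∈ {m : Matrix (Fin n) (Fin n) ℂ |
        (((g⁻¹ : GL (Fin n) ℂ) : Matrix (Fin n) (Fin n) ℂ) * m).BlockTriangular id}} := by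
    ext h
    rw [Set.mem_preimage, Set.mem_singleton_iff, eq_comm, QuotientGroup.eq]
    rfl
  rw [h]
  refine isPreirreducible_linear_section_gl _ fun a ha b hb t => ?_
  simp only [Set.mem_ofPred_eq] at ha hb ⊢
  intro i j hij
  rw [Matrix.mul_add, Matrix.mul_smul, Matrix.mul_sub]
  rw [Matrix.add_apply, Matrix.smul_apply, Matrix.sub_apply, ha hij, hb hij, sub_self, smul_zero,
    add_zero]

end Flags

/-! ## The conjugation map onto the square-zero matrices of a given rank -/

section Conjugation

variable {n : ℕ}

/-- The square-zero matrices of the same rank as `x`. -/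
def squareZeroSameRank (x : Matrix (Fin n) (Fin n) ℂ) : Set (Matrix (Fin n) (Fin n) ℂ) :=
  {y | y * y = 0 ∧ y.rank = x.rank}

/-- If `D * y * B` is invertible of size at least the rank of `y`, then `y` and `D * y` have the
same kernel, so an identity on the right of `y` may be checked after multiplication by `D`. Thus B
(D y B)⁻¹ D is a generalised inverse of `y`. -/
theorem det_smul_eq_of_rank_le {k : ℕ} {y : Matrix (Fin n) (Fin n) ℂ} (hy : y.rank ≤ k)
    {D : Matrix (Fin k) (Fin n) ℂ} {B : Matrix (Fin n) (Fin k) ℂ} (h : (D * y * B).det ≠ 0) :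
    (D * y * B).det • y = y * (B * (D * y * B).adjugate * D) * y := by
  have hrank : (D * y * B).rank = k := by
    rw [Matrix.rank_of_isUnit _ ((Matrix.isUnit_iff_isUnit_det _).2 h.isUnit), Fintype.card_fin]
  have hle : LinearMap.ker y.mulVecLin ≤ LinearMap.ker (D * y).mulVecLin := by
    intro v hv
    rw [LinearMap.mem_ker, Matrix.mulVecLin_apply] at hv ⊢
    rw [← Matrix.mulVec_mulVec, hv, Matrix.mulVec_zero]
  have hker : LinearMap.ker y.mulVecLin = LinearMap.ker (D * y).mulVecLin := by
    refine Submodule.eq_of_le_of_finrank_le hle ?_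
    have h1 := LinearMap.finrank_range_add_finrank_ker y.mulVecLin
    have h2 := LinearMap.finrank_range_add_finrank_ker (D * y).mulVecLin
    have h3 := Matrix.rank_mul_le_left (D * y) B
    rw [hrank] at h3
    change (D * y).rank + _ = _ at h2
    change y.rank + _ = _ at h1
    omega
  have hQ : D * y * ((D * y * B).det • (1 : Matrix (Fin n) (Fin n) ℂ) -
      B * (D * y * B).adjugate * D * y) = 0 := by
    have h1 : D * y * (B * (D * y * B).adjugate * D * y) =
        (D * y * B) * (D * y * B).adjugate * (D * y) := by
      simp only [Matrix.mul_assoc]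
    rw [Matrix.mul_sub, h1, Matrix.mul_adjugate, Matrix.mul_smul, Matrix.mul_one, Matrix.smul_mul,
      Matrix.one_mul, sub_self]
  have hyQ : y * ((D * y * B).det • (1 : Matrix (Fin n) (Fin n) ℂ) -
      B * (D * y * B).adjugate * D * y) = 0 := by
    refine Matrix.ext_of_mulVec_single fun i => ?_
    rw [Matrix.zero_mulVec, ← Matrix.mulVec_mulVec, ← Matrix.mulVecLin_apply, ← LinearMap.mem_ker,
      hker, LinearMap.mem_ker, Matrix.mulVecLin_apply, Matrix.mulVec_mulVec, hQ, Matrix.zero_mulVec]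
  rw [Matrix.mul_sub, Matrix.mul_smul, Matrix.mul_one, sub_eq_zero] at hyQ
  rw [hyQ]
  simp only [Matrix.mul_assoc]

/-- Locally, square-zero matrices of constant rank are conjugate by a matrix which depends
polynomially on them. -/
theorem exists_polynomial_conjugator {y₀ : Matrix (Fin n) (Fin n) ℂ} (h₀ : y₀ * y₀ = 0) :
    ∃ H : Matrix (Fin n) (Fin n) ℂ → Matrix (Fin n) (Fin n) ℂ,
      (∀ i j, (fun y => H y i j) ∈ polyFun n) ∧ H y₀ = 1 ∧
      ∃ δ ∈ polyFun n, δ y₀ ≠ 0 ∧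
        ∀ y ∈ squareZeroSameRank y₀, δ y ≠ 0 → y₀ * H y = H y * y := by
  obtain ⟨D, B, hDB⟩ := exists_mul_mul_eq_one (le_refl y₀.rank)
  have hz : y₀ * (B * D) * y₀ = y₀ := by
    have h := det_smul_eq_of_rank_le le_rfl (y := y₀) (D := D) (B := B) (by rw [hDB]; simp)
    rw [hDB, Matrix.det_one, one_smul, Matrix.adjugate_one, Matrix.mul_one] at h
    exact h.symm
  have hid : ∀ i j, (fun y : Matrix (Fin n) (Fin n) ℂ => y i j) ∈ polyFun n := entry_mem_polyFun
  have hE : ∀ i j, (fun y : Matrix (Fin n) (Fin n) ℂ => (D * y * B) i j) ∈ polyFun n :=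
    mul_mem_subalgebra (polyFun n) (fun y => D * y) (fun _ => B)
      (mul_mem_subalgebra (polyFun n) (fun _ => D) (fun y => y)
        (fun _ _ => const_mem_polyFun _) hid)
      (fun _ _ => const_mem_polyFun _)
  have hdet := det_mem_subalgebra (polyFun n) (fun y => D * y * B) hE
  have hR : ∀ i j, (fun y : Matrix (Fin n) (Fin n) ℂ =>
      (y * (B * (D * y * B).adjugate * D)) i j) ∈ polyFun n :=
    mul_mem_subalgebra (polyFun n) (fun y => y) (fun y => B * (D * y * B).adjugate * D) hid
      (mul_mem_subalgebra (polyFun n) (fun y => B * (D * y * B).adjugate) (fun _ => D)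
        (mul_mem_subalgebra (polyFun n) (fun _ => B) (fun y => (D * y * B).adjugate)
          (fun _ _ => const_mem_polyFun _)
          (adjugate_mem_subalgebra (polyFun n) (fun y => D * y * B) hE))
        (fun _ _ => const_mem_polyFun _))
  have hP : ∀ i j, (fun y : Matrix (Fin n) (Fin n) ℂ =>
      ((D * y * B).det • (1 : Matrix (Fin n) (Fin n) ℂ) -
        y * (B * (D * y * B).adjugate * D)) i j) ∈ polyFun n := fun i j =>
    sub_mem (mul_mem hdet (const_mem_polyFun ((1 : Matrix (Fin n) (Fin n) ℂ) i j))) (hR i j)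
  -- With z = B D, a generalised inverse of y₀, and P the bracketed factor, which satisfies P y = 0,
  -- both products y₀ H(y) and H(y) y equal y₀ z y. The last summand is chosen so that H(y₀) = 1.
  refine ⟨fun y => B * D * y + y₀ * (B * D) + (1 - B * D * y₀) *
    ((D * y * B).det • (1 : Matrix (Fin n) (Fin n) ℂ) - y * (B * (D * y * B).adjugate * D)),
    fun i j => ?_, ?_, fun y => (D * y * B).det, hdet, by simp [hDB], fun y hy hdet0 => ?_⟩
  · exact add_mem (add_mem
      (mul_mem_subalgebra (polyFun n) (fun _ => B * D) (fun y => y)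
        (fun _ _ => const_mem_polyFun _) hid i j) (const_mem_polyFun _))
      (mul_mem_subalgebra (polyFun n) (fun _ => 1 - B * D * y₀) _
        (fun _ _ => const_mem_polyFun _) hP i j)
  · beta_reduce
    rw [hDB, Matrix.det_one, one_smul, Matrix.adjugate_one, Matrix.mul_one]
    have h : B * D * y₀ * (y₀ * (B * D)) = 0 := by
      rw [Matrix.mul_assoc, ← Matrix.mul_assoc y₀ y₀, h₀, Matrix.zero_mul, Matrix.mul_zero]
    rw [Matrix.mul_sub, Matrix.mul_one, Matrix.sub_mul, h, Matrix.one_mul]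
    abel
  · have hPy : ((D * y * B).det • (1 : Matrix (Fin n) (Fin n) ℂ) -
        y * (B * (D * y * B).adjugate * D)) * y = 0 := by
      rw [Matrix.sub_mul, Matrix.smul_mul, Matrix.one_mul, det_smul_eq_of_rank_le hy.2.le hdet0,
        sub_self]
    have hz' : y₀ * (1 - B * D * y₀) = 0 := by
      rw [Matrix.mul_sub, Matrix.mul_one, ← Matrix.mul_assoc, hz, sub_self]
    beta_reduce
    generalize (D * y * B).det • (1 : Matrix (Fin n) (Fin n) ℂ) -
      y * (B * (D * y * B).adjugate * D) = P at hPy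
    calc y₀ * (B * D * y + y₀ * (B * D) + (1 - B * D * y₀) * P)
        = y₀ * (B * D) * y + y₀ * y₀ * (B * D) + y₀ * (1 - B * D * y₀) * P := by
          simp only [Matrix.mul_add, Matrix.mul_assoc]
      _ = B * D * (y * y) + y₀ * (B * D) * y + (1 - B * D * y₀) * (P * y) := by
          rw [h₀, hz', hPy, hy.1]
          simp
      _ = (B * D * y + y₀ * (B * D) + (1 - B * D * y₀) * P) * y := by
          simp only [Matrix.add_mul, Matrix.mul_assoc]

theorem adj_inv_mem_squareZeroSameRank {x : Matrix (Fin n) (Fin n) ℂ} (hx : x * x = 0)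
    (g : GL (Fin n) ℂ) : adj g⁻¹ x ∈ squareZeroSameRank x :=
  ⟨by rw [adj_mul_adj, hx, adj_zero], rank_adj _ _⟩

theorem adj_inv_eq_iff {g : GL (Fin n) ℂ} {x y : Matrix (Fin n) (Fin n) ℂ} :
    adj g⁻¹ x = y ↔ x * (g : Matrix (Fin n) (Fin n) ℂ) = g * y := by
  rw [← eq_adj_iff]
  constructor
  · rintro rfl
    rw [adj_adj_inv]
  · rintro rfl
    rw [adj_inv_adj]

/-- The map `g ↦ g⁻¹.x` to the square-zero matrices of the rank of `x`. -/
def conjMap {x : Matrix (Fin n) (Fin n) ℂ} (hx : x * x = 0) (g : GL (Fin n) ℂ) :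
    squareZeroSameRank x :=
  ⟨adj g⁻¹ x, adj_inv_mem_squareZeroSameRank hx g⟩

theorem continuous_conjMap {x : Matrix (Fin n) (Fin n) ℂ} (hx : x * x = 0) :
    @Continuous _ _ (glZariski n) (@instTopologicalSpaceSubtype _ _ (matZariski n))
      (conjMap hx) := by
  let _ := matZariski n
  let _ := glZariski n
  exact Continuous.subtype_mk (continuous_adj_inv_left x) _

theorem isPreirreducible_conjMap_fiber {x : Matrix (Fin n) (Fin n) ℂ} (hx : x * x = 0)
    (y : squareZeroSameRank x) : @IsPreirreducible _ (glZariski n) (conjMap hx ⁻¹' {y}) := by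
  have h : conjMap hx ⁻¹' {y} = {g : GL (Fin n) ℂ | (g : Matrix (Fin n) (Fin n) ℂ) ∈
      {m : Matrix (Fin n) (Fin n) ℂ | x * m = m * y}} := by
    ext g
    rw [Set.mem_preimage, Set.mem_singleton_iff, Subtype.ext_iff]
    exact adj_inv_eq_iff
  rw [h]
  refine isPreirreducible_linear_section_gl _ fun a ha b hb t => ?_
  simp only [Set.mem_ofPred_eq] at ha hb ⊢
  rw [Matrix.mul_add, Matrix.mul_smul, Matrix.mul_sub, Matrix.add_mul, Matrix.smul_mul,
    Matrix.sub_mul, ha, hb]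

/-- Near g₀⁻¹.x the map has a local section y ↦ g₀ H(y) through g₀, with `H` polynomial. Membership
of g₀ H(y) in an open set is again an open condition on y. -/
theorem isOpenMap_conjMap {x : Matrix (Fin n) (Fin n) ℂ} (hx : x * x = 0) :
    @IsOpenMap _ _ (glZariski n) (@instTopologicalSpaceSubtype _ _ (matZariski n))
      (conjMap hx) := by
  let _ := matZariski n
  let _ := glZariski n
  rintro U ⟨U', hU', rfl⟩
  refine isOpen_iff_forall_mem_open.2 ?_
  rintro _ ⟨g₀, hg₀, rfl⟩
  obtain ⟨φ, hφ, hφ0, hφU⟩ := exists_polyFun_of_mem_isOpen hU' hg₀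
  have h₀ := adj_inv_mem_squareZeroSameRank hx g₀
  obtain ⟨H, hH, hH0, δ, hδ, hδ0, hconj⟩ := exists_polynomial_conjugator h₀.1
  have hdet := det_mem_subalgebra (polyFun n) H hH
  have hφ' := polyFun_comp (polyFun n) (fun y => (g₀ : Matrix (Fin n) (Fin n) ℂ) * H y)
    (mul_mem_subalgebra (polyFun n) (fun _ => (g₀ : Matrix (Fin n) (Fin n) ℂ)) H
      (fun _ _ => const_mem_polyFun _) hH) hφ
  have hψ := mul_mem (mul_mem hφ' hdet) hδ
  refine ⟨Subtype.val ⁻¹' {y | _ = (0 : ℂ)}ᶜ, ?_,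
    (isClosed_zero_polyFun hψ).isOpen_compl.preimage continuous_subtype_val, ?_⟩
  · rintro ⟨y, hy⟩ hψy
    simp only [Set.mem_preimage, Set.mem_compl_iff, Set.mem_ofPred_eq, Pi.mul_apply,
      mul_eq_zero, not_or] at hψy
    obtain ⟨⟨h1, h2⟩, h3⟩ := hψy
    refine ⟨g₀ * Matrix.GeneralLinearGroup.mkOfDetNeZero (H y) h2, hφU _ h1, Subtype.ext ?_⟩
    change adj (g₀ * _)⁻¹ x = y
    rw [mul_inv_rev, adj_mul, adj_inv_eq_iff]
    exact hconj y ⟨hy.1, hy.2.trans h₀.2.symm⟩ h3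
  · simp only [Set.mem_preimage, Set.mem_compl_iff, Set.mem_ofPred_eq, Pi.mul_apply,
      mul_eq_zero, not_or]
    change (φ (_ * H (adj g₀⁻¹ x)) ≠ 0 ∧ (H (adj g₀⁻¹ x)).det ≠ 0) ∧ δ (adj g₀⁻¹ x) ≠ 0
    rw [hH0, Matrix.mul_one, Matrix.det_one]
    exact ⟨⟨hφ0, one_ne_zero⟩, hδ0⟩

end Conjugation

/-! ## Conjugacy of square-zero matrices of the same rank -/

section Conjugacy

variable {n : ℕ} {σ τ : Equiv.Perm (Fin n)}

/-- A bijection `u` between left ends extends to right ends by sending `σ p` to `τ (u p)`, and then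
arbitrarily to fixed points. The same construction from `u⁻¹` gives the inverse. -/
theorem exists_perm_conj (hσ : σ ∈ involutions n) (hτ : τ ∈ involutions n)
    (h : linkCount σ 0 n = linkCount τ 0 n) :
    ∃ w : Equiv.Perm (Fin n), ∀ p, τ (w p) = w (σ p) ∧ (w p < τ (w p) ↔ p < σ p) := by
  have hcard : ∀ σ : Equiv.Perm (Fin n), linkCount σ 0 n = Fintype.card {p // p < σ p} := by
    intro σ
    rw [linkCount, Fintype.card_subtype]
    congr 1
    ext p
    simp
  rw [hcard, hcard] at h
  obtain ⟨u, hu⟩ : ∃ u : Equiv.Perm (Fin n), ∀ p, u p < τ (u p) ↔ p < σ p := by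
    let e := Fintype.equivOfCardEq h
    refine ⟨e.extendSubtype, fun p => ⟨fun hp => ?_, fun hp => e.extendSubtype_mem p hp⟩⟩
    by_contra hcon
    exact e.extendSubtype_not_mem p hcon hp
  let F : ∀ u σ τ : Equiv.Perm (Fin n), Fin n → Fin n := fun u σ τ p =>
    if p < σ p then u p else τ (u (σ p))
  have hF : ∀ u σ τ : Equiv.Perm (Fin n), σ ∈ involutions n → τ ∈ involutions n →
      (∀ p, u p < τ (u p) ↔ p < σ p) → ∀ p, σ p ≠ p →
      τ (F u σ τ p) = F u σ τ (σ p) ∧ (F u σ τ p < τ (F u σ τ p) ↔ p < σ p) ∧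
        τ (F u σ τ p) ≠ F u σ τ p ∧ F u⁻¹ τ σ (F u σ τ p) = p := by
    intro u σ τ hσ hτ hu p hp
    have hσσ := involution_apply_apply hσ
    have hττ := involution_apply_apply hτ
    by_cases h1 : p < σ p
    · have h2 := (hu p).2 h1
      have h3 : F u σ τ p = u p := if_pos h1
      have h4 : F u σ τ (σ p) = τ (u p) := by
        simp only [F, hσσ]
        rw [if_neg h1.not_gt]
      rw [h3, h4]
      refine ⟨rfl, by simp [h1, h2], h2.ne', ?_⟩
      simp only [F]
      rw [if_pos h2]
      simp
    · have h0 : σ p < p := lt_of_le_of_ne (not_lt.1 h1) hp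
      have h2 : u (σ p) < τ (u (σ p)) := (hu (σ p)).2 (by rwa [hσσ])
      have h3 : F u σ τ p = τ (u (σ p)) := if_neg h1
      have h4 : F u σ τ (σ p) = u (σ p) := by
        simp only [F, hσσ]
        rw [if_pos h0]
      rw [h3, h4, hττ]
      refine ⟨rfl, by simp [h1, h2.le], h2.ne, ?_⟩
      simp only [F]
      rw [hττ, if_neg h2.not_gt]
      simp [hσσ]
  have hu' : ∀ p, u⁻¹ p < σ (u⁻¹ p) ↔ p < τ p := by
    intro p
    rw [← hu]
    simp
  let e : {p // σ p ≠ p} ≃ {p // τ p ≠ p} :=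
    { toFun := fun p => ⟨F u σ τ p, (hF u σ τ hσ hτ hu p p.2).2.2.1⟩
      invFun := fun p => ⟨F u⁻¹ τ σ p, (hF u⁻¹ τ σ hτ hσ hu' p p.2).2.2.1⟩
      left_inv := fun p => Subtype.ext (hF u σ τ hσ hτ hu p p.2).2.2.2
      right_inv := fun p => Subtype.ext (by
        simpa using (hF u⁻¹ τ σ hτ hσ hu' p p.2).2.2.2) }
  refine ⟨e.extendSubtype, fun p => ?_⟩
  by_cases hp : σ p = p
  · have h1 : τ (e.extendSubtype p) = e.extendSubtype p := by
      by_contra hcon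
      exact e.extendSubtype_not_mem p (not_not.2 hp) hcon
    rw [h1, hp]
    simp
  · have hp' : σ (σ p) ≠ σ p := fun h => hp (σ.injective h)
    rw [e.extendSubtype_apply_of_mem p hp, e.extendSubtype_apply_of_mem (σ p) hp']
    obtain ⟨h1, h2, -⟩ := hF u σ τ hσ hτ hu p hp
    exact ⟨h1, h2⟩

theorem exists_adj_upperPart_eq (hσ : σ ∈ involutions n) (hτ : τ ∈ involutions n)
    (h : linkCount σ 0 n = linkCount τ 0 n) :
    ∃ g : GL (Fin n) ℂ, adj g (upperPart σ) = upperPart τ := by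
  -- Conjugation by `permGL w` turns the entry at `(w p, w q)` into the one at `(p, q)`, so `w` has
  -- to carry `τ` to `σ`.
  obtain ⟨w, hw⟩ := exists_perm_conj hτ hσ h.symm
  refine ⟨permGL w, ?_⟩
  symm
  rw [eq_adj_iff]
  change upperPart τ * w.permMatrix ℂ = w.permMatrix ℂ * upperPart σ
  ext p q
  rw [PEquiv.mul_toMatrix_toPEquiv, PEquiv.toMatrix_toPEquiv_mul]
  simp only [Matrix.submatrix_apply, id, upperPart, Matrix.of_apply]
  refine if_congr ?_ rfl rfl
  obtain ⟨q, rfl⟩ := w.surjective q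
  rw [Equiv.symm_apply_apply, (hw p).1, w.injective.eq_iff]
  refine and_congr_left ?_
  rintro rfl
  rw [← (hw p).2, (hw p).1]

theorem exists_adj_inv_eq {x y : Matrix (Fin n) (Fin n) ℂ} (hx : x ∈ squareZero n)
    (hy : y ∈ squareZero n) (h : y.rank = x.rank) : ∃ g : GL (Fin n) ℂ, adj g⁻¹ x = y := by
  obtain ⟨σ, hσ, b, _, hxσ⟩ := exists_involution_mem_borelOrbit hx.1 hx.2
  obtain ⟨τ, hτ, c, _, hyτ⟩ := exists_involution_mem_borelOrbit hy.1 hy.2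
  have hrank : linkCount σ 0 n = linkCount τ 0 n := by
    rw [← rank_upperPart hσ, ← rank_upperPart hτ, ← rank_adj b, ← hxσ, ← h, hyτ, rank_adj]
  obtain ⟨g, hg⟩ := exists_adj_upperPart_eq hσ hτ hrank
  refine ⟨(c * g * b⁻¹)⁻¹, ?_⟩
  rw [inv_inv, adj_mul, adj_mul, hxσ, adj_inv_adj, hg, hyτ]

end Conjugacy

/-! ## Components of Springer fibres -/

section Springer

variable {n : ℕ}

/-- The columns of `g` up to `m` form a basis of the flag member. By x g = g y, the matrix of the
restriction of `x` in this basis is the leading block of y = g⁻¹.x. -/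
theorem jordanBoxes_restrict_flagSpace {g : GL (Fin n) ℂ} {x : Matrix (Fin n) (Fin n) ℂ}
    (hx : adj g⁻¹ x ∈ strictlyUpper n) (m : Fin n) :
    ∃ h : ∀ v ∈ flagSpace g m, Matrix.toLin' x v ∈ flagSpace g m,
      jordanBoxes ((Matrix.toLin' x).restrict h) =
        jordanBoxes (Matrix.toLin' (principalBlock (Finset.Iic m) (adj g⁻¹ x))) := by
  set y := adj g⁻¹ x with hy
  have hxg : x * (g : Matrix (Fin n) (Fin n) ℂ) = g * y := adj_inv_eq_iff.1 hy.symm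
  set c : Finset.Iic m → Fin n → ℂ := fun k => (g : Matrix (Fin n) (Fin n) ℂ).col k with hc
  have hli : LinearIndependent ℂ c :=
    (Matrix.linearIndependent_cols_of_isUnit g.isUnit).comp _ Subtype.val_injective
  have hspan : Submodule.span ℂ (Set.range c) = flagSpace g m := by
    rw [flagSpace]
    congr 1
    ext v
    constructor
    · rintro ⟨k, rfl⟩
      exact ⟨k, Finset.mem_Iic.1 k.2, rfl⟩
    · rintro ⟨k, hk, rfl⟩
      exact ⟨⟨k, Finset.mem_Iic.2 hk⟩, rfl⟩
  let e : (Finset.Iic m → ℂ) ≃ₗ[ℂ] flagSpace g m :=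
    (Module.Basis.span hli).equivFun.symm.trans (LinearEquiv.ofEq _ _ hspan)
  have he : ∀ a, (e a : Fin n → ℂ) = ∑ k, a k • c k := by
    intro a
    simp [e, Module.Basis.equivFun_symm_apply, Module.Basis.span_apply]
  have hact : ∀ a, Matrix.toLin' x (e a) =
      e (Matrix.toLin' (principalBlock (Finset.Iic m) y) a) := by
    intro a
    have h1 : ∀ l : Finset.Iic m, x.mulVec (c l) = ∑ k : Finset.Iic m, y k l • c k := by
      intro l
      have h2 : x.mulVec (c l) = (x * (g : Matrix (Fin n) (Fin n) ℂ)).col l := rfl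
      rw [h2, hxg]
      ext i
      rw [Matrix.col_apply, Matrix.mul_apply, Finset.sum_apply,
        ← Finset.sum_subset (Finset.subset_univ (Finset.Iic m)), ← Finset.sum_coe_sort]
      · refine Finset.sum_congr rfl fun k _ => ?_
        rw [Pi.smul_apply, smul_eq_mul, mul_comm]
        rfl
      · intro k _ hk
        rw [hx k l, mul_zero]
        exact (Finset.mem_Iic.1 l.2).trans (not_le.1 fun h => hk (Finset.mem_Iic.2 h)).le
    rw [he, he, Matrix.toLin'_apply, Matrix.mulVec_sum]
    simp only [Matrix.mulVec_smul, h1, Finset.smul_sum, Matrix.toLin'_apply, Matrix.mulVec,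
      dotProduct, Finset.sum_smul]
    rw [Finset.sum_comm]
    refine Finset.sum_congr rfl fun k _ => Finset.sum_congr rfl fun l _ => ?_
    rw [smul_smul, mul_comm]
    rfl
  have hstab : ∀ v ∈ flagSpace g m, Matrix.toLin' x v ∈ flagSpace g m := by
    intro v hv
    obtain ⟨a, ha⟩ := e.surjective ⟨v, hv⟩
    have h1 := hact a
    rw [ha] at h1
    rw [h1]
    exact Subtype.prop _
  refine ⟨hstab, (jordanBoxes_congr e fun a => Subtype.ext ?_).symm⟩
  exact (hact a).symm

variable {μ : YoungDiagram}

theorem preimage_springerStratum (hμ : μ.rowLen 0 ≤ 2) (T : Tableau n μ)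
    {x : Matrix (Fin n) (Fin n) ℂ} (hx : x ∈ nilpotentOrbit n μ) :
    (fun g : GL (Fin n) ℂ => (g : FlagManifold n)) ⁻¹' springerStratum x T =
      {g | adj g⁻¹ x ∈ orbitalStratum T} := by
  have key : ∀ g : GL (Fin n) ℂ, (adj g⁻¹ x ∈ strictlyUpper n ∧
      ∀ m : Fin n, ∃ h : ∀ v ∈ flagSpace g m, Matrix.toLin' x v ∈ flagSpace g m,
        jordanBoxes ((Matrix.toLin' x).restrict h) = T.boxesUpTo m) ↔
      adj g⁻¹ x ∈ orbitalStratum T := by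
    intro g
    constructor
    · rintro ⟨h1, h2⟩
      refine ⟨h1, ?_, fun m => ?_⟩
      · rw [mem_nilpotentOrbit_iff hμ T] at hx ⊢
        rw [adj_mul_adj, hx.1, adj_zero, rank_adj]
        exact ⟨rfl, hx.2⟩
      · obtain ⟨h, hJ⟩ := jordanBoxes_restrict_flagSpace h1 m
        obtain ⟨_, hJ'⟩ := h2 m
        rw [← hJ, hJ']
    · rintro ⟨h1, _, h2⟩
      refine ⟨h1, fun m => ?_⟩
      obtain ⟨h, hJ⟩ := jordanBoxes_restrict_flagSpace h1 m
      exact ⟨h, hJ.trans (h2 m)⟩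
  ext g
  constructor
  · rintro ⟨g', hg', hgg'⟩
    have hb : g'⁻¹ * g ∈ upperGroup n := QuotientGroup.eq.1 hgg'
    refine borelOrbit_subset_orbitalStratum hμ T ((key g').1 hg') ⟨_, inv_mem hb, ?_⟩
    rw [← adj_mul]
    simp
  · exact fun hg => ⟨g, (key g).2 hg, rfl⟩

/-- Preimages under continuous open maps commute with closures; this is applied both to the quotient
map and to `conjMap`, starting from the equality of the preimages of the strata. -/
theorem preimage_springerComponent (hμ : μ.rowLen 0 ≤ 2) (T : Tableau n μ)
    {x : Matrix (Fin n) (Fin n) ℂ} (hx : x ∈ nilpotentOrbit n μ) :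
    (fun g : GL (Fin n) ℂ => (g : FlagManifold n)) ⁻¹' springerComponent x T =
      {g | adj g⁻¹ x ∈ orbitalVariety T} := by
  let _ := matZariski n
  let _ := glZariski n
  let _ := flagZariski n
  have hxx := (mem_nilpotentOrbit_iff hμ T).1 hx
  rw [springerComponent, (isOpenMap_flag n).preimage_closure_eq_closure_preimage
    continuous_coinduced_rng, preimage_springerStratum hμ T hx]
  change closure (conjMap hxx.1 ⁻¹' (Subtype.val ⁻¹' orbitalStratum T)) = _
  rw [← (isOpenMap_conjMap hxx.1).preimage_closure_eq_closure_preimage (continuous_conjMap hxx.1),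
    Topology.IsInducing.subtypeVal.closure_eq_preimage_closure_image,
    Set.image_preimage_eq_of_subset]
  · ext g
    refine (and_iff_left ((mem_nilpotentOrbit_iff hμ T).2 ?_)).symm
    have h := adj_inv_mem_squareZeroSameRank hxx.1 g
    exact ⟨h.1, h.2.trans hxx.2⟩
  · rw [Subtype.range_coe]
    intro y hy
    have h := (mem_nilpotentOrbit_iff hμ T).1 hy.2.1
    exact ⟨h.1, h.2.trans hxx.2.symm⟩

/-- Both intersections have the same preimage in `GL_n`, and irreducibility passes along each of the
two open maps with irreducible fibres. -/
theorem isIrreducible_springerComponent_inter_iff (hμ : μ.rowLen 0 ≤ 2) (T T' : Tableau n μ)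
    {x : Matrix (Fin n) (Fin n) ℂ} (hxu : x ∈ strictlyUpper n) (hx : x ∈ nilpotentOrbit n μ) :
    @IsIrreducible _ (flagZariski n) (springerComponent x T ∩ springerComponent x T') ↔
      @IsIrreducible _ (matZariski n) (orbitalVariety T ∩ orbitalVariety T') := by
  let _ := matZariski n
  let _ := glZariski n
  let _ := flagZariski n
  have hxx := (mem_nilpotentOrbit_iff hμ T).1 hx
  have hrank : ∀ y ∈ orbitalVariety T ∩ orbitalVariety T', y ∈ squareZeroSameRank x := by
    rintro y ⟨⟨_, hy⟩, _⟩
    have h := (mem_nilpotentOrbit_iff hμ T).1 hy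
    exact ⟨h.1, h.2.trans hxx.2.symm⟩
  rw [← isIrreducible_preimage_iff continuous_coinduced_rng (isOpenMap_flag n)
    isPreirreducible_flag_fiber fun ξ _ => QuotientGroup.mk_surjective ξ, Set.preimage_inter,
    preimage_springerComponent hμ T hx, preimage_springerComponent hμ T' hx]
  change IsIrreducible (conjMap hxx.1 ⁻¹' (Subtype.val ⁻¹' (orbitalVariety T ∩ orbitalVariety T')))
    ↔ _
  rw [isIrreducible_preimage_iff (continuous_conjMap hxx.1) (isOpenMap_conjMap hxx.1)
    (isPreirreducible_conjMap_fiber hxx.1)]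
  · exact isIrreducible_preimage_val_iff hrank
  · rintro ⟨y, hy⟩ hyV
    obtain ⟨g, hg⟩ := exists_adj_inv_eq ⟨hxu, hxx.1⟩
      (orbitalVariety_subset_squareZero hμ T hyV.1) hy.2
    exact ⟨g, Subtype.ext hg⟩

end Springer

end

theorem theorem3p3 (n : ℕ) :
    -- distinct involutions have disjoint `B`-orbits
    (involutions n).PairwiseDisjoint (fun ς => borelOrbit (upperPart ς)) ∧
    -- the intersection of two orbit closures, and the criterion for its irreducibility
    (∀ σ ∈ involutions n, ∀ σ' ∈ involutions n,
      closure[matZariski n] (borelOrbit (upperPart σ)) ∩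
          closure[matZariski n] (borelOrbit (upperPart σ')) =
        (⋃ ς ∈ {ς | ς ∈ involutions n ∧ EntrywiseLE (invRankMatrix ς) (minRankMatrix σ σ')},
          borelOrbit (upperPart ς)) ∧
      (@IsIrreducible _ (matZariski n)
          (closure[matZariski n] (borelOrbit (upperPart σ)) ∩
            closure[matZariski n] (borelOrbit (upperPart σ'))) ↔
        minRankMatrix σ σ' ∈ involutionRankMatrices n)) ∧
    -- the criterion for orbital varieties and for components of Springer fibers
    (∀ μ : YoungDiagram, μ.rowLen 0 ≤ 2 → ∀ T T' : Tableau n μ,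
      (@IsIrreducible _ (matZariski n) (orbitalVariety T ∩ orbitalVariety T') ↔
        minRankMatrix T.involution T'.involution ∈ involutionRankMatrices n) ∧
      (∀ x ∈ strictlyUpper n, x ∈ nilpotentOrbit n μ →
        (@IsIrreducible _ (flagZariski n) (springerComponent x T ∩ springerComponent x T') ↔
          minRankMatrix T.involution T'.involution ∈ involutionRankMatrices n))) := by
  refine ⟨borelOrbit_pairwiseDisjoint n, fun σ hσ σ' hσ' =>
    ⟨closure_inter_closure_eq_iUnion hσ hσ', isIrreducible_closure_inter_closure_iff hσ hσ'⟩,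
    fun μ hμ T T' => ⟨isIrreducible_orbitalVariety_inter_iff hμ T T', fun x hxu hx => ?_⟩⟩
  rw [isIrreducible_springerComponent_inter_iff hμ T T' hxu hx]
  exact isIrreducible_orbitalVariety_inter_iff hμ T T'
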